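/- Let $L=\sum_{i,j=1}^N a_{ij}\partial_i\partial_j+\sum_{i=1}^N b_i\partial_i+c$ be a differential operator on $\mathbb R^N$ whose coefficients are real valued and lie in $C_b^\infty(\mathbb R^N)$ (bounded together with all derivatives), with $A=[a_{ij}]$ symmetric and $\sum_{i,j} a_{ij}(x)\xi_i\xi_j\ge\gamma|\xi|^2$ for all $x,\xi\in\mathbb R^N$ and some $\gamma>0$. For $w\in\mathbb R^N$, write $g^{s,w}(x)=g(w+s(x-w))$ and let $$L^{s,w}=\sum_{i,j} a_{ij}^{s,w}\partial_i\partial_j+s\sum_i b_i^{s,w}\partial_i+s^2c^{s,w},\qquad L_m^w=\frac1{m!}\frac{d^m}{ds^m}L^{s,w}\Big|_{s=0},\quad m\ge 0,$$ so that $L_0^w=\sum_{i,j} a_{ij}(w)\partial_i\partial_j$. Let $e^{tL_0^w}$, $t\ge0$, be the solution operator of $\partial_tu=L_0^wu$ in $L^p(\mathbb R^N)$, $1<p<\infty$. Let $1\le k\le n$ and let $\alpha=(\alpha_1,\dots,\alpha_k)$ be positive integers with $\alpha_j\le n$ for all $j$. With $\Sigma_k=\{\tau\in\mathbb R^{k+1}:\tau_j\ge0,\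 \sum_{j=0}^k\tau_j=1\}$ parametrized by $1\ge\sigma_1\ge\dots\ge\sigma_k\ge0$, $\sigma_j=\tau_j+\dots+\tau_k$, and $d\tau=d\sigma$, set $$\Lambda_{\alpha,w}=\int_{\Sigma_k}e^{\tau_0L_0^w}L_{\alpha_1}^we^{\tau_1L_0^w}L_{\alpha_2}^w\cdots L_{\alpha_k}^we^{\tau_kL_0^w}\,d\tau .$$ Let $z:\mathbb R^N\times\mathbb R^N\to\mathbb R^N$ be admissible: smooth, with $z(x,x)=x$ for all $x$ and all derivatives of positive order bounded. Then the operators $\Lambda_{\alpha,w}$, $w\in\mathbb R^N$, are well defined on Schwartz functions and have smooth kernels $\Lambda_{\alpha,w}(x,y)$. For $s\in(0,1]$ let $$\mathcal L_{s,\alpha}f(x)=s^{-N}\int_{\mathbb R^N}\Lambda_{\alpha,z}\big(z+s^{-1}(x-z),\,z+s^{-1}(y-z)\big)f(y)\,dy,\qquad z=z(x,y).$$ There exists a family $\{a_s\}_{s\in(0,1]}$, uniformly bounded in $S^{-\infty}(\mathbb R^N\times\mathbb R^N)$, such that, with $b_s(x,\xi)=a_s(x,s\xi)$, $$\mathcal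 L_{s,\alpha}=b_s(x,D)\qquad\text{on Schwartz functions, for every } s\in(0,1].$$ Here uniformly bounded means that each $a_s$ is smooth and that, for every $m\in\mathbb Z$ and all multi-indices $\beta,\beta'$, $$\sup_{s\in(0,1]}\ \sup_{x,\xi}\ (1+|\xi|^2)^{(|\beta'|-m)/2}\,|\partial_x^\beta\partial_\xi^{\beta'}a_s(x,\xi)|<\infty ,$$ and $b(x,D)u(x)=(2\pi)^{-N}\int e^{ix\cdot\xi}\,b(x,\xi)\,\hat u(\xi)\,d\xi$ with $\hat u(\xi)=\int e^{-i\xi\cdot x}u(x)\,dx$. -/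

import Mathlib

open MeasureTheory Filter Set Topology
open scoped ContDiff SchwartzMap ENNReal

noncomputable section

/-- The space `ℝ^N` with its Euclidean norm. -/
abbrev Eucl (N : ℕ) : Type := EuclideanSpace ℝ (Fin N)

namespace DysonTaylor

variable {N : ℕ}

/-- The partial derivative `∂_i g`. -/
def partialD {F : Type*} [NormedAddCommGroup F] [NormedSpace ℝ F]
    (i : Fin N) (g : Eucl N → F) : Eucl N → F :=
  fun x => fderiv ℝ g x (EuclideanSpace.single i (1 : ℝ))

/-- The iterated partial derivative `∂_{i₁} ⋯ ∂_{iᵣ} g` for a list `I = [i₁, …, iᵣ]` of coordinate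
indices. On smooth functions it is `∂^α g`, where `α_i` is the number of occurrences of `i` in `I`
and `|α|` is the length of `I`; every multi-index `α` arises in this way. -/
def iterPartialD {F : Type*} [NormedAddCommGroup F] [NormedSpace ℝ F]
    (I : List (Fin N)) (g : Eucl N → F) : Eucl N → F :=
  I.foldr partialD g

/-- `C_b^∞(ℝ^N)`, real valued: smooth functions bounded together with all their derivatives. -/
def IsCbInfty (g : Eucl N → ℝ) : Prop :=
  ContDiff ℝ ∞ g ∧ ∀ m : ℕ, ∃ C : ℝ, ∀ x, ‖iteratedFDeriv ℝ m g x‖ ≤ C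

/-! ### Second order differential operators -/

/-- The coefficients of a differential operator `∑ a_{ij} ∂_i ∂_j + ∑ b_i ∂_i + c`. -/
structure SecondOrderOp (N : ℕ) where
  /-- the second order coefficients -/
  a : Fin N → Fin N → Eucl N → ℝ
  /-- the first order coefficients -/
  b : Fin N → Eucl N → ℝ
  /-- the zero order coefficient -/
  c : Eucl N → ℝ

namespace SecondOrderOp

/-- The action of `∑ a_{ij} ∂_i ∂_j + ∑ b_i ∂_i + c` on complex valued functions. -/
def act (L : SecondOrderOp N) (u : Eucl N → ℂ) : Eucl N → ℂ := fun x =>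
  (∑ i, ∑ j, (L.a i j x : ℂ) * partialD i (partialD j u) x)
    + (∑ i, (L.b i x : ℂ) * partialD i u x) + (L.c x : ℂ) * u x

/-- The class `𝕃_γ`: coefficients in `C_b^∞`, symmetric second order part, and uniform strong
ellipticity with constant `γ`. -/
structure IsElliptic (L : SecondOrderOp N) (γ : ℝ) : Prop where
  smooth_a : ∀ i j, IsCbInfty (L.a i j)
  smooth_b : ∀ i, IsCbInfty (L.b i)
  smooth_c : IsCbInfty L.c
  symm : ∀ i j x, L.a i j x = L.a j i x
  elliptic : ∀ x ξ : Eucl N, γ * ‖ξ‖ ^ 2 ≤ ∑ i, ∑ j, L.a i j x * ξ i * ξ j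

/-- The dilated operator `L^{s,z} = ∑ a_{ij}^{s,z} ∂_i ∂_j + s ∑ b_i^{s,z} ∂_i + s² c^{s,z}`,
where `g^{s,z}(x) = g (z + s (x - z))`. -/
def dilate (L : SecondOrderOp N) (s : ℝ) (z : Eucl N) : SecondOrderOp N where
  a := fun i j x => L.a i j (z + s • (x - z))
  b := fun i x => s * L.b i (z + s • (x - z))
  c := fun x => s ^ 2 * L.c (z + s • (x - z))

/-- The Taylor coefficient `L_m^z = (1 / m!) (d/ds)^m L^{s,z} |_{s = 0}`. -/
def taylorCoeff (L : SecondOrderOp N) (z : Eucl N) (m : ℕ) : SecondOrderOp N where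
  a := fun i j x => iteratedDeriv m (fun s => (L.dilate s z).a i j x) 0 / (m.factorial : ℝ)
  b := fun i x => iteratedDeriv m (fun s => (L.dilate s z).b i x) 0 / (m.factorial : ℝ)
  c := fun x => iteratedDeriv m (fun s => (L.dilate s z).c x) 0 / (m.factorial : ℝ)

end SecondOrderOp

/-! ### The solution operator `e^{tL}` -/

/-- Continuity on the set `J` of times, as a map into `L^p(ℝ^N)`. -/
def ContinuousInLp (p : ℝ≥0∞) (J : Set ℝ) (v : ℝ → Eucl N → ℂ) : Prop :=
  (∀ t ∈ J, MemLp (v t) p volume) ∧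
    ∀ t ∈ J, Tendsto (fun τ => eLpNorm (v τ - v t) p volume) (𝓝[J] t) (𝓝 0)

/-- `u` is a classical solution in `L^p(ℝ^N)` of `∂_t u = L u`, `u(0) = f`:
`u ∈ C([0,∞), L^p) ∩ C¹((0,∞), L^p) ∩ C((0,∞), W^{2,p})`. The elements `u(t)` of `L^p` are
represented by functions that are twice continuously differentiable for `t > 0`, so that the
derivatives that occur in `W^{2,p}` and in `L u(t)` are ordinary partial derivatives. The last
field says that `u'(t) = L u(t)`, with the derivative taken in `L^p`; for an `L` with bounded
continuous coefficients `L u` is continuous into `L^p` by the fields before it. -/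
structure IsClassicalSolution (p : ℝ≥0∞) (L : SecondOrderOp N) (f : Eucl N → ℂ)
    (u : ℝ → Eucl N → ℂ) : Prop where
  initial : u 0 = f
  contDiff : ∀ t, 0 < t → ContDiff ℝ 2 (u t)
  continuous_Lp : ContinuousInLp p (Ici 0) u
  continuous_first : ∀ i, ContinuousInLp p (Ioi 0) (fun t => partialD i (u t))
  continuous_second : ∀ i j, ContinuousInLp p (Ioi 0) (fun t => partialD i (partialD j (u t)))
  equation : ∀ t, 0 < t →
    Tendsto (fun τ => eLpNorm ((τ - t)⁻¹ • (u τ - u t) - L.act (u t)) p volume)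
      (𝓝[≠] t) (𝓝 0)

open Classical in
/-- The solution operator `e^{tL}`, for `t ≥ 0`: `e^{tL} f = u(t)`, with `u` the classical solution
in `L^p` with initial datum `f`. -/
def expL (p : ℝ≥0∞) (L : SecondOrderOp N) (t : ℝ) (f : Eucl N → ℂ) : Eucl N → ℂ :=
  if h : ∃ u, IsClassicalSolution p L f u then h.choose t else 0

/-! ### The operators `Λ_{α,z}` -/

/-- `𝔄_{k,ℓ}`: the `(α_1, …, α_k)` with `α_j ≥ 1` and `α_1 + ⋯ + α_k = ℓ`. -/
def indexSet (k l : ℕ) : Set (Fin k → ℕ) := {α | (∀ j, 1 ≤ α j) ∧ ∑ j, α j = l}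

/-- The unit simplex `Σ_k` in the coordinates `1 ≥ σ_1 ≥ ⋯ ≥ σ_k ≥ 0`. -/
def simplex (k : ℕ) : Set (Fin k → ℝ) := {σ | Antitone σ ∧ ∀ j, σ j ∈ Icc (0 : ℝ) 1}

/-- The coordinates `(τ_0, …, τ_k) = (1 - σ_1, σ_1 - σ_2, …, σ_{k-1} - σ_k, σ_k)`. -/
def tau {k : ℕ} (σ : Fin k → ℝ) : Fin (k + 1) → ℝ := fun j =>
  let e : Fin (k + 2) → ℝ := Fin.cons (α := fun _ => ℝ) 1 (Fin.snoc (α := fun _ => ℝ) σ 0)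
  e j.castSucc - e j.succ

/-- The product `S(τ_0) V_1 S(τ_1) V_2 ⋯ V_k S(τ_k)` of operators on functions. -/
def dysonProduct (S : ℝ → (Eucl N → ℂ) → Eucl N → ℂ) :
    (k : ℕ) → (Fin k → (Eucl N → ℂ) → Eucl N → ℂ) → (Fin (k + 1) → ℝ) →
      (Eucl N → ℂ) → Eucl N → ℂ
  | 0, _, τ, f => S (τ 0) f
  | k + 1, V, τ, f => S (τ 0) (V 0 (dysonProduct S k (Fin.tail V) (Fin.tail τ) f))

/-- `e^{τ_0 L_0^z} L_{α_1}^z e^{τ_1 L_0^z} ⋯ L_{α_k}^z e^{τ_k L_0^z}` at the point of `Σ_k` with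
coordinates `σ`. -/
def dysonIntegrand (p : ℝ≥0∞) (L : SecondOrderOp N) {k : ℕ} (α : Fin k → ℕ) (z : Eucl N)
    (σ : Fin k → ℝ) : (Eucl N → ℂ) → Eucl N → ℂ :=
  dysonProduct (expL p (L.taylorCoeff z 0)) k (fun j => (L.taylorCoeff z (α j)).act) (tau σ)

/-- `Λ_{α,z} = ∫_{Σ_k} e^{τ_0 L_0^z} L_{α_1}^z e^{τ_1 L_0^z} ⋯ L_{α_k}^z e^{τ_k L_0^z} dτ`. -/
def Lam (p : ℝ≥0∞) (L : SecondOrderOp N) {k : ℕ} (α : Fin k → ℕ) (z : Eucl N)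
    (f : Eucl N → ℂ) : Eucl N → ℂ := fun x =>
  ∫ σ in simplex k, dysonIntegrand p L α z σ f x

/-- `K` is a smooth kernel of the operator `T`: `T f (x) = ∫ K(x, y) f(y) dy` for all Schwartz
functions `f`. Such a `K` is unique. -/
def IsSmoothKernel (T : (Eucl N → ℂ) → Eucl N → ℂ) (K : Eucl N → Eucl N → ℂ) : Prop :=
  ContDiff ℝ ∞ (fun q : Eucl N × Eucl N => K q.1 q.2) ∧
    ∀ (f : 𝓢(Eucl N, ℂ)) (x : Eucl N),
      Integrable (fun y => K x y * f y) volume ∧ T f x = ∫ y, K x y * f y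

open Classical in
/-- The smooth kernel `T(x, y)` of an operator `T` that has one. -/
def kernelOf (T : (Eucl N → ℂ) → Eucl N → ℂ) : Eucl N → Eucl N → ℂ :=
  if h : ∃ K, IsSmoothKernel T K then h.choose else 0

/-! ### The rescaled operators `𝓛_{s,α}` -/

/-- Admissible dilation centres: smooth, `z(x, x) = x`, and all derivatives of positive order
bounded. -/
def Admissible (z : Eucl N → Eucl N → Eucl N) : Prop :=
  ContDiff ℝ ∞ (fun q : Eucl N × Eucl N => z q.1 q.2) ∧ (∀ x, z x x = x) ∧
    ∀ m : ℕ, 1 ≤ m → ∃ C : ℝ, ∀ q : Eucl N × Eucl N,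
      ‖iteratedFDeriv ℝ m (fun q : Eucl N × Eucl N => z q.1 q.2) q‖ ≤ C

/-- The kernel `s^{-N} Λ_{α,z}(z + s⁻¹(x - z), z + s⁻¹(y - z))`, `z = z(x, y)`. -/
def rescaledKernel (p : ℝ≥0∞) (L : SecondOrderOp N) {k : ℕ} (α : Fin k → ℕ)
    (z : Eucl N → Eucl N → Eucl N) (s : ℝ) (x y : Eucl N) : ℂ :=
  ((s ^ N)⁻¹ : ℝ) * kernelOf (Lam p L α (z x y))
    (z x y + s⁻¹ • (x - z x y)) (z x y + s⁻¹ • (y - z x y))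

/-- The operator `𝓛_{s,α}` with kernel `rescaledKernel`. -/
def rescaledOp (p : ℝ≥0∞) (L : SecondOrderOp N) {k : ℕ} (α : Fin k → ℕ)
    (z : Eucl N → Eucl N → Eucl N) (s : ℝ) (f : Eucl N → ℂ) : Eucl N → ℂ := fun x =>
  ∫ y, rescaledKernel p L α z s x y * f y

/-! ### Pseudodifferential operators -/

/-- The Fourier transform `û(ξ) = ∫ e^{-i ξ·x} u(x) dx`. -/
def fourierHat (u : Eucl N → ℂ) : Eucl N → ℂ := fun ξ =>
  ∫ x, Complex.exp (-Complex.I * (inner ℝ ξ x : ℝ)) * u x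

/-- The operator `a(x, D) u (x) = (2π)^{-N} ∫ e^{i x·ξ} a(x, ξ) û(ξ) dξ`. -/
def psdo (a : Eucl N → Eucl N → ℂ) (u : Eucl N → ℂ) : Eucl N → ℂ := fun x =>
  (((2 * Real.pi) ^ N)⁻¹ : ℝ) *
    ∫ ξ, Complex.exp (Complex.I * (inner ℝ x ξ : ℝ)) * a x ξ * fourierHat u ξ

/-- `⟨ξ⟩ = (1 + |ξ|²)^{1/2}`. -/
def japanese (ξ : Eucl N) : ℝ := Real.sqrt (1 + ‖ξ‖ ^ 2)

/-- The derivative `∂_x^I ∂_ξ^J a`. -/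
def mixedD (I J : List (Fin N)) (a : Eucl N → Eucl N → ℂ) (x ξ : Eucl N) : ℂ :=
  iterPartialD I (fun x' => iterPartialD J (a x') ξ) x

/-- The family `(a_s)_{s ∈ J}` consists of elements of `S^{-∞}(ℝ^N × ℝ^N)` and is uniformly bounded
there: for each `m ∈ ℤ` and each pair of multi-indices, the seminorms
`sup ⟨ξ⟩^{|β| - m} |∂_x^α ∂_ξ^β a_s(x, ξ)|` are bounded uniformly in `s ∈ J`. -/
def UniformlyBoundedInSNegInfty (J : Set ℝ) (a : ℝ → Eucl N → Eucl N → ℂ) : Prop :=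
  (∀ s ∈ J, ContDiff ℝ ∞ (fun q : Eucl N × Eucl N => a s q.1 q.2)) ∧
    ∀ (m : ℤ) (I I' : List (Fin N)), ∃ C : ℝ, ∀ s ∈ J, ∀ x ξ : Eucl N,
      japanese ξ ^ ((I'.length : ℤ) - m) * ‖mixedD I I' (a s) x ξ‖ ≤ C

end DysonTaylor

end

open MeasureTheory Filter Set Topology
open scoped ContDiff SchwartzMap ENNReal

noncomputable section

/-! The Taylor coefficient `L_m^w` is a differential operator whose coefficients are polynomials in
`x - w`, with coefficients in `C_b^∞` as functions of `w`. On Schwartz functions `e^{tL_0^w}` is the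
Fourier multiplier `heat (A w) t`: the multiplier gives a classical solution, and a duality argument
shows that there is no other one (`expL_constOp`). Conjugating multiplication by a coordinate with
this semigroup costs only a first order term, `e^{tL_0}(x_i - w_i) = ((x_i - w_i) + 2t ∑_j A_ij ∂_j)
e^{tL_0}` (`heat_xCLM`). Hence all semigroups in the Dyson product can be moved to the right, where
their times add up to 1 (`dysonProduct_eq`). What remains is a differential operator, polynomial in
`x - w` and in the simplex variables, applied to `e^{L_0^w}`. The degenerate times at the boundary
of the simplex therefore cause no singularity, and the kernel is a smooth function of `(σ, w, x - w,
x - y)`, rapidly decreasing in `x - y` and of polynomial growth in `x - w`, uniformly in `w`.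
Integration over the compact simplex preserves this (`exists_kernel_Lam`) and gives a kernel `K(w, x
- w, x - y)` of `Λ_{α,w}`.

For the rescaled operator put `v = (x - y)/s`. Its kernel is `s^{-N} H_s(x, v)` with `H_s(x, v) =
K(z, (x - z)/s, v)` and `z = z(x, x - sv)`. Since `z(x, x) = x`, the second argument is the
difference quotient `(z(x, x) - z(x, x - sv))/s`. It is `O(|v|)`, and its derivatives are `O(1 +
|v|)`, uniformly in `s`; so the rapid decay of `K` in `v` absorbs its growth in `x - w`, and `H_s`
is uniformly Schwartz in `v` (`unifSchwartz_comp_rescaleMap`). An operator with kernel `s^{-N}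
H_s(x, (x - y)/s)` has symbol `a_s(x, sξ)` with `a_s(x, ξ) = ∫ e^{-iξ·v} H_s(x, v) dv`
(`psdo_fourier_slice`), and a partial Fourier transform preserves uniformly Schwartz families
(`UnifSchwartz.partialFourier`).

The bookkeeping rests on the order of quantifiers in `UnifRapid`: the power of the growth weight is
fixed before the order of decay. This allows the growth weight to be traded for powers of the decay
weight. -/

namespace DysonTaylor

/-! ### Uniform families of symbols -/

section Families

variable {ι ι' Q Q' E F G : Type*} [NormedAddCommGroup Q] [NormedSpace ℝ Q]
  [NormedAddCommGroup Q'] [NormedSpace ℝ Q'] [NormedAddCommGroup E] [NormedSpace ℝ E]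
  [NormedAddCommGroup F] [NormedSpace ℝ F] [NormedAddCommGroup G] [NormedSpace ℝ G]

/-- A family of smooth functions all of whose derivatives are bounded by powers of `ρ`, uniformly
in the family. -/
def UnifTemperate (ρ : Q → ℝ) (f : ι → Q → F) : Prop :=
  (∀ i, ContDiff ℝ ∞ (f i)) ∧
    ∀ n : ℕ, ∃ (k : ℕ) (C : ℝ), ∀ i q, ‖iteratedFDeriv ℝ n (f i) q‖ ≤ C * ρ q ^ k

/-- A family of smooth functions all of whose derivatives decay faster than every power of `η`,
up to powers of `ρ` that depend only on the order of the derivative. -/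
def UnifRapid (ρ η : Q → ℝ) (f : ι → Q → F) : Prop :=
  (∀ i, ContDiff ℝ ∞ (f i)) ∧
    ∀ n : ℕ, ∃ k : ℕ, ∀ m : ℕ, ∃ C : ℝ, ∀ i q,
      η q ^ m * ‖iteratedFDeriv ℝ n (f i) q‖ ≤ C * ρ q ^ k

variable {ρ η : Q → ℝ}

theorem exists_common_bound {α : Type*} {N : ℕ → α → ℝ} {ρ : α → ℝ} (hρ : ∀ q, 1 ≤ ρ q)
    (h : ∀ n, ∃ (k : ℕ) (C : ℝ), ∀ q, N n q ≤ C * ρ q ^ k) (n : ℕ) :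
    ∃ (k : ℕ) (C : ℝ), 0 ≤ C ∧ ∀ j ≤ n, ∀ q, N j q ≤ C * ρ q ^ k := by
  choose k C hC using h
  refine ⟨(Finset.range (n + 1)).sup k, ∑ j ∈ Finset.range (n + 1), |C j|,
    Finset.sum_nonneg fun _ _ => abs_nonneg _, fun j hj q => (hC j q).trans ?_⟩
  have hj' : j ∈ Finset.range (n + 1) := Finset.mem_range.2 (by omega)
  have h0 : 0 ≤ ρ q := zero_le_one.trans (hρ q)
  calc C j * ρ q ^ k j ≤ |C j| * ρ q ^ k j := by gcongr; exact le_abs_self _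
    _ ≤ |C j| * ρ q ^ (Finset.range (n + 1)).sup k := by
        gcongr
        · exact hρ q
        · exact Finset.le_sup (f := k) hj'
    _ ≤ _ := by
        gcongr
        exact Finset.single_le_sum (f := fun j => |C j|) (fun _ _ => abs_nonneg _) hj'

theorem UnifTemperate.exists_bound {f : ι → Q → F} (hf : UnifTemperate ρ f) (hρ : ∀ q, 1 ≤ ρ q)
    (n : ℕ) : ∃ (k : ℕ) (C : ℝ), 0 ≤ C ∧ ∀ j ≤ n, ∀ i q,
      ‖iteratedFDeriv ℝ j (f i) q‖ ≤ C * ρ q ^ k := by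
  obtain ⟨k, C, hC, h⟩ := exists_common_bound
    (N := fun n (x : ι × Q) => ‖iteratedFDeriv ℝ n (f x.1) x.2‖) (ρ := fun x : ι × Q => ρ x.2)
    (fun q => hρ _) (fun n => (hf.2 n).imp fun k => Exists.imp fun C h q => h _ _) n
  exact ⟨k, C, hC, fun j hj i q => h j hj (i, q)⟩

theorem UnifRapid.exists_bound {f : ι → Q → F} (hf : UnifRapid ρ η f) (hρ : ∀ q, 1 ≤ ρ q)
    (n : ℕ) : ∃ k : ℕ, ∀ m : ℕ, ∃ C : ℝ, 0 ≤ C ∧ ∀ j ≤ n, ∀ i q,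
      η q ^ m * ‖iteratedFDeriv ℝ j (f i) q‖ ≤ C * ρ q ^ k := by
  choose k C hC using hf.2
  refine ⟨(Finset.range (n + 1)).sup k, fun m => ⟨∑ j ∈ Finset.range (n + 1), |C j m|,
    Finset.sum_nonneg fun _ _ => abs_nonneg _, fun j hj i q => (hC j m i q).trans ?_⟩⟩
  have hj' : j ∈ Finset.range (n + 1) := Finset.mem_range.2 (by omega)
  have h0 : 0 ≤ ρ q := zero_le_one.trans (hρ q)
  calc C j m * ρ q ^ k j ≤ |C j m| * ρ q ^ k j := by gcongr; exact le_abs_self _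
    _ ≤ |C j m| * ρ q ^ (Finset.range (n + 1)).sup k := by
        gcongr
        · exact hρ q
        · exact Finset.le_sup (f := k) hj'
    _ ≤ _ := by
        gcongr
        exact Finset.single_le_sum (f := fun j => |C j m|) (fun _ _ => abs_nonneg _) hj'

theorem UnifRapid.reindex {f : ι → Q → F} (hf : UnifRapid ρ η f) (e : ι' → ι) :
    UnifRapid ρ η (fun i => f (e i)) :=
  ⟨fun i => hf.1 (e i), fun n => (hf.2 n).imp fun _ h m => (h m).imp fun _ h i => h (e i)⟩

theorem UnifRapid.unifTemperate {f : ι → Q → F} (hf : UnifRapid ρ η f) : UnifTemperate ρ f :=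
  ⟨hf.1, fun n => (hf.2 n).imp fun k h => (h 0).imp fun C h i q => by simpa using h i q⟩

theorem UnifTemperate.mono {ρ' : Q → ℝ} {f : ι → Q → F} (hf : UnifTemperate ρ f)
    (hρ : ∀ q, 1 ≤ ρ q) (h : ∃ (k : ℕ) (C : ℝ), ∀ q, ρ q ≤ C * ρ' q ^ k) :
    UnifTemperate ρ' f := by
  obtain ⟨k, C, hC⟩ := h
  refine ⟨hf.1, fun n => ?_⟩
  obtain ⟨l, D, hD, h⟩ := hf.exists_bound hρ n
  refine ⟨k * l, D * C ^ l, fun i q => (h n le_rfl i q).trans ?_⟩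
  have h0 : 0 ≤ ρ q := zero_le_one.trans (hρ q)
  calc D * ρ q ^ l ≤ D * (C * ρ' q ^ k) ^ l := by gcongr; exact hC q
    _ = _ := by ring

theorem unifTemperate_const (c : ι → F) (hc : ∃ C, ∀ i, ‖c i‖ ≤ C) :
    UnifTemperate ρ (fun i (_ : Q) => c i) := by
  obtain ⟨C, hC⟩ := hc
  refine ⟨fun i => contDiff_const, fun n => ⟨0, max C 0, fun i q => ?_⟩⟩
  rcases n with _ | n
  · simpa using Or.inl (hC i)
  · rw [iteratedFDeriv_const_of_ne (by omega)]
    simp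

theorem unifTemperate_clm (ℓ : ι → Q →L[ℝ] F) {B : ℝ} (hB : ∀ i, ‖ℓ i‖ ≤ B)
    {C : ℝ} (hC : ∀ i q, ‖ℓ i q‖ ≤ C * ρ q) :
    UnifTemperate ρ (fun i q => ℓ i q) := by
  refine ⟨fun i => (ℓ i).contDiff, fun n => ?_⟩
  rcases n with _ | _ | n
  · exact ⟨1, C, fun i q => by simpa using hC i q⟩
  · refine ⟨0, B, fun i q => ?_⟩
    rw [zero_add, norm_iteratedFDeriv_one]
    simpa using hB i
  · refine ⟨0, 0, fun i q => ?_⟩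
    rw [← norm_iteratedFDeriv_fderiv]
    have : fderiv ℝ (fun q => ℓ i q) = fun _ => ℓ i := by ext1 q; simp
    rw [this, iteratedFDeriv_const_of_ne (by omega)]
    simp

theorem UnifTemperate.add {f g : ι → Q → F} (hf : UnifTemperate ρ f) (hg : UnifTemperate ρ g)
    (hρ : ∀ q, 1 ≤ ρ q) : UnifTemperate ρ (fun i q => f i q + g i q) := by
  refine ⟨fun i => (hf.1 i).add (hg.1 i), fun n => ?_⟩
  obtain ⟨k, C, hC, h⟩ := hf.exists_bound hρ n
  obtain ⟨l, D, hD, h'⟩ := hg.exists_bound hρ n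
  refine ⟨max k l, C + D, fun i q => ?_⟩
  have hfg : iteratedFDeriv ℝ n (fun q => f i q + g i q) q = iteratedFDeriv ℝ n (f i) q
      + iteratedFDeriv ℝ n (g i) q :=
    iteratedFDeriv_add_apply ((hf.1 i).of_le (by exact_mod_cast le_top)).contDiffAt
      ((hg.1 i).of_le (by exact_mod_cast le_top)).contDiffAt
  rw [hfg]
  refine (norm_add_le _ _).trans ?_
  rw [add_mul]
  refine add_le_add ((h n le_rfl i q).trans ?_) ((h' n le_rfl i q).trans ?_)
  · gcongr
    · exact hρ q
    · exact le_max_left _ _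
  · gcongr
    · exact hρ q
    · exact le_max_right _ _

theorem UnifRapid.add {f g : ι → Q → F} (hf : UnifRapid ρ η f) (hg : UnifRapid ρ η g)
    (hρ : ∀ q, 1 ≤ ρ q) (hη : ∀ q, 1 ≤ η q) : UnifRapid ρ η (fun i q => f i q + g i q) := by
  refine ⟨fun i => (hf.1 i).add (hg.1 i), fun n => ?_⟩
  obtain ⟨k, h⟩ := hf.exists_bound hρ n
  obtain ⟨l, h'⟩ := hg.exists_bound hρ n
  refine ⟨max k l, fun m => ?_⟩
  obtain ⟨C, hC, h⟩ := h m
  obtain ⟨D, hD, h'⟩ := h' m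
  refine ⟨C + D, fun i q => ?_⟩
  have h0 : 0 ≤ η q := zero_le_one.trans (hη q)
  have hfg : iteratedFDeriv ℝ n (fun q => f i q + g i q) q = iteratedFDeriv ℝ n (f i) q
      + iteratedFDeriv ℝ n (g i) q :=
    iteratedFDeriv_add_apply ((hf.1 i).of_le (by exact_mod_cast le_top)).contDiffAt
      ((hg.1 i).of_le (by exact_mod_cast le_top)).contDiffAt
  rw [hfg]
  refine (mul_le_mul_of_nonneg_left (norm_add_le _ _) (by positivity)).trans ?_
  rw [add_mul, mul_add]
  refine add_le_add ((h n le_rfl i q).trans ?_) ((h' n le_rfl i q).trans ?_)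
  · gcongr
    · exact hρ q
    · exact le_max_left _ _
  · gcongr
    · exact hρ q
    · exact le_max_right _ _

theorem UnifTemperate.sum {J : Type*} {s : Finset J} {f : J → ι → Q → F} (hρ : ∀ q, 1 ≤ ρ q)
    (hf : ∀ j ∈ s, UnifTemperate ρ (f j)) : UnifTemperate ρ (fun i q => ∑ j ∈ s, f j i q) := by
  classical
  induction s using Finset.induction_on with
  | empty => simpa using unifTemperate_const (ι := ι) (ρ := ρ) (fun _ => (0 : F)) ⟨0, by simp⟩
  | insert a s ha ih =>
    simp only [Finset.sum_insert ha]
    exact (hf a (by simp)).add (ih fun j hj => hf j (by simp [hj])) hρ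

theorem UnifTemperate.bilinear {f : ι → Q → E} {g : ι → Q → F} (B : E →L[ℝ] F →L[ℝ] G)
    (hf : UnifTemperate ρ f) (hg : UnifTemperate ρ g) (hρ : ∀ q, 1 ≤ ρ q) :
    UnifTemperate ρ (fun i q => B (f i q) (g i q)) := by
  refine ⟨fun i => B.isBoundedBilinearMap.contDiff.comp ((hf.1 i).prodMk (hg.1 i)), fun n => ?_⟩
  obtain ⟨k, C, hC, h⟩ := hf.exists_bound hρ n
  obtain ⟨l, D, hD, h'⟩ := hg.exists_bound hρ n
  refine ⟨k + l, ‖B‖ * ∑ j ∈ Finset.range (n + 1), (n.choose j : ℝ) * C * D, fun i q => ?_⟩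
  have h0 : 0 ≤ ρ q := zero_le_one.trans (hρ q)
  refine (B.norm_iteratedFDeriv_le_of_bilinear (hf.1 i) (hg.1 i) q
    (by exact_mod_cast le_top)).trans ?_
  rw [mul_assoc, Finset.sum_mul]
  refine mul_le_mul_of_nonneg_left (Finset.sum_le_sum fun j hj => ?_) (norm_nonneg B)
  calc (n.choose j : ℝ) * ‖iteratedFDeriv ℝ j (f i) q‖ * ‖iteratedFDeriv ℝ (n - j) (g i) q‖
      ≤ (n.choose j : ℝ) * (C * ρ q ^ k) * (D * ρ q ^ l) := by
        gcongr
        · exact h j (by simpa [Nat.lt_succ_iff] using hj) i q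
        · exact h' (n - j) (by omega) i q
    _ = _ := by ring

/-- The product of a family of growth `ρ η` and a rapidly decreasing family. -/
theorem UnifRapid.bilinear {f : ι → Q → E} {g : ι → Q → F} (B : E →L[ℝ] F →L[ℝ] G)
    (hf : UnifTemperate (fun q => ρ q * η q) f) (hg : UnifRapid ρ η g) (hρ : ∀ q, 1 ≤ ρ q)
    (hη : ∀ q, 1 ≤ η q) : UnifRapid ρ η (fun i q => B (f i q) (g i q)) := by
  refine ⟨fun i => B.isBoundedBilinearMap.contDiff.comp ((hf.1 i).prodMk (hg.1 i)), fun n => ?_⟩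
  obtain ⟨k, C, hC, h⟩ := hf.exists_bound (fun q => one_le_mul_of_one_le_of_one_le (hρ q) (hη q)) n
  obtain ⟨l, h'⟩ := hg.exists_bound hρ n
  refine ⟨k + l, fun m => ?_⟩
  -- The `k` additional orders of decay of `g` pay for the factor `η ^ k` in the growth of `f`.
  obtain ⟨D, hD, h'⟩ := h' (m + k)
  refine ⟨‖B‖ * ∑ j ∈ Finset.range (n + 1), (n.choose j : ℝ) * C * D, fun i q => ?_⟩
  have h0 : 0 ≤ ρ q := zero_le_one.trans (hρ q)
  have h1 : 0 ≤ η q := zero_le_one.trans (hη q)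
  refine (mul_le_mul_of_nonneg_left (B.norm_iteratedFDeriv_le_of_bilinear (hf.1 i) (hg.1 i) q
    (by exact_mod_cast le_top)) (by positivity)).trans ?_
  rw [mul_assoc, Finset.sum_mul, mul_left_comm, Finset.mul_sum]
  refine mul_le_mul_of_nonneg_left (Finset.sum_le_sum fun j hj => ?_) (norm_nonneg B)
  calc η q ^ m * ((n.choose j : ℝ) * ‖iteratedFDeriv ℝ j (f i) q‖
        * ‖iteratedFDeriv ℝ (n - j) (g i) q‖)
      ≤ η q ^ m * ((n.choose j : ℝ) * (C * (ρ q * η q) ^ k)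
        * ‖iteratedFDeriv ℝ (n - j) (g i) q‖) := by
        gcongr
        exact h j (by simpa [Nat.lt_succ_iff] using hj) i q
    _ = (n.choose j : ℝ) * C * ρ q ^ k *
        (η q ^ (m + k) * ‖iteratedFDeriv ℝ (n - j) (g i) q‖) := by ring
    _ ≤ (n.choose j : ℝ) * C * ρ q ^ k * (D * ρ q ^ l) := by
        exact mul_le_mul_of_nonneg_left (h' (n - j) (by omega) i q) (by positivity)
    _ = _ := by ring

/-- Pointwise control of the derivatives of `g ∘ Φ` by those of `g` at the image point. -/
theorem exists_bound_comp {Φ : ι → Q → Q'} (hρ : ∀ q, 1 ≤ ρ q)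
    (hΦ : ∀ i, ContDiff ℝ ∞ (Φ i))
    (hΦ' : ∀ n, 1 ≤ n → ∃ (k : ℕ) (C : ℝ), ∀ i q, ‖iteratedFDeriv ℝ n (Φ i) q‖ ≤ C * ρ q ^ k)
    (n : ℕ) : ∃ (k : ℕ) (C : ℝ), 0 ≤ C ∧ ∀ (i : ι) (q : Q) (g : Q' → F) (B : ℝ),
      ContDiff ℝ ∞ g → (∀ j ≤ n, ‖iteratedFDeriv ℝ j g (Φ i q)‖ ≤ B) →
        ‖iteratedFDeriv ℝ n (fun q => g (Φ i q)) q‖ ≤ C * ρ q ^ k * B := by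
  obtain ⟨k, C, hC, h⟩ := exists_common_bound
    (N := fun n (x : ι × Q) => ‖iteratedFDeriv ℝ (n + 1) (Φ x.1) x.2‖)
    (ρ := fun x : ι × Q => ρ x.2) (fun q => hρ _)
    (fun n => (hΦ' (n + 1) (by omega)).imp fun k => Exists.imp fun C h q => h _ _) n
  refine ⟨k * n, n.factorial * (C + 1) ^ n, by positivity, fun i q g B hg hB => ?_⟩
  have h1 : 1 ≤ ρ q ^ k := one_le_pow₀ (hρ q)
  -- The chain rule estimate asks for `‖D^j Φ‖ ≤ D ^ j`. With a base at least 1, a bound by the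
  -- first power is enough for all `j ≥ 1`; hence `C + 1` in place of `C`.
  have h2 : 1 ≤ (C + 1) * ρ q ^ k := by nlinarith
  refine (norm_iteratedFDeriv_comp_le hg (hΦ i) (by exact_mod_cast le_top) q hB
    (D := (C + 1) * ρ q ^ k) fun j hj hjn => ?_).trans
    (le_of_eq (by rw [mul_pow, ← pow_mul]; ring))
  obtain ⟨j, rfl⟩ : ∃ j', j = j' + 1 := ⟨j - 1, by omega⟩
  refine (h j (by omega) (i, q)).trans ?_
  calc C * ρ q ^ k ≤ (C + 1) * ρ q ^ k := by gcongr; linarith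
    _ ≤ _ := le_self_pow₀ h2 (by omega)

theorem UnifTemperate.comp {Φ : ι → Q → Q'} {g : ι → Q' → F} (hρ : ∀ q, 1 ≤ ρ q)
    (hΦ : ∀ i, ContDiff ℝ ∞ (Φ i))
    (hΦ' : ∀ n, 1 ≤ n → ∃ (k : ℕ) (C : ℝ), ∀ i q, ‖iteratedFDeriv ℝ n (Φ i) q‖ ≤ C * ρ q ^ k)
    (hg : ∀ i, ContDiff ℝ ∞ (g i))
    (hg' : ∀ n, ∃ (k : ℕ) (C : ℝ), ∀ i q, ‖iteratedFDeriv ℝ n (g i) (Φ i q)‖ ≤ C * ρ q ^ k) :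
    UnifTemperate ρ (fun i q => g i (Φ i q)) := by
  refine ⟨fun i => (hg i).comp (hΦ i), fun n => ?_⟩
  obtain ⟨k, C, hC, h⟩ := exists_bound_comp (F := F) hρ hΦ hΦ' n
  obtain ⟨l, D, hD, h'⟩ := exists_common_bound
    (N := fun n (x : ι × Q) => ‖iteratedFDeriv ℝ n (g x.1) (Φ x.1 x.2)‖)
    (ρ := fun x : ι × Q => ρ x.2) (fun q => hρ _)
    (fun n => (hg' n).imp fun k => Exists.imp fun C h q => h _ _) n
  exact ⟨k + l, C * D, fun i q => (h i q (g i) (D * ρ q ^ l) (hg i)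
    fun j hj => h' j hj (i, q)).trans (le_of_eq (by ring))⟩

/-- Substitution in a rapidly decreasing family, where the weight `ρ'` may grow like `ρ η`. -/
theorem UnifRapid.comp {Φ : ι → Q → Q'} {g : ι → Q' → F} {ρ' η' : Q' → ℝ}
    (hρ : ∀ q, 1 ≤ ρ q) (hη : ∀ q, 1 ≤ η q) (hρ' : ∀ q, 1 ≤ ρ' q) (hη' : ∀ q, 1 ≤ η' q)
    (hg : UnifRapid ρ' η' g) (hΦ : ∀ i, ContDiff ℝ ∞ (Φ i))
    (hΦ' : ∀ n, 1 ≤ n → ∃ (k : ℕ) (C : ℝ), ∀ i q,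
      ‖iteratedFDeriv ℝ n (Φ i) q‖ ≤ C * (ρ q * η q) ^ k)
    (h1 : ∃ (k : ℕ) (C : ℝ), ∀ i q, ρ' (Φ i q) ≤ C * (ρ q * η q) ^ k)
    (h2 : ∃ C : ℝ, ∀ i q, η q ≤ C * η' (Φ i q)) :
    UnifRapid ρ η (fun i q => g i (Φ i q)) := by
  refine ⟨fun i => (hg.1 i).comp (hΦ i), fun n => ?_⟩
  obtain ⟨k, C, hC, h⟩ := exists_bound_comp (F := F)
    (fun q => one_le_mul_of_one_le_of_one_le (hρ q) (hη q)) hΦ hΦ' n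
  obtain ⟨l, h'⟩ := hg.exists_bound hρ' n
  obtain ⟨a, A, hA⟩ := h1
  obtain ⟨B, hB⟩ := h2
  -- The exponents `k`, `l`, `a` do not depend on `m`. The powers of `η` produced by the derivatives
  -- of `Φ` (`k` of them) and by the growth of `ρ'` (`a * l` of them) can therefore be paid for by
  -- asking for decay of order `m + k + a * l`.
  refine ⟨k + a * l, fun m => ?_⟩
  obtain ⟨D, hD, h'⟩ := h' (m + k + a * l)
  refine ⟨C * |B| ^ (m + k + a * l) * D * |A| ^ l, fun i q => ?_⟩
  have r0 : 0 < ρ q := zero_lt_one.trans_le (hρ q)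
  have e0 : 0 < η q := zero_lt_one.trans_le (hη q)
  have r0' : 0 ≤ ρ' (Φ i q) := zero_le_one.trans (hρ' _)
  have e0' : 0 ≤ η' (Φ i q) := zero_le_one.trans (hη' _)
  have key : ∀ j ≤ n, ‖iteratedFDeriv ℝ j (g i) (Φ i q)‖ ≤
      |B| ^ (m + k + a * l) * D * (|A| * (ρ q * η q) ^ a) ^ l / η q ^ (m + k + a * l) := by
    intro j hj
    rw [le_div_iff₀ (by positivity)]
    calc ‖iteratedFDeriv ℝ j (g i) (Φ i q)‖ * η q ^ (m + k + a * l)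
        ≤ ‖iteratedFDeriv ℝ j (g i) (Φ i q)‖ * (|B| * η' (Φ i q)) ^ (m + k + a * l) := by
          gcongr
          exact (hB i q).trans (by gcongr; exact le_abs_self _)
      _ = |B| ^ (m + k + a * l) *
          (η' (Φ i q) ^ (m + k + a * l) * ‖iteratedFDeriv ℝ j (g i) (Φ i q)‖) := by ring
      _ ≤ |B| ^ (m + k + a * l) * (D * ρ' (Φ i q) ^ l) := by
          exact mul_le_mul_of_nonneg_left (h' j hj i _) (by positivity)
      _ ≤ |B| ^ (m + k + a * l) * (D * (|A| * (ρ q * η q) ^ a) ^ l) := by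
          gcongr
          exact (hA i q).trans (by gcongr; exact le_abs_self _)
      _ = _ := by ring
  refine (mul_le_mul_of_nonneg_left (h i q (g i) _ (hg.1 i) key) (by positivity)).trans
    (le_of_eq ?_)
  field_simp
  ring

end Families

section Families

variable {ι Q E F : Type*} [NormedAddCommGroup Q] [NormedSpace ℝ Q]
  [NormedAddCommGroup E] [NormedSpace ℝ E] [NormedAddCommGroup F] [NormedSpace ℝ F]
  {ρ η : Q → ℝ}

theorem UnifTemperate.fderiv {f : ι → Q → F} (hf : UnifTemperate ρ f) :
    UnifTemperate ρ (fun i => fderiv ℝ (f i)) :=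
  ⟨fun i => (hf.1 i).fderiv_right (by simp), fun n => by
    simpa only [norm_iteratedFDeriv_fderiv] using hf.2 (n + 1)⟩

theorem UnifRapid.fderiv {f : ι → Q → F} (hf : UnifRapid ρ η f) :
    UnifRapid ρ η (fun i => fderiv ℝ (f i)) :=
  ⟨fun i => (hf.1 i).fderiv_right (by simp), fun n => by
    simpa only [norm_iteratedFDeriv_fderiv] using hf.2 (n + 1)⟩

theorem norm_iteratedFDeriv_clm_comp_le (T : E →L[ℝ] F) {f : Q → E} (hf : ContDiff ℝ ∞ f)
    (n : ℕ) (q : Q) :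
    ‖iteratedFDeriv ℝ n (fun q => T (f q)) q‖ ≤ ‖T‖ * ‖iteratedFDeriv ℝ n f q‖ :=
  T.norm_iteratedFDeriv_comp_left hf.contDiffAt (by exact_mod_cast le_top)

theorem UnifTemperate.clm_comp (T : E →L[ℝ] F) {f : ι → Q → E} (hf : UnifTemperate ρ f) :
    UnifTemperate ρ (fun i q => T (f i q)) := by
  refine ⟨fun i => T.contDiff.comp (hf.1 i), fun n => ?_⟩
  obtain ⟨k, C, h⟩ := hf.2 n
  refine ⟨k, ‖T‖ * C, fun i q => (norm_iteratedFDeriv_clm_comp_le T (hf.1 i) n q).trans ?_⟩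
  rw [mul_assoc]
  exact mul_le_mul_of_nonneg_left (h i q) (norm_nonneg T)

theorem UnifRapid.clm_comp (T : E →L[ℝ] F) {f : ι → Q → E} (hf : UnifRapid ρ η f)
    (hη : ∀ q, 1 ≤ η q) : UnifRapid ρ η (fun i q => T (f i q)) := by
  refine ⟨fun i => T.contDiff.comp (hf.1 i), fun n => ?_⟩
  obtain ⟨k, h⟩ := hf.2 n
  refine ⟨k, fun m => ?_⟩
  obtain ⟨C, h⟩ := h m
  refine ⟨‖T‖ * C, fun i q => ?_⟩
  have h0 : 0 ≤ η q := zero_le_one.trans (hη q)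
  refine (mul_le_mul_of_nonneg_left (norm_iteratedFDeriv_clm_comp_le T (hf.1 i) n q)
    (by positivity)).trans ?_
  rw [mul_left_comm, mul_assoc]
  exact mul_le_mul_of_nonneg_left (h i q) (norm_nonneg T)

theorem UnifRapid.fderiv_apply {f : ι → Q → F} (hf : UnifRapid ρ η f) (hη : ∀ q, 1 ≤ η q)
    (v : Q) : UnifRapid ρ η (fun i q => _root_.fderiv ℝ (f i) q v) :=
  hf.fderiv.clm_comp (ContinuousLinearMap.apply ℝ F v) hη

theorem norm_iteratedFDeriv_clm_le (ℓ : Q →L[ℝ] F) {n : ℕ} (hn : 1 ≤ n) (q : Q) :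
    ‖iteratedFDeriv ℝ n (fun q => ℓ q) q‖ ≤ ‖ℓ‖ := by
  rcases n with _ | _ | n
  · omega
  · rw [zero_add, norm_iteratedFDeriv_one]
    simp
  · rw [← norm_iteratedFDeriv_fderiv]
    have : _root_.fderiv ℝ (fun q => ℓ q) = fun _ => ℓ := by ext1 q; simp
    rw [this, iteratedFDeriv_const_of_ne (by omega)]
    simp

theorem UnifTemperate.comp_clm {ι Q Q' F : Type*} [NormedAddCommGroup Q] [NormedSpace ℝ Q]
    [NormedAddCommGroup Q'] [NormedSpace ℝ Q'] [NormedAddCommGroup F] [NormedSpace ℝ F]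
    {ρ : Q → ℝ} {ρ' : Q' → ℝ} {g : ι → Q' → F} (hg : UnifTemperate ρ' g) (hρ : ∀ q, 1 ≤ ρ q)
    (hρ' : ∀ q, 1 ≤ ρ' q) (ℓ : Q →L[ℝ] Q') (h : ∃ (k : ℕ) (C : ℝ), ∀ q, ρ' (ℓ q) ≤ C * ρ q ^ k) :
    UnifTemperate ρ (fun i q => g i (ℓ q)) := by
  obtain ⟨k, C, hC⟩ := h
  refine UnifTemperate.comp hρ (fun _ => ℓ.contDiff) (fun n hn => ?_) hg.1 fun n => ?_
  · exact ⟨0, ‖ℓ‖, fun _ q => by simpa using norm_iteratedFDeriv_clm_le ℓ hn q⟩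
  · obtain ⟨l, D, hD, h⟩ := hg.exists_bound hρ' n
    refine ⟨k * l, D * |C| ^ l, fun i q => (h n le_rfl i _).trans ?_⟩
    have h0 : 0 ≤ ρ q := zero_le_one.trans (hρ q)
    have h1 : 0 ≤ ρ' (ℓ q) := zero_le_one.trans (hρ' _)
    calc D * ρ' (ℓ q) ^ l ≤ D * (|C| * ρ q ^ k) ^ l := by
          gcongr
          exact (hC q).trans (by gcongr; exact le_abs_self _)
      _ = _ := by rw [mul_pow, ← pow_mul]; ring

end Families

/-! ### Integrals over compact sets depending on a parameter -/

section Parametric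

open scoped Topology

/-- Differentiation under the integral sign: the product of a closed unit ball in the proper space
`Q` and of `S` is compact, so a constant dominates the derivative there. -/
theorem hasFDerivAt_setIntegral_of_contDiff {Q Y F : Type} [NormedAddCommGroup Q]
    [NormedSpace ℝ Q] [ProperSpace Q] [NormedAddCommGroup Y] [NormedSpace ℝ Y] [MeasurableSpace Y]
    [BorelSpace Y] [SecondCountableTopology Y] [NormedAddCommGroup F] [NormedSpace ℝ F]
    {μ : Measure Y} [IsFiniteMeasureOnCompacts μ] {S : Set Y} (hS : IsCompact S)
    {K : Q × Y → F} (hK : ContDiff ℝ ∞ K) (q₀ : Q) :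
    HasFDerivAt (fun q => ∫ y in S, K (q, y) ∂μ)
      (∫ y in S, (fderiv ℝ K (q₀, y)).comp (ContinuousLinearMap.inl ℝ Q Y) ∂μ) q₀ := by
  have hcont : Continuous fun p : Q × Y =>
      (fderiv ℝ K p).comp (ContinuousLinearMap.inl ℝ Q Y) :=
    (hK.continuous_fderiv (by simp)).clm_comp continuous_const
  obtain ⟨B, hB⟩ := ((isCompact_closedBall q₀ 1).prod hS).exists_bound_of_continuousOn
    hcont.continuousOn
  have hint : ∀ q, IntegrableOn (fun y => K (q, y)) S μ := fun q =>
    (hK.continuous.comp (by fun_prop : Continuous fun y => (q, y))).continuousOn.integrableOn_compact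
      hS
  refine hasFDerivAt_integral_of_dominated_of_fderiv_le (𝕜 := ℝ)
    (F' := fun q y => (fderiv ℝ K (q, y)).comp (ContinuousLinearMap.inl ℝ Q Y)) (bound := fun _ => B)
    (Metric.closedBall_mem_nhds q₀ one_pos) (Eventually.of_forall fun q => (hint q).1) (hint q₀)
    ?_ ?_ ?_ ?_
  · exact (hcont.comp (by fun_prop : Continuous fun y => (q₀, y))).continuousOn.integrableOn_compact
      hS |>.1
  · filter_upwards [ae_restrict_mem hS.measurableSet] with y hy q hq
    exact hB (q, y) ⟨hq, hy⟩
  · exact (continuousOn_const).integrableOn_compact hS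
  · filter_upwards with y q hq
    exact ((hK.differentiable (by simp)) (q, y)).hasFDerivAt.comp q (hasFDerivAt_prodMk_left (𝕜 := ℝ) q y)

/-- Induction on the order. The target `F` is quantified inside, because the derivative of the
integral is the integral of a kernel with values in `Q →L[ℝ] F`. The estimate loses no constant,
since restriction to the first factor has norm at most 1. -/
theorem contDiff_setIntegral_nat {Q Y : Type} [NormedAddCommGroup Q]
    [NormedSpace ℝ Q] [ProperSpace Q] [NormedAddCommGroup Y] [NormedSpace ℝ Y] [MeasurableSpace Y]
    [BorelSpace Y] [SecondCountableTopology Y]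
    {μ : Measure Y} [IsFiniteMeasureOnCompacts μ] {S : Set Y} (hS : IsCompact S) (n : ℕ) :
    ∀ (F : Type) [NormedAddCommGroup F] [NormedSpace ℝ F] {K : Q × Y → F}, ContDiff ℝ ∞ K →
      ContDiff ℝ n (fun q => ∫ y in S, K (q, y) ∂μ) ∧ ∀ q B,
        (∀ y ∈ S, ‖iteratedFDeriv ℝ n K (q, y)‖ ≤ B) →
          ‖iteratedFDeriv ℝ n (fun q => ∫ y in S, K (q, y) ∂μ) q‖ ≤ B * μ.real S := by
  induction n with
  | zero =>
    intro F _ _ K hK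
    refine ⟨?_, fun q B hB => ?_⟩
    · exact contDiff_zero.2 (continuous_iff_continuousAt.2 fun q =>
        (hasFDerivAt_setIntegral_of_contDiff (μ := μ) hS hK q).continuousAt)
    · simp only [norm_iteratedFDeriv_zero] at hB ⊢
      exact norm_setIntegral_le_of_norm_le_const hS.measure_lt_top hB
  | succ n ih =>
    intro F _ _ K hK
    have hK' : ContDiff ℝ ∞ fun p : Q × Y =>
        (fderiv ℝ K p).comp (ContinuousLinearMap.inl ℝ Q Y) :=
      (hK.fderiv_right (by simp)).clm_comp contDiff_const
    have hfd : fderiv ℝ (fun q => ∫ y in S, K (q, y) ∂μ) = fun q =>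
        ∫ y in S, (fderiv ℝ K (q, y)).comp (ContinuousLinearMap.inl ℝ Q Y) ∂μ :=
      funext fun q => (hasFDerivAt_setIntegral_of_contDiff (μ := μ) hS hK q).fderiv
    obtain ⟨h1, h2⟩ := ih (Q →L[ℝ] F) hK'
    refine ⟨?_, fun q B hB => ?_⟩
    · rw [Nat.cast_succ, contDiff_succ_iff_fderiv]
      refine ⟨fun q => (hasFDerivAt_setIntegral_of_contDiff (μ := μ) hS hK q).differentiableAt,
        by simp, ?_⟩
      rw [hfd]
      exact h1
    · rw [← norm_iteratedFDeriv_fderiv, hfd]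
      refine h2 q B fun y hy => ?_
      have h3 := norm_iteratedFDeriv_clm_comp_le
        ((ContinuousLinearMap.compL ℝ Q (Q × Y) F).flip (ContinuousLinearMap.inl ℝ Q Y))
        (hK.fderiv_right (m := ∞) (by simp)) n (q, y)
      refine h3.trans ?_
      rw [norm_iteratedFDeriv_fderiv]
      have h4 : ‖(ContinuousLinearMap.compL ℝ Q (Q × Y) F).flip
          (ContinuousLinearMap.inl ℝ Q Y)‖ ≤ 1 := by
        refine ContinuousLinearMap.opNorm_le_bound _ zero_le_one fun T => ?_
        rw [one_mul]
        refine (ContinuousLinearMap.opNorm_comp_le _ _).trans ?_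
        exact mul_le_of_le_one_right (norm_nonneg _) (ContinuousLinearMap.norm_inl_le_one ℝ Q Y)
      exact (mul_le_of_le_one_left (norm_nonneg _) h4).trans (hB y hy)

theorem contDiff_setIntegral {Q Y F : Type} [NormedAddCommGroup Q]
    [NormedSpace ℝ Q] [ProperSpace Q] [NormedAddCommGroup Y] [NormedSpace ℝ Y] [MeasurableSpace Y]
    [BorelSpace Y] [SecondCountableTopology Y] [NormedAddCommGroup F] [NormedSpace ℝ F]
    {μ : Measure Y} [IsFiniteMeasureOnCompacts μ] {S : Set Y} (hS : IsCompact S)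
    {K : Q × Y → F} (hK : ContDiff ℝ ∞ K) :
    ContDiff ℝ ∞ (fun q => ∫ y in S, K (q, y) ∂μ) :=
  contDiff_infty.2 fun n => (contDiff_setIntegral_nat hS n F hK).1

end Parametric

/-! ### Families of Schwartz functions and their partial Fourier transform -/

section PartialFourier

open FourierTransform

variable {ι F X V : Type*} [NormedAddCommGroup X] [NormedSpace ℝ X]
  [NormedAddCommGroup F] [NormedSpace ℝ F]

theorem norm_iteratedFDeriv_slice_le [NormedAddCommGroup V] [NormedSpace ℝ V] {f : X × V → F}
    (hf : ContDiff ℝ ∞ f) (n : ℕ) (x : X) (ξ : V) :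
    ‖iteratedFDeriv ℝ n (fun ξ => f (x, ξ)) ξ‖ ≤ ‖iteratedFDeriv ℝ n f (x, ξ)‖ := by
  have h1 : (fun ξ => f (x, ξ)) =
      (fun p => f (p + (x, 0))) ∘ (ContinuousLinearMap.inr ℝ X V) := by
    ext ξ; simp
  have h2 : ContDiff ℝ ∞ fun p => f (p + (x, 0)) := hf.comp (contDiff_id.add contDiff_const)
  rw [h1, ContinuousLinearMap.iteratedFDeriv_comp_right _ h2 _ (i := n)
    (by exact_mod_cast le_top), iteratedFDeriv_comp_add_right]
  refine (ContinuousMultilinearMap.norm_compContinuousLinearMap_le _ _).trans ?_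
  have h3 : ContinuousLinearMap.inr ℝ X V ξ + (x, 0) = (x, ξ) := by simp
  rw [h3]
  refine mul_le_of_le_one_right (norm_nonneg _) ?_
  exact Finset.prod_le_one (fun _ _ => norm_nonneg _)
    fun _ _ => ContinuousLinearMap.norm_inr_le_one ℝ X V

/-- Families of functions that are uniformly Schwartz in the second variable. -/
def UnifSchwartz [NormedAddCommGroup V] [NormedSpace ℝ V] (f : ι → X × V → F) : Prop :=
  UnifRapid (fun _ => 1) (fun q => 1 + ‖q.2‖) f

theorem one_le_one_add_norm {E : Type*} [NormedAddCommGroup E] (x : E) : 1 ≤ 1 + ‖x‖ := by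
  linarith [norm_nonneg x]

theorem UnifSchwartz.exists_bound [NormedAddCommGroup V] [NormedSpace ℝ V] {f : ι → X × V → F}
    (hf : UnifSchwartz f) (n m : ℕ) : ∃ C : ℝ, 0 ≤ C ∧ ∀ i q,
      (1 + ‖q.2‖) ^ m * ‖iteratedFDeriv ℝ n (f i) q‖ ≤ C := by
  obtain ⟨k, h⟩ := UnifRapid.exists_bound hf (fun _ => le_rfl) n
  obtain ⟨C, hC, h⟩ := h m
  exact ⟨C, hC, fun i q => by simpa using h n le_rfl i q⟩

theorem unifSchwartz_iff [NormedAddCommGroup V] [NormedSpace ℝ V] {f : ι → X × V → F} :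
    UnifSchwartz f ↔ (∀ i, ContDiff ℝ ∞ (f i)) ∧ ∀ n m : ℕ, ∃ C : ℝ, ∀ i q,
      (1 + ‖q.2‖) ^ m * ‖iteratedFDeriv ℝ n (f i) q‖ ≤ C := by
  refine ⟨fun h => ⟨h.1, fun n m => (h.exists_bound n m).imp fun C h => h.2⟩, fun h => ⟨h.1,
    fun n => ⟨0, fun m => (h.2 n m).imp fun C h => by simpa using h⟩⟩⟩

/-- A continuous operator on Schwartz space maps bounded families to bounded families. -/
theorem exists_bound_of_schwartz_clm [NormedAddCommGroup V] [NormedSpace ℝ V]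
    (T : 𝓢(V, ℂ) →L[ℂ] 𝓢(V, ℂ)) {g : ι → 𝓢(V, ℂ)}
    (hg : ∀ k n, ∃ C, ∀ i x, ‖x‖ ^ k * ‖iteratedFDeriv ℝ n (g i) x‖ ≤ C) (m n : ℕ) :
    ∃ C, 0 ≤ C ∧ ∀ i x, (1 + ‖x‖) ^ m * ‖iteratedFDeriv ℝ n (T (g i)) x‖ ≤ C := by
  let p : Seminorm ℂ 𝓢(V, ℂ) := (Finset.Iic (m, n)).sup fun m => SchwartzMap.seminorm ℂ m.1 m.2
  have hp : Continuous p := by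
    simp only [p]
    induction Finset.Iic (m, n) using Finset.cons_induction with
    | empty => exact continuous_const (y := (0 : ℝ))
    | cons a s ha ih =>
      rw [Finset.sup_cons, Seminorm.coe_sup]
      exact ((schwartz_withSeminorms ℂ V ℂ).continuous_seminorm a).sup ih
  obtain ⟨s, C, -, hC⟩ := Seminorm.bound_of_continuous (schwartz_withSeminorms ℂ V ℂ)
    (p.comp T.toLinearMap) (hp.comp T.continuous)
  choose B hB using hg
  have hB' : ∀ i, ∀ j ∈ s, schwartzSeminormFamily ℂ V ℂ j (g i) ≤ ∑ j ∈ s, |B j.1 j.2| := by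
    intro i j hj
    refine (SchwartzMap.seminorm_le_bound ℂ j.1 j.2 (g i) (abs_nonneg (B j.1 j.2))
      fun x => (hB j.1 j.2 i x).trans (le_abs_self _)).trans ?_
    exact Finset.single_le_sum (f := fun j : ℕ × ℕ => |B j.1 j.2|) (fun _ _ => abs_nonneg _) hj
  refine ⟨2 ^ m * (C * ∑ j ∈ s, |B j.1 j.2|), by positivity, fun i x => ?_⟩
  refine (SchwartzMap.one_add_le_sup_seminorm_apply (𝕜 := ℂ) (m := (m, n)) le_rfl le_rfl
    (T (g i)) x).trans ?_
  gcongr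
  refine (hC (g i)).trans ?_
  change (C : ℝ) * (s.sup (schwartzSeminormFamily ℂ V ℂ)) (g i) ≤ _
  gcongr
  exact Seminorm.finset_sup_apply_le (by positivity) (hB' i)

variable [NormedAddCommGroup V] [InnerProductSpace ℝ V]

/-- The slices of a uniformly Schwartz family. -/
def UnifSchwartz.slice {f : ι → X × V → ℂ} (hf : UnifSchwartz f) (p : ι × X) : 𝓢(V, ℂ) where
  toFun ξ := f p.1 (p.2, ξ)
  smooth' := (hf.1 p.1).comp (contDiff_const.prodMk contDiff_id)
  decay' k n := by
    obtain ⟨C, -, h⟩ := hf.exists_bound n k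
    refine ⟨C, fun ξ => ?_⟩
    refine le_trans ?_ (h p.1 (p.2, ξ))
    gcongr
    · simp
    · exact norm_iteratedFDeriv_slice_le (hf.1 p.1) n p.2 ξ

theorem UnifSchwartz.slice_bound {f : ι → X × V → ℂ} (hf : UnifSchwartz f) (k n : ℕ) :
    ∃ C, ∀ (p : ι × X) ξ, ‖ξ‖ ^ k * ‖iteratedFDeriv ℝ n (hf.slice p) ξ‖ ≤ C := by
  obtain ⟨C, -, h⟩ := hf.exists_bound n k
  refine ⟨C, fun p ξ => le_trans ?_ (h p.1 (p.2, ξ))⟩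
  gcongr
  · simp
  · exact norm_iteratedFDeriv_slice_le (hf.1 p.1) n p.2 ξ

/-- The symbol of the derivative of a partial Fourier transform. -/
def fourierDerivSymbol (P : X × V → ℂ) (b : X × V) (q : X × V) : ℂ :=
  fderiv ℝ P q (b.1, 0) + (-(2 * Real.pi * Complex.I) * (inner ℝ q.2 b.2 : ℝ)) * P q

/-- Differentiating a partial Fourier transform replaces the integrand by `fourierDerivSymbol`,
whose extra factor is linear in the frequency variable and so harmless against rapid decay. As the
class is stable under this operation, derivatives of every order can be treated by induction. -/
theorem UnifSchwartz.fourierDerivSymbol {P : ι → X × V → ℂ} (hP : UnifSchwartz P) (b : X × V) :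
    UnifSchwartz (fun i => fourierDerivSymbol (P i) b) := by
  have hη : ∀ q : X × V, 1 ≤ 1 + ‖q.2‖ := fun q => one_le_one_add_norm _
  refine (UnifRapid.fderiv_apply hP hη (b.1, 0)).add ?_ (fun _ => le_rfl) hη
  let ℓ : X × V →L[ℝ] ℂ := (-(2 * Real.pi * Complex.I)) •
    (Complex.ofRealCLM.comp (((innerSL ℝ).flip b.2).comp (ContinuousLinearMap.snd ℝ X V)))
  refine UnifRapid.bilinear (ContinuousLinearMap.mul ℝ ℂ)
    (f := fun _ q => -(2 * Real.pi * Complex.I) * (inner ℝ q.2 b.2 : ℝ)) ?_ hP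
    (fun _ => le_rfl) hη
  refine unifTemperate_clm (fun _ => ℓ) (B := ‖ℓ‖) (fun _ => le_rfl)
    (C := 2 * Real.pi * ‖b.2‖) fun _ q => ?_
  have : ‖ℓ q‖ = 2 * Real.pi * |inner ℝ q.2 b.2| := by
    simp [ℓ, abs_of_pos Real.pi_pos, innerSL_apply_apply ℝ, real_inner_comm]
  rw [this]
  have h2 := abs_real_inner_le_norm q.2 b.2
  have h3 := Real.pi_pos
  have h4 : |inner ℝ q.2 b.2| ≤ ‖b.2‖ * (1 + ‖q.2‖) := by nlinarith [norm_nonneg b.2]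
  calc 2 * Real.pi * |inner ℝ q.2 b.2| ≤ 2 * Real.pi * (‖b.2‖ * (1 + ‖q.2‖)) := by gcongr
    _ = _ := by ring

variable [FiniteDimensional ℝ V] [MeasurableSpace V] [BorelSpace V]

/-- The Fourier transform in the second variable. -/
def partialFourier (P : X × V → ℂ) (q : X × V) : ℂ := 𝓕 (fun ξ => P (q.1, ξ)) q.2

/-- All slices together form a bounded set in Schwartz space, and the Fourier transform, being
continuous there, maps it to a bounded set. -/
theorem UnifSchwartz.partialFourier_bound {P : ι → X × V → ℂ} (hP : UnifSchwartz P) (m : ℕ) :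
    ∃ C, ∀ i q, (1 + ‖q.2‖) ^ m * ‖partialFourier (P i) q‖ ≤ C := by
  obtain ⟨C, -, h⟩ := exists_bound_of_schwartz_clm (fourierCLM ℂ 𝓢(V, ℂ)) hP.slice_bound m 0
  refine ⟨C, fun i q => ?_⟩
  have h1 := h (i, q.1) q.2
  rw [norm_iteratedFDeriv_zero] at h1
  exact h1

omit [NormedSpace ℝ F] in
theorem integrable_of_one_add_norm_bound {μ : Measure V} [μ.IsAddHaarMeasure] {f : V → F}
    {C : ℝ} (hf : AEStronglyMeasurable f μ)
    (h : ∀ ξ, (1 + ‖ξ‖) ^ (Module.finrank ℝ V + 1) * ‖f ξ‖ ≤ C) : Integrable f μ := by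
  refine Integrable.mono' ((integrable_one_add_norm (μ := μ) (E := V)
    (r := (Module.finrank ℝ V + 1 : ℕ)) (by push_cast; linarith)).const_mul C) hf ?_
  filter_upwards with ξ
  have h0 : 0 < 1 + ‖ξ‖ := by positivity
  rw [Real.rpow_neg h0.le, Real.rpow_natCast, ← div_eq_mul_inv, le_div_iff₀ (by positivity),
    mul_comm]
  exact h ξ

theorem UnifSchwartz.hasFDerivAt_partialFourier {Q : Type*} [NormedAddCommGroup Q]
    [NormedSpace ℝ Q] {P : ι → X × V → ℂ} (hP : UnifSchwartz P) {π₁ : Q →L[ℝ] X} {π₂ : Q →L[ℝ] V}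
    (hπ₁ : ∀ b, ‖π₁ b‖ ≤ ‖b‖) (hπ₂ : ∀ b, ‖π₂ b‖ ≤ ‖b‖)
    (i : ι) (q₀ : Q) : ∃ T : Q →L[ℝ] ℂ,
      HasFDerivAt (fun q => partialFourier (P i) (π₁ q, π₂ q)) T q₀ ∧
      ∀ b, T b = partialFourier (DysonTaylor.fourierDerivSymbol (P i) (π₁ b, π₂ b))
        (π₁ q₀, π₂ q₀) := by
  -- The weight `(1 + ‖ξ‖) ^ (-d)` is integrable on `V`. One order of decay more is needed for `P`
  -- itself, because the derivative of the character brings down a factor `ξ`.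
  set d := Module.finrank ℝ V + 1 with hd
  obtain ⟨C₀, hC₀, h₀⟩ := hP.exists_bound 0 (d + 1)
  obtain ⟨C₁, hC₁, h₁⟩ := hP.exists_bound 1 d
  let F' : Q → V → Q →L[ℝ] ℂ := fun q ξ =>
    (Real.fourierChar (-inner ℝ ξ (π₂ q)) : ℂ) • ((fderiv ℝ (P i) (π₁ q, ξ)).comp
      ((ContinuousLinearMap.inl ℝ X V).comp π₁) +
      P i (π₁ q, ξ) • (((-(2 * Real.pi * Complex.I)) • Complex.ofRealCLM).comp
        ((innerSL ℝ ξ).comp π₂)))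
  have hPd : ∀ p, HasFDerivAt (P i) (fderiv ℝ (P i) p) p := fun p =>
    ((hP.1 i).differentiable (by simp) p).hasFDerivAt
  have hdiff : ∀ q ξ, HasFDerivAt
      (fun q : Q => (Real.fourierChar (-inner ℝ ξ (π₂ q)) : ℂ) * P i (π₁ q, ξ)) (F' q ξ) q := by
    intro q ξ
    have e1 : HasFDerivAt (fun q : Q => (π₁ q, ξ)) ((ContinuousLinearMap.inl ℝ X V).comp π₁) q :=
      (hasFDerivAt_prodMk_left (𝕜 := ℝ) (π₁ q) ξ).comp q π₁.hasFDerivAt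
    have e2 := (hPd (π₁ q, ξ)).comp q e1
    have e3 : HasFDerivAt (fun q : Q => -inner ℝ ξ (π₂ q))
        (-((innerSL ℝ ξ).comp π₂)) q :=
      (((innerSL ℝ ξ).comp π₂).hasFDerivAt).neg
    have e4 := (Real.hasDerivAt_fourierChar (-inner ℝ ξ (π₂ q))).hasFDerivAt.comp q e3
    have e5 : HasFDerivAt
        (fun q : Q => (Real.fourierChar (-inner ℝ ξ (π₂ q)) : ℂ) * P i (π₁ q, ξ)) _ q := e4.mul e2
    refine e5.congr_fderiv ?_
    ext b
    simp [F', innerSL_apply_apply ℝ]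
    ring
  have hbound : ∀ q ξ, ‖F' q ξ‖ ≤ (C₁ + 2 * Real.pi * C₀) * (1 + ‖ξ‖) ^ (-(d : ℝ)) := by
    intro q ξ
    have hpos : 0 < 1 + ‖ξ‖ := by positivity
    have a1 := h₀ i (π₁ q, ξ)
    have a2 := h₁ i (π₁ q, ξ)
    rw [norm_iteratedFDeriv_zero] at a1
    rw [norm_iteratedFDeriv_one] at a2
    have a3 : ‖F' q ξ‖ ≤ ‖fderiv ℝ (P i) (π₁ q, ξ)‖ + 2 * Real.pi * ((1 + ‖ξ‖) * ‖P i (π₁ q, ξ)‖) := by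
      refine ContinuousLinearMap.opNorm_le_bound _ (by positivity) fun b => ?_
      have b1 : ‖fderiv ℝ (P i) (π₁ q, ξ) (π₁ b, 0)‖ ≤ ‖fderiv ℝ (P i) (π₁ q, ξ)‖ * ‖b‖ := by
        refine (ContinuousLinearMap.le_opNorm _ _).trans ?_
        gcongr
        simpa using hπ₁ b
      have b2 : |inner ℝ ξ (π₂ b)| ≤ (1 + ‖ξ‖) * ‖b‖ := by
        refine (abs_real_inner_le_norm _ _).trans ?_
        gcongr
        · linarith
        · exact hπ₂ b
      have b3 : F' q ξ b = (Real.fourierChar (-inner ℝ ξ (π₂ q)) : ℂ) *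
          (fderiv ℝ (P i) (π₁ q, ξ) (π₁ b, 0) + P i (π₁ q, ξ) * (-(2 * Real.pi * Complex.I) *
            (inner ℝ ξ (π₂ b) : ℝ))) := by
        simp [F', innerSL_apply_apply ℝ]
        ring
      rw [b3, norm_mul, Circle.norm_coe, one_mul]
      refine (norm_add_le _ _).trans ?_
      rw [norm_mul, norm_mul, norm_neg, norm_mul, norm_mul, Complex.norm_I, Complex.norm_real,
        Complex.norm_real, Complex.norm_ofNat, Real.norm_of_nonneg Real.pi_pos.le, mul_one, add_mul]
      refine add_le_add b1 ?_
      calc ‖P i (π₁ q, ξ)‖ * (2 * Real.pi * ‖inner ℝ ξ (π₂ b)‖)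
          ≤ ‖P i (π₁ q, ξ)‖ * (2 * Real.pi * ((1 + ‖ξ‖) * ‖b‖)) := by
            have := Real.pi_pos
            gcongr
            exact b2
        _ = _ := by ring
    refine a3.trans ?_
    rw [Real.rpow_neg hpos.le, Real.rpow_natCast, ← div_eq_mul_inv, le_div_iff₀ (by positivity)]
    have : 2 * Real.pi * ((1 + ‖ξ‖) ^ (d + 1) * ‖P i (π₁ q, ξ)‖) ≤ 2 * Real.pi * C₀ := by
      have := Real.pi_pos
      gcongr
    simp only at a2
    calc _ = (1 + ‖ξ‖) ^ d * ‖fderiv ℝ (P i) (π₁ q, ξ)‖ +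
          2 * Real.pi * ((1 + ‖ξ‖) ^ (d + 1) * ‖P i (π₁ q, ξ)‖) := by ring
      _ ≤ _ := add_le_add a2 this
  have hcont : ∀ q : Q, Continuous fun ξ : V =>
      (Real.fourierChar (-inner ℝ ξ (π₂ q)) : ℂ) := fun q =>
    (continuous_subtype_val.comp Real.continuous_fourierChar).comp (by fun_prop)
  have hPc : ∀ x, Continuous fun ξ => P i (x, ξ) := fun x =>
    (hP.1 i).continuous.comp (by fun_prop)
  have hF'c : Continuous (F' q₀) := by
    have h1 := ((hP.1 i).continuous_fderiv (by simp)).comp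
      (by fun_prop : Continuous fun ξ : V => ((π₁ q₀), ξ))
    refine (hcont q₀).smul ((h1.clm_comp continuous_const).add ((hPc (π₁ q₀)).smul ?_))
    exact continuous_const.clm_comp (((innerSL ℝ).continuous).clm_comp continuous_const)
  have hint : Integrable (fun ξ => (C₁ + 2 * Real.pi * C₀) * (1 + ‖ξ‖) ^ (-(d : ℝ)))
      (volume : Measure V) :=
    (integrable_one_add_norm (by rw [hd]; push_cast; linarith)).const_mul _
  have key := hasFDerivAt_integral_of_dominated_of_fderiv_le (𝕜 := ℝ) (μ := (volume : Measure V))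
    (F := fun (q : Q) ξ => (Real.fourierChar (-inner ℝ ξ (π₂ q)) : ℂ) * P i (π₁ q, ξ))
    (F' := F') (x₀ := q₀) (s := univ)
    (bound := fun ξ => (C₁ + 2 * Real.pi * C₀) * (1 + ‖ξ‖) ^ (-(d : ℝ)))
    univ_mem (Eventually.of_forall fun q => ((hcont q).mul (hPc (π₁ q))).aestronglyMeasurable)
    (integrable_of_one_add_norm_bound (C := C₀) ((hcont q₀).mul (hPc (π₁ q₀))).aestronglyMeasurable
      fun ξ => by
        have a1 := h₀ i ((π₁ q₀), ξ)
        rw [norm_iteratedFDeriv_zero] at a1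
        rw [norm_mul, Circle.norm_coe, one_mul]
        refine le_trans ?_ a1
        gcongr
        · linarith [norm_nonneg ξ]
        · omega)
    hF'c.aestronglyMeasurable (Eventually.of_forall fun ξ q _ => hbound q ξ) hint
    (Eventually.of_forall fun ξ q _ => hdiff q ξ)
  refine ⟨∫ ξ, F' q₀ ξ, ?_, fun b => ?_⟩
  · exact key
  · have hF'int : Integrable (F' q₀) volume :=
      Integrable.mono' hint hF'c.aestronglyMeasurable (Eventually.of_forall fun ξ => hbound q₀ ξ)
    rw [ContinuousLinearMap.integral_apply hF'int]
    simp only [partialFourier, Real.fourier_eq]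
    refine integral_congr_ae (Eventually.of_forall fun ξ => ?_)
    simp only [F', DysonTaylor.fourierDerivSymbol, Circle.smul_def, smul_eq_mul]
    simp
    ring

/-- The directional derivatives of a partial Fourier transform in a basis of `Q`, assembled to
the full derivative. -/
theorem UnifSchwartz.fderiv_partialFourier {Q : Type*} [NormedAddCommGroup Q]
    [NormedSpace ℝ Q] [FiniteDimensional ℝ Q] {P : ι → X × V → ℂ} (hP : UnifSchwartz P)
    {π₁ : Q →L[ℝ] X} {π₂ : Q →L[ℝ] V} (hπ₁ : ∀ b, ‖π₁ b‖ ≤ ‖b‖) (hπ₂ : ∀ b, ‖π₂ b‖ ≤ ‖b‖)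
    (i : ι) :
    let b := Module.finBasis ℝ Q
    fderiv ℝ (fun q => partialFourier (P i) (π₁ q, π₂ q)) = fun q => ∑ j,
      ContinuousLinearMap.smulRightL ℝ Q ℂ (LinearMap.toContinuousLinearMap (b.coord j))
        (partialFourier (DysonTaylor.fourierDerivSymbol (P i) (π₁ (b j), π₂ (b j)))
          (π₁ q, π₂ q)) := by
  intro b
  ext1 q
  obtain ⟨T, hT, hTb⟩ := hP.hasFDerivAt_partialFourier hπ₁ hπ₂ i q
  rw [hT.fderiv]
  ext v
  have hv : T v = ∑ j, b.repr v j • T (b j) := by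
    conv_lhs => rw [← b.sum_repr v, map_sum]
    exact Finset.sum_congr rfl fun j _ => map_smul _ _ _
  rw [hv]
  simp [hTb]

theorem UnifSchwartz.contDiff_partialFourier {Q : Type*} [NormedAddCommGroup Q]
    [NormedSpace ℝ Q] [FiniteDimensional ℝ Q] {π₁ : Q →L[ℝ] X} {π₂ : Q →L[ℝ] V}
    (hπ₁ : ∀ b, ‖π₁ b‖ ≤ ‖b‖) (hπ₂ : ∀ b, ‖π₂ b‖ ≤ ‖b‖) (n : ℕ) :
    ∀ {P : ι → X × V → ℂ}, UnifSchwartz P → ∀ i,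
      ContDiff ℝ n (fun q => partialFourier (P i) (π₁ q, π₂ q)) := by
  induction n with
  | zero =>
    intro P hP i
    refine contDiff_zero.2 (continuous_iff_continuousAt.2 fun q => ?_)
    obtain ⟨T, hT, -⟩ := hP.hasFDerivAt_partialFourier hπ₁ hπ₂ i q
    exact hT.continuousAt
  | succ n ih =>
    intro P hP i
    rw [Nat.cast_succ, contDiff_succ_iff_fderiv]
    refine ⟨fun q => ?_, by simp, ?_⟩
    · obtain ⟨T, hT, -⟩ := hP.hasFDerivAt_partialFourier hπ₁ hπ₂ i q
      exact hT.differentiableAt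
    · rw [hP.fderiv_partialFourier hπ₁ hπ₂ i]
      exact ContDiff.sum fun j _ => (ContinuousLinearMap.contDiff _).comp
        (ih (hP.fourierDerivSymbol _) i)

/-- One derivative is a finite sum, over a basis of `Q`, of partial Fourier transforms of other
uniformly Schwartz families. The induction on `n` therefore has to run over all `P` at once. -/
theorem UnifSchwartz.partialFourier_iteratedFDeriv_bound {Q : Type*} [NormedAddCommGroup Q]
    [NormedSpace ℝ Q] [FiniteDimensional ℝ Q] {π₁ : Q →L[ℝ] X} {π₂ : Q →L[ℝ] V}
    (hπ₁ : ∀ b, ‖π₁ b‖ ≤ ‖b‖) (hπ₂ : ∀ b, ‖π₂ b‖ ≤ ‖b‖) (n m : ℕ) :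
    ∀ {P : ι → X × V → ℂ}, UnifSchwartz P → ∃ C, ∀ i q, (1 + ‖π₂ q‖) ^ m *
      ‖iteratedFDeriv ℝ n (fun q => partialFourier (P i) (π₁ q, π₂ q)) q‖ ≤ C := by
  induction n with
  | zero =>
    intro P hP
    obtain ⟨C, h⟩ := hP.partialFourier_bound m
    exact ⟨C, fun i q => by simpa using h i (π₁ q, π₂ q)⟩
  | succ n ih =>
    intro P hP
    have hcd : ∀ j i, ContDiff ℝ ∞ fun q : Q => partialFourier (DysonTaylor.fourierDerivSymbol (P i)
        (π₁ (Module.finBasis ℝ Q j), π₂ (Module.finBasis ℝ Q j))) (π₁ q, π₂ q) := fun j i =>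
      contDiff_infty.2 fun n => UnifSchwartz.contDiff_partialFourier hπ₁ hπ₂ n
        (hP.fourierDerivSymbol _) i
    choose C hC using fun j => ih (hP.fourierDerivSymbol
      (π₁ (Module.finBasis ℝ Q j), π₂ (Module.finBasis ℝ Q j)))
    refine ⟨∑ j, ‖ContinuousLinearMap.smulRightL ℝ Q ℂ
      (LinearMap.toContinuousLinearMap ((Module.finBasis ℝ Q).coord j))‖ * C j, fun i q => ?_⟩
    rw [← norm_iteratedFDeriv_fderiv, hP.fderiv_partialFourier hπ₁ hπ₂ i]
    rw [iteratedFDeriv_fun_sum_apply fun j _ => ContDiff.contDiffAt <|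
      ContDiff.of_le (n := ∞) (by fun_prop) (by exact_mod_cast le_top)]
    refine (mul_le_mul_of_nonneg_left (norm_sum_le _ _) (by positivity)).trans ?_
    rw [Finset.mul_sum]
    refine Finset.sum_le_sum fun j _ => ?_
    refine (mul_le_mul_of_nonneg_left (norm_iteratedFDeriv_clm_comp_le _ (hcd j i) n q)
      (by positivity)).trans ?_
    rw [mul_left_comm]
    exact mul_le_mul_of_nonneg_left (hC j i q) (norm_nonneg _)

/-- The partial Fourier transform preserves uniformly Schwartz families. -/
theorem UnifSchwartz.partialFourier [FiniteDimensional ℝ X] {P : ι → X × V → ℂ}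
    (hP : UnifSchwartz P) : UnifSchwartz (fun i => partialFourier (P i)) := by
  have h1 : ∀ b : X × V, ‖ContinuousLinearMap.fst ℝ X V b‖ ≤ ‖b‖ := norm_fst_le
  have h2 : ∀ b : X × V, ‖ContinuousLinearMap.snd ℝ X V b‖ ≤ ‖b‖ := norm_snd_le
  refine unifSchwartz_iff.2 ⟨fun i => contDiff_infty.2 fun n =>
    UnifSchwartz.contDiff_partialFourier h1 h2 n hP i, fun n m => ?_⟩
  exact UnifSchwartz.partialFourier_iteratedFDeriv_bound h1 h2 n m hP

end PartialFourier

/-! ### The heat semigroup on Schwartz space -/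

section Heat

open FourierTransform LineDeriv SchwartzMap

variable {N : ℕ}

/-- The quadratic form `∑ A_{ij} ξ_i ξ_j`. -/
def quadForm (A : Fin N → Fin N → ℝ) (ξ : Eucl N) : ℝ := ∑ i, ∑ j, A i j * ξ i * ξ j

/-- The Fourier multiplier `exp (-4 π² t ∑ A_{ij} ξ_i ξ_j)`. -/
def heatSymbol (A : Fin N → Fin N → ℝ) (t : ℝ) (ξ : Eucl N) : ℂ :=
  (Real.exp (-(t * (4 * Real.pi ^ 2 * quadForm A ξ))) : ℝ)

/-- Every derivative of `exp` is `exp`, so the factor `exp (Φ i q)` survives in the chain rule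
estimate. For a nonnegative form it is merely bounded by 1; for an elliptic one it supplies Gaussian
decay. -/
theorem exists_bound_exp_comp {ι Q : Type*} [NormedAddCommGroup Q] [NormedSpace ℝ Q]
    {ρ : Q → ℝ} {Φ : ι → Q → ℝ} (hρ : ∀ q, 1 ≤ ρ q) (hΦ : UnifTemperate ρ Φ) (n : ℕ) :
    ∃ (k : ℕ) (C : ℝ), 0 ≤ C ∧ ∀ i q, ‖iteratedFDeriv ℝ n (fun q => Real.exp (Φ i q)) q‖ ≤
      C * ρ q ^ k * Real.exp (Φ i q) := by
  obtain ⟨k, C, hC, h⟩ := exists_bound_comp (F := ℝ) hρ hΦ.1 (fun n _ => hΦ.2 n) n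
  refine ⟨k, C, hC, fun i q => h i q Real.exp _ Real.contDiff_exp fun j _ => ?_⟩
  rw [norm_iteratedFDeriv_eq_norm_iteratedDeriv, iteratedDeriv_eq_iterate, Real.iter_deriv_exp,
    Real.norm_of_nonneg (Real.exp_pos _).le]

theorem unifTemperate_coord {ι : Type*} (i : Fin N) :
    UnifTemperate (fun ξ : Eucl N => 1 + ‖ξ‖) (fun (_ : ι) ξ => ξ i) := by
  refine unifTemperate_clm (fun _ => EuclideanSpace.proj (𝕜 := ℝ) i) (fun _ => le_rfl) (C := 1)
    fun _ ξ => ?_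
  have := PiLp.norm_apply_le ξ i
  simp only [PiLp.proj_apply]
  linarith

theorem contDiff_heatSymbol (A : Fin N → Fin N → ℝ) (t : ℝ) : ContDiff ℝ ∞ (heatSymbol A t) := by
  have h : ContDiff ℝ ∞ fun ξ : Eucl N => Real.exp (-(t * (4 * Real.pi ^ 2 * quadForm A ξ))) := by
    unfold quadForm
    fun_prop
  exact Complex.ofRealCLM.contDiff.comp h

theorem norm_heatSymbol_le {A : Fin N → Fin N → ℝ} (hA : ∀ ξ, 0 ≤ quadForm A ξ) {t : ℝ}
    (ht : 0 ≤ t) (ξ : Eucl N) : ‖heatSymbol A t ξ‖ ≤ 1 := by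
  rw [heatSymbol, Complex.norm_real, Real.norm_of_nonneg (Real.exp_pos _).le, Real.exp_le_one_iff]
  have := hA ξ
  have : 0 ≤ t * (4 * Real.pi ^ 2 * quadForm A ξ) := by positivity
  linarith

theorem unifTemperate_heatSymbol {A : Fin N → Fin N → ℝ} (hA : ∀ ξ, 0 ≤ quadForm A ξ) (T : ℝ) :
    UnifTemperate (fun ξ : Eucl N => 1 + ‖ξ‖) (fun t : Icc 0 T => heatSymbol A t) := by
  have hρ : ∀ ξ : Eucl N, 1 ≤ 1 + ‖ξ‖ := one_le_one_add_norm
  have hq : UnifTemperate (fun ξ : Eucl N => 1 + ‖ξ‖) (fun _ : Icc 0 T => quadForm A) := by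
    refine UnifTemperate.sum hρ fun i _ => UnifTemperate.sum hρ fun j _ => ?_
    exact ((unifTemperate_const (fun _ => A i j) ⟨_, fun _ => le_rfl⟩).bilinear
      (ContinuousLinearMap.mul ℝ ℝ) (unifTemperate_coord i) hρ).bilinear
      (ContinuousLinearMap.mul ℝ ℝ) (unifTemperate_coord j) hρ
  have ht : UnifTemperate (fun ξ : Eucl N => 1 + ‖ξ‖)
      (fun (t : Icc 0 T) (_ : Eucl N) => -(t * (4 * Real.pi ^ 2) : ℝ)) := by
    refine unifTemperate_const _ ⟨T * (4 * Real.pi ^ 2), fun t => ?_⟩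
    rw [norm_neg, Real.norm_of_nonneg (mul_nonneg t.2.1 (by positivity))]
    gcongr
    exact t.2.2
  have hΦ := ht.bilinear (ContinuousLinearMap.mul ℝ ℝ) hq hρ
  have he : UnifTemperate (fun ξ : Eucl N => 1 + ‖ξ‖) (fun (t : Icc 0 T) ξ =>
      Real.exp (-(t * (4 * Real.pi ^ 2) : ℝ) * quadForm A ξ)) := by
    refine ⟨fun t => Real.contDiff_exp.comp (hΦ.1 t), fun n => ?_⟩
    obtain ⟨k, C, hC, h⟩ := exists_bound_exp_comp hρ hΦ n
    refine ⟨k, C, fun t ξ => (h t ξ).trans (mul_le_of_le_one_right (by positivity) ?_)⟩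
    rw [Real.exp_le_one_iff]
    have h1 := hA ξ
    have h2 : 0 ≤ (t : ℝ) * (4 * Real.pi ^ 2) * quadForm A ξ :=
      mul_nonneg (mul_nonneg t.2.1 (by positivity)) h1
    simp only [ContinuousLinearMap.mul_apply', neg_mul]
    linarith
  have := he.clm_comp Complex.ofRealCLM
  convert this using 3 with t ξ
  simp only [heatSymbol, Complex.ofRealCLM_apply]
  congr 2
  ring

theorem hasTemperateGrowth_heatSymbol {A : Fin N → Fin N → ℝ} (hA : ∀ ξ, 0 ≤ quadForm A ξ)
    {t : ℝ} (ht : 0 ≤ t) : (heatSymbol A t).HasTemperateGrowth := by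
  have h := unifTemperate_heatSymbol hA t
  refine ⟨h.1 ⟨t, ht, le_rfl⟩, fun n => ?_⟩
  obtain ⟨k, C, h⟩ := h.2 n
  exact ⟨k, C, h ⟨t, ht, le_rfl⟩⟩

/-- The solution operator of `∂_t u = ∑ A_{ij} ∂_i ∂_j u` on Schwartz space. -/
def heat (A : Fin N → Fin N → ℝ) (t : ℝ) : 𝓢(Eucl N, ℂ) →L[ℂ] 𝓢(Eucl N, ℂ) :=
  SchwartzMap.fourierMultiplierCLM ℂ (heatSymbol A t)

/-- The partial derivative on Schwartz space. -/
def dCLM (i : Fin N) : 𝓢(Eucl N, ℂ) →L[ℂ] 𝓢(Eucl N, ℂ) :=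
  lineDerivOpCLM ℂ 𝓢(Eucl N, ℂ) (EuclideanSpace.single i (1 : ℝ))

theorem coe_dCLM (i : Fin N) (h : 𝓢(Eucl N, ℂ)) : ⇑(dCLM i h) = partialD i h := by
  ext x
  exact SchwartzMap.lineDerivOp_apply_eq_fderiv _ h x

theorem hasTemperateGrowth_coord (i : Fin N) (w : Eucl N) :
    (fun x : Eucl N => ((x i - w i : ℝ) : ℂ)).HasTemperateGrowth := by
  have : (fun x : Eucl N => x i - w i).HasTemperateGrowth := by
    have h := (EuclideanSpace.proj (𝕜 := ℝ) i : Eucl N →L[ℝ] ℝ).hasTemperateGrowth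
    exact h.sub (.const (w i))
  exact Function.HasTemperateGrowth.comp (Complex.ofRealCLM.hasTemperateGrowth) this

/-- Multiplication by `x_i - w_i` on Schwartz space. -/
def xCLM (w : Eucl N) (i : Fin N) : 𝓢(Eucl N, ℂ) →L[ℂ] 𝓢(Eucl N, ℂ) :=
  SchwartzMap.smulLeftCLM ℂ (fun x : Eucl N => ((x i - w i : ℝ) : ℂ))

theorem xCLM_apply (w : Eucl N) (i : Fin N) (h : 𝓢(Eucl N, ℂ)) (x : Eucl N) :
    xCLM w i h x = ((x i - w i : ℝ) : ℂ) * h x := by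
  rw [xCLM, SchwartzMap.smulLeftCLM_apply_apply (hasTemperateGrowth_coord i w), smul_eq_mul]

theorem fourier_dCLM_apply (i : Fin N) (h : 𝓢(Eucl N, ℂ)) (ξ : Eucl N) :
    𝓕 (dCLM i h) ξ = 2 * Real.pi * Complex.I * ξ i * 𝓕 h ξ := by
  have h1 : 𝓕 (dCLM i h) = _ :=
    SchwartzMap.fourier_lineDerivOp_eq h (EuclideanSpace.single i (1 : ℝ))
  have h2 : (inner ℝ · (EuclideanSpace.single i (1 : ℝ)) : Eucl N → ℝ).HasTemperateGrowth := by
    fun_prop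
  rw [h1, smul_apply, SchwartzMap.smulLeftCLM_apply_apply h2]
  simp [EuclideanSpace.inner_single_right]
  ring

theorem fourier_heat_apply {A : Fin N → Fin N → ℝ} (hA : ∀ ξ, 0 ≤ quadForm A ξ) {t : ℝ}
    (ht : 0 ≤ t) (h : 𝓢(Eucl N, ℂ)) (ξ : Eucl N) :
    𝓕 (heat A t h) ξ = heatSymbol A t ξ * 𝓕 h ξ := by
  rw [heat, SchwartzMap.fourierMultiplierCLM_apply, FourierTransform.fourier_fourierInv_eq,
    SchwartzMap.smulLeftCLM_apply_apply (hasTemperateGrowth_heatSymbol hA ht), smul_eq_mul]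

theorem schwartz_ext_fourier {f g : 𝓢(Eucl N, ℂ)} (h : ∀ ξ, 𝓕 f ξ = 𝓕 g ξ) : f = g := by
  have h1 : 𝓕 f = 𝓕 g := SchwartzMap.ext h
  rw [← FourierTransform.fourierInv_fourier_eq (F := 𝓢(Eucl N, ℂ)) f, h1,
    FourierTransform.fourierInv_fourier_eq (F := 𝓢(Eucl N, ℂ))]

theorem heat_zero {A : Fin N → Fin N → ℝ} (hA : ∀ ξ, 0 ≤ quadForm A ξ) (h : 𝓢(Eucl N, ℂ)) :
    heat A 0 h = h :=
  schwartz_ext_fourier fun ξ => by rw [fourier_heat_apply hA le_rfl]; simp [heatSymbol]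

theorem heat_heat {A : Fin N → Fin N → ℝ} (hA : ∀ ξ, 0 ≤ quadForm A ξ) {t r : ℝ} (ht : 0 ≤ t)
    (hr : 0 ≤ r) (h : 𝓢(Eucl N, ℂ)) : heat A t (heat A r h) = heat A (t + r) h :=
  schwartz_ext_fourier fun ξ => by
    rw [fourier_heat_apply hA ht, fourier_heat_apply hA hr, fourier_heat_apply hA (by positivity),
      ← mul_assoc, heatSymbol, heatSymbol, heatSymbol, ← Complex.ofReal_mul, ← Real.exp_add]
    congr 3
    ring

theorem heat_dCLM {A : Fin N → Fin N → ℝ} (hA : ∀ ξ, 0 ≤ quadForm A ξ) {t : ℝ} (ht : 0 ≤ t)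
    (i : Fin N) (h : 𝓢(Eucl N, ℂ)) : heat A t (dCLM i h) = dCLM i (heat A t h) :=
  schwartz_ext_fourier fun ξ => by
    rw [fourier_heat_apply hA ht, fourier_dCLM_apply, fourier_dCLM_apply, fourier_heat_apply hA ht]
    ring

/-- Translates multiplication by `x_i - w_i` to the Fourier side, where it can be compared with the
derivative of the heat multiplier. -/
theorem partialD_fourier (i : Fin N) (h : 𝓢(Eucl N, ℂ)) (ξ : Eucl N) (w : Eucl N) :
    partialD i ⇑(𝓕 h : 𝓢(Eucl N, ℂ)) ξ = -(2 * Real.pi * Complex.I) * (𝓕 (xCLM w i h) ξ + w i * 𝓕 h ξ) := by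
  have h1 := SchwartzMap.lineDerivOp_fourier_eq h (EuclideanSpace.single i (1 : ℝ))
  have h2 : (inner ℝ · (EuclideanSpace.single i (1 : ℝ)) : Eucl N → ℝ).HasTemperateGrowth := by
    fun_prop
  have h3 : SchwartzMap.smulLeftCLM ℂ (inner ℝ · (EuclideanSpace.single i (1 : ℝ))) h =
      xCLM w i h + (w i : ℂ) • h := by
    ext x
    rw [SchwartzMap.smulLeftCLM_apply_apply h2, add_apply, smul_apply,
      xCLM_apply]
    simp [EuclideanSpace.inner_single_right]
    ring
  rw [h3] at h1
  have h4 : partialD i ⇑(𝓕 h : 𝓢(Eucl N, ℂ)) ξ = ∂_{EuclideanSpace.single i (1 : ℝ)} (𝓕 h) ξ :=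
    (SchwartzMap.lineDerivOp_apply_eq_fderiv _ (𝓕 h) ξ).symm
  rw [h4, h1]
  simp only [FourierTransform.fourier_smul, FourierTransform.fourier_add]
  simp [mul_add]

theorem fderiv_quadForm {A : Fin N → Fin N → ℝ} (hsymm : ∀ i j, A i j = A j i) (i : Fin N)
    (ξ : Eucl N) : fderiv ℝ (quadForm A) ξ (EuclideanSpace.single i 1) = 2 * ∑ j, A i j * ξ j := by
  have hp : ∀ j : Fin N, HasFDerivAt (fun ξ : Eucl N => ξ j) (EuclideanSpace.proj (𝕜 := ℝ) j) ξ :=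
    fun j => (EuclideanSpace.proj (𝕜 := ℝ) j : Eucl N →L[ℝ] ℝ).hasFDerivAt
  have hd : HasFDerivAt (quadForm A) (∑ k, ∑ l, ((A k l * ξ k) • EuclideanSpace.proj (𝕜 := ℝ) l +
      ξ l • A k l • EuclideanSpace.proj (𝕜 := ℝ) k : Eucl N →L[ℝ] ℝ)) ξ :=
    HasFDerivAt.fun_sum fun k _ => HasFDerivAt.fun_sum fun l _ => ((hp k).const_mul _).mul (hp l)
  rw [hd.fderiv]
  simp [Finset.sum_add_distrib]
  rw [two_mul]
  congr 1
  · exact Finset.sum_congr rfl fun j _ => by rw [hsymm]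
  · exact Finset.sum_congr rfl fun j _ => by ring

/-- The commutation of the heat semigroup with multiplication by a coordinate. -/
theorem heat_xCLM {A : Fin N → Fin N → ℝ} (hA : ∀ ξ, 0 ≤ quadForm A ξ)
    (hsymm : ∀ i j, A i j = A j i) {t : ℝ} (ht : 0 ≤ t) (w : Eucl N) (i : Fin N)
    (h : 𝓢(Eucl N, ℂ)) : heat A t (xCLM w i h) = xCLM w i (heat A t h) +
      ∑ j, (2 * t * A i j : ℂ) • dCLM j (heat A t h) := by
  have hpi : (2 * Real.pi * Complex.I : ℂ) ≠ 0 := by simp [Real.pi_ne_zero]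
  refine schwartz_ext_fourier fun ξ => ?_
  have e1 : ⇑(𝓕 (heat A t h) : 𝓢(Eucl N, ℂ)) = fun ξ => heatSymbol A t ξ * 𝓕 h ξ :=
    funext fun ξ => fourier_heat_apply hA ht h ξ
  have e2 := partialD_fourier i (heat A t h) ξ w
  have e3 := partialD_fourier i h ξ w
  have hm : DifferentiableAt ℝ (heatSymbol A t) ξ :=
    (contDiff_heatSymbol A t).differentiable (by simp) ξ
  have hq : DifferentiableAt ℝ (quadForm A) ξ := by
    unfold quadForm
    fun_prop
  -- The derivative of the Gaussian multiplier is the source of the correction `2 t ∑_j A_ij ∂_j`.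
  -- Symmetry of `A` enters here, through the gradient of the quadratic form.
  have e4 : fderiv ℝ (heatSymbol A t) ξ (EuclideanSpace.single i 1) =
      -(t * (4 * Real.pi ^ 2) * (2 * ∑ j, A i j * ξ j)) * heatSymbol A t ξ := by
    have h1 : HasFDerivAt (fun ξ => Real.exp (-(t * (4 * Real.pi ^ 2 * quadForm A ξ)))) _ ξ :=
      (((hq.hasFDerivAt.const_mul (4 * Real.pi ^ 2)).const_mul t).neg).exp
    have h2 := (Complex.ofRealCLM.hasFDerivAt.comp ξ h1).fderiv
    have h3 : heatSymbol A t = Complex.ofRealCLM ∘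
      (fun ξ => Real.exp (-(t * (4 * Real.pi ^ 2 * quadForm A ξ)))) := rfl
    rw [h3, h2]
    simp [fderiv_quadForm hsymm]
    ring
  have e5 : partialD i ⇑(𝓕 (heat A t h) : 𝓢(Eucl N, ℂ)) ξ = heatSymbol A t ξ * partialD i ⇑(𝓕 h : 𝓢(Eucl N, ℂ)) ξ +
      (-(t * (4 * Real.pi ^ 2) * (2 * ∑ j, A i j * ξ j)) * heatSymbol A t ξ) * 𝓕 h ξ := by
    rw [← e4]
    simp only [partialD]
    rw [e1, (hm.hasFDerivAt.fun_mul ((𝓕 h).differentiableAt (x := ξ)).hasFDerivAt).fderiv]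
    simp
    ring
  rw [e5, e3, fourier_heat_apply hA ht] at e2
  have e6 : 𝓕 (∑ j, (2 * t * A i j : ℂ) • dCLM j (heat A t h)) ξ =
      ∑ j, 2 * t * A i j * (2 * Real.pi * Complex.I * ξ j * (heatSymbol A t ξ * 𝓕 h ξ)) := by
    have : 𝓕 (∑ j, (2 * t * A i j : ℂ) • dCLM j (heat A t h)) =
        ∑ j, (2 * t * A i j : ℂ) • 𝓕 (dCLM j (heat A t h)) := by
      have := map_sum (fourierCLM ℂ 𝓢(Eucl N, ℂ))
        (fun j => (2 * t * A i j : ℂ) • dCLM j (heat A t h)) Finset.univ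
      simp
    rw [this]
    simp [fourier_dCLM_apply, fourier_heat_apply hA ht]
  rw [FourierTransform.fourier_add, add_apply, e6, fourier_heat_apply hA ht]
  have e7 : ∑ j, 2 * t * A i j * (2 * Real.pi * Complex.I * ξ j * (heatSymbol A t ξ * 𝓕 h ξ)) =
      (2 * t * (2 * Real.pi * Complex.I) * (heatSymbol A t ξ * 𝓕 h ξ)) * ∑ j, (A i j * ξ j : ℂ) := by
    rw [Finset.mul_sum]
    exact Finset.sum_congr rfl fun j _ => by ring
  rw [e7]
  push_cast at e2
  refine mul_left_cancel₀ hpi ?_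
  linear_combination (-1 : ℂ) * e2 - (8 * Real.pi ^ 2 * t * (∑ j, (A i j * ξ j : ℂ)) *
    heatSymbol A t ξ * 𝓕 h ξ) * Complex.I_sq

end Heat

/-! ### Time dependence of the heat semigroup in weighted norms. -/

section Heat

open FourierTransform LineDeriv SchwartzMap

variable {N : ℕ}

theorem fourier_finset_sum {ι : Type*} (s : Finset ι) (f : ι → 𝓢(Eucl N, ℂ)) :
    𝓕 (∑ i ∈ s, f i) = ∑ i ∈ s, 𝓕 (f i) :=
  map_sum (fourierCLM ℂ 𝓢(Eucl N, ℂ)) f s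

/-- The operator `∑ A_{ij} ∂_i ∂_j` on Schwartz space. -/
def lapCLM (A : Fin N → Fin N → ℝ) : 𝓢(Eucl N, ℂ) →L[ℂ] 𝓢(Eucl N, ℂ) :=
  ∑ i, ∑ j, (A i j : ℂ) • (dCLM i ∘L dCLM j)

theorem lapCLM_eq (A : Fin N → Fin N → ℝ) (h : 𝓢(Eucl N, ℂ)) :
    lapCLM A h = ∑ i, ∑ j, (A i j : ℂ) • dCLM i (dCLM j h) := by
  simp [lapCLM, sum_apply]

theorem fourier_lapCLM_apply (A : Fin N → Fin N → ℝ) (h : 𝓢(Eucl N, ℂ)) (ξ : Eucl N) :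
    𝓕 (lapCLM A h) ξ = -(4 * Real.pi ^ 2 * quadForm A ξ : ℝ) * 𝓕 h ξ := by
  have h1 : 𝓕 (lapCLM A h) ξ = ∑ i, ∑ j, (A i j : ℂ) * (2 * Real.pi * Complex.I * ξ i *
      (2 * Real.pi * Complex.I * ξ j * 𝓕 h ξ)) := by
    rw [lapCLM_eq, fourier_finset_sum]
    simp_rw [fourier_finset_sum]
    simp [fourier_dCLM_apply]
  rw [h1, quadForm]
  push_cast
  simp only [Finset.mul_sum, Finset.sum_mul, ← Finset.sum_neg_distrib]
  refine Finset.sum_congr rfl fun i _ => Finset.sum_congr rfl fun j _ => ?_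
  linear_combination (4 * Real.pi ^ 2 * A i j * ξ i * ξ j * 𝓕 h ξ : ℂ) * Complex.I_sq

theorem heat_apply {A : Fin N → Fin N → ℝ} (hA : ∀ ξ, 0 ≤ quadForm A ξ) {t : ℝ} (ht : 0 ≤ t)
    (h : 𝓢(Eucl N, ℂ)) (x : Eucl N) : heat A t h x =
      ∫ ξ, Complex.exp (2 * Real.pi * inner ℝ ξ x * Complex.I) * (heatSymbol A t ξ * 𝓕 h ξ) := by
  have h1 : heat A t h = 𝓕⁻ (𝓕 (heat A t h)) :=
    (FourierTransform.fourierInv_fourier_eq (F := 𝓢(Eucl N, ℂ)) _).symm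
  rw [h1, SchwartzMap.fourierInv_coe, Real.fourierInv_eq']
  refine integral_congr_ae (.of_forall fun ξ => ?_)
  simp [fourier_heat_apply hA ht]

/-- Writing the time as `r ^ 2` makes the multiplier bounded for every real `r`, so that
differentiability holds through `r = 0`. Continuity of the semigroup up to time 0 then follows from
the mean value inequality without one-sided derivatives. -/
theorem hasDerivAt_heat_sq {A : Fin N → Fin N → ℝ} (hA : ∀ ξ, 0 ≤ quadForm A ξ)
    (h : 𝓢(Eucl N, ℂ)) (x : Eucl N) (r : ℝ) :
    HasDerivAt (fun r : ℝ => heat A (r ^ 2) h x) (2 * r * heat A (r ^ 2) (lapCLM A h) x) r := by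
  have e : ∀ (r : ℝ) (g : 𝓢(Eucl N, ℂ)), heat A (r ^ 2) g x =
      ∫ ξ, Complex.exp (2 * Real.pi * inner ℝ ξ x * Complex.I) * (heatSymbol A (r ^ 2) ξ * 𝓕 g ξ) :=
    fun r g => heat_apply hA (sq_nonneg r) g x
  simp_rw [e, ← integral_const_mul]
  have hn : ∀ (r : ℝ) ξ (c : ℂ), ‖Complex.exp (2 * Real.pi * inner ℝ ξ x * Complex.I) *
      (heatSymbol A (r ^ 2) ξ * c)‖ ≤ ‖c‖ := fun r ξ c => by
    have h1 : ‖Complex.exp (2 * Real.pi * inner ℝ ξ x * Complex.I)‖ = 1 := by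
      have := Complex.norm_exp_ofReal_mul_I (2 * Real.pi * inner ℝ ξ x)
      push_cast at this
      exact this
    rw [norm_mul, norm_mul, h1, one_mul]
    exact mul_le_of_le_one_left (norm_nonneg _) (norm_heatSymbol_le hA (sq_nonneg r) ξ)
  have hc : ∀ (r : ℝ) (g : 𝓢(Eucl N, ℂ)), Continuous fun ξ : Eucl N =>
      Complex.exp (2 * Real.pi * inner ℝ ξ x * Complex.I) * (heatSymbol A (r ^ 2) ξ * 𝓕 g ξ) :=
    fun r g => by
      have := (contDiff_heatSymbol A (r ^ 2)).continuous
      have := (𝓕 g).continuous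
      fun_prop
  refine (hasDerivAt_integral_of_dominated_loc_of_deriv_le
    (bound := fun ξ => 2 * (|r| + 1) * ‖𝓕 (lapCLM A h) ξ‖)
    (F' := fun (r : ℝ) ξ => 2 * (r : ℂ) * (Complex.exp (2 * Real.pi * inner ℝ ξ x * Complex.I) *
      (heatSymbol A (r ^ 2) ξ * 𝓕 (lapCLM A h) ξ)))
    (Metric.ball_mem_nhds r one_pos) (.of_forall fun r => (hc r h).aestronglyMeasurable)
    ((𝓕 h).integrable.norm.mono' (hc r h).aestronglyMeasurable (.of_forall fun ξ => hn r ξ _))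
    ((hc r _).const_mul _).aestronglyMeasurable (.of_forall fun ξ s hs => ?_)
    ((𝓕 (lapCLM A h)).integrable.norm.const_mul _) (.of_forall fun ξ s _ => ?_)).2
  · rw [norm_mul]
    refine mul_le_mul ?_ (hn s ξ _) (norm_nonneg _) (by positivity)
    rw [norm_mul, Complex.norm_real, Complex.norm_two, Real.norm_eq_abs]
    have h1 : |s - r| < 1 := hs
    have h2 : |s| - |r| ≤ |s - r| := abs_sub_abs_le_abs_sub s r
    linarith
  · have h1 : HasDerivAt (fun s : ℝ => Real.exp (-(s ^ 2 * (4 * Real.pi ^ 2 * quadForm A ξ)))) _ s :=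
      (((hasDerivAt_pow 2 s).mul_const _).neg).exp
    have h2 := ((h1.ofReal_comp).mul_const (𝓕 h ξ)).const_mul
      (Complex.exp (2 * Real.pi * inner ℝ ξ x * Complex.I))
    refine h2.congr_deriv ?_
    rw [fourier_lapCLM_apply, heatSymbol]
    simp only [Pi.neg_apply]
    push_cast
    ring

theorem hasDerivAt_heat {A : Fin N → Fin N → ℝ} (hA : ∀ ξ, 0 ≤ quadForm A ξ)
    (h : 𝓢(Eucl N, ℂ)) (x : Eucl N) {t : ℝ} (ht : 0 < t) :
    HasDerivAt (fun t : ℝ => heat A t h x) (heat A t (lapCLM A h) x) t := by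
  have h1 := (hasDerivAt_heat_sq hA h x (√t)).scomp t (Real.hasDerivAt_sqrt ht.ne')
  have h2 : (fun t : ℝ => heat A t h x) =ᶠ[𝓝 t] (fun r : ℝ => heat A (r ^ 2) h x) ∘ Real.sqrt := by
    filter_upwards [eventually_gt_nhds ht] with τ hτ
    simp [Real.sq_sqrt hτ.le]
  refine (h1.congr_of_eventuallyEq h2).congr_deriv ?_
  have h3 : (√t : ℂ) ≠ 0 := by exact_mod_cast (Real.sqrt_pos.2 ht).ne'
  rw [Real.sq_sqrt ht.le, Complex.real_smul]
  push_cast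
  field_simp

/-- The multipliers with `t ∈ [0, T]` are uniformly temperate, so their products with `𝓕 h` form a
bounded set in Schwartz space. The inverse Fourier transform keeps it bounded. -/
theorem exists_bound_heat {A : Fin N → Fin N → ℝ} (hA : ∀ ξ, 0 ≤ quadForm A ξ) (T : ℝ)
    (h : 𝓢(Eucl N, ℂ)) (m : ℕ) :
    ∃ C, 0 ≤ C ∧ ∀ t ∈ Icc 0 T, ∀ x, (1 + ‖x‖) ^ m * ‖heat A t h x‖ ≤ C := by
  have hρ : ∀ ξ : Eucl N, 1 ≤ 1 + ‖ξ‖ := one_le_one_add_norm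
  have h1 : UnifRapid (fun _ : Eucl N => 1) (fun ξ => 1 + ‖ξ‖) (fun _ : Icc 0 T => ⇑(𝓕 h : 𝓢(Eucl N, ℂ))) := by
    refine ⟨fun _ => (𝓕 h).smooth', fun n => ⟨0, fun m => ?_⟩⟩
    obtain ⟨C, -, hC⟩ := exists_bound_of_schwartz_clm (ι := Unit) (.id ℂ _) (g := fun _ => 𝓕 h)
      (fun k n => ((𝓕 h).decay' k n).imp fun C h _ => h) m n
    exact ⟨C, fun _ ξ => by simpa using hC () ξ⟩
  have h2 := UnifRapid.bilinear (ContinuousLinearMap.mul ℝ ℂ)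
    (by simpa using unifTemperate_heatSymbol hA T) h1 (fun _ => le_rfl) hρ
  obtain ⟨C, hC, h3⟩ := exists_bound_of_schwartz_clm (fourierInvCLM ℂ 𝓢(Eucl N, ℂ))
    (g := fun t : Icc 0 T => 𝓕 (heat A t h)) (fun k n => by
      obtain ⟨l, h3⟩ := h2.2 n
      obtain ⟨C, hC⟩ := h3 k
      refine ⟨C, fun t ξ => le_trans ?_ ((hC t ξ).trans_eq (by simp))⟩
      have e : ⇑(𝓕 (heat A t h) : 𝓢(Eucl N, ℂ)) = fun ξ => heatSymbol A t ξ * 𝓕 h ξ :=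
        funext fun ξ => fourier_heat_apply hA t.2.1 h ξ
      rw [e]
      simp only [ContinuousLinearMap.mul_apply']
      gcongr
      linarith) m 0
  refine ⟨C, hC, fun t ht x => ?_⟩
  have := h3 ⟨t, ht⟩ x
  simpa [FourierTransform.fourierInv_fourier_eq] using this

/-- `t ↦ heat A t h` is Hölder continuous with exponent `1 / 2`, with values in weighted spaces. -/
theorem exists_bound_heat_sub {A : Fin N → Fin N → ℝ} (hA : ∀ ξ, 0 ≤ quadForm A ξ) (T : ℝ)
    (h : 𝓢(Eucl N, ℂ)) (m : ℕ) : ∃ C, 0 ≤ C ∧ ∀ t ∈ Icc 0 T, ∀ τ ∈ Icc 0 T, ∀ x,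
      (1 + ‖x‖) ^ m * ‖heat A τ h x - heat A t h x‖ ≤ C * |√τ - √t| := by
  obtain ⟨C, hC, hb⟩ := exists_bound_heat hA T (lapCLM A h) m
  refine ⟨2 * √T * C, by positivity, fun t ht τ hτ x => ?_⟩
  have h0 : 0 < (1 + ‖x‖) ^ m := by positivity
  have h1 : ‖heat A (√τ ^ 2) h x - heat A (√t ^ 2) h x‖ ≤
      (2 * √T * (C / (1 + ‖x‖) ^ m)) * ‖√τ - √t‖ := by
    refine Convex.norm_image_sub_le_of_norm_hasDerivWithin_le (s := Icc 0 √T)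
      (fun r _ => (hasDerivAt_heat_sq hA h x r).hasDerivWithinAt) (fun r hr => ?_)
      (convex_Icc _ _) ⟨Real.sqrt_nonneg _, Real.sqrt_le_sqrt ht.2⟩
      ⟨Real.sqrt_nonneg _, Real.sqrt_le_sqrt hτ.2⟩
    rw [norm_mul, norm_mul, Complex.norm_two, Complex.norm_real, Real.norm_of_nonneg hr.1]
    have hT : r ^ 2 ≤ T := by
      by_cases hT : 0 ≤ T
      · calc r ^ 2 ≤ √T ^ 2 := pow_le_pow_left₀ hr.1 hr.2 2
          _ = T := Real.sq_sqrt hT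
      · exact absurd (ht.1.trans ht.2) hT
    have h2 := hb (r ^ 2) ⟨sq_nonneg r, hT⟩ x
    have h3 : ‖heat A (r ^ 2) (lapCLM A h) x‖ ≤ C / (1 + ‖x‖) ^ m := by
      rwa [le_div_iff₀ h0, mul_comm]
    have := hr.2
    have := hr.1
    gcongr
  rw [Real.sq_sqrt hτ.1, Real.sq_sqrt ht.1, Real.norm_eq_abs] at h1
  calc _ ≤ (1 + ‖x‖) ^ m * ((2 * √T * (C / (1 + ‖x‖) ^ m)) * |√τ - √t|) := by gcongr
    _ = _ := by field_simp

/-- The first order Taylor remainder in time, from two applications of the mean value inequality;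
the second time derivative is the heat flow of `lapCLM A (lapCLM A h)`. It makes the difference
quotients of the flow converge in weighted norms at positive times. -/
theorem exists_bound_heat_sub_sub {A : Fin N → Fin N → ℝ} (hA : ∀ ξ, 0 ≤ quadForm A ξ) (T : ℝ)
    (h : 𝓢(Eucl N, ℂ)) (m : ℕ) : ∃ C, 0 ≤ C ∧ ∀ t ∈ Ioc 0 T, ∀ τ ∈ Ioc 0 T, ∀ x,
      (1 + ‖x‖) ^ m * ‖heat A τ h x - heat A t h x - (τ - t) * heat A t (lapCLM A h) x‖ ≤
        C * |τ - t| ^ 2 := by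
  obtain ⟨C, hC, hb⟩ := exists_bound_heat hA T (lapCLM A (lapCLM A h)) m
  refine ⟨C, hC, fun t ht τ hτ x => ?_⟩
  have h0 : 0 < (1 + ‖x‖) ^ m := by positivity
  have hs : ∀ r ∈ uIcc t τ, 0 < r ∧ r ≤ T := fun r hr =>
    ⟨(lt_min ht.1 hτ.1).trans_le hr.1, hr.2.trans (max_le ht.2 hτ.2)⟩
  have h1 : ∀ r ∈ uIcc t τ, ‖heat A r (lapCLM A h) x - heat A t (lapCLM A h) x‖ ≤
      C / (1 + ‖x‖) ^ m * |τ - t| := fun r hr => by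
    refine (Convex.norm_image_sub_le_of_norm_hasDerivWithin_le (s := uIcc t τ)
      (C := C / (1 + ‖x‖) ^ m)
      (fun r hr => (hasDerivAt_heat hA (lapCLM A h) x (hs r hr).1).hasDerivWithinAt)
      (fun r hr => ?_) (convex_uIcc _ _) left_mem_uIcc hr).trans ?_
    · rw [le_div_iff₀ h0, mul_comm]
      exact hb r ⟨(hs r hr).1.le, (hs r hr).2⟩ x
    · have := abs_sub_left_of_mem_uIcc hr
      rw [Real.norm_eq_abs]
      gcongr
  have h2 := Convex.norm_image_sub_le_of_norm_hasDerivWithin_le (s := uIcc t τ)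
    (f := fun r : ℝ => heat A r h x - (r : ℂ) * heat A t (lapCLM A h) x)
    (fun r hr => ((hasDerivAt_heat hA h x (hs r hr).1).sub
      ((Complex.ofRealCLM.hasDerivAt (x := r)).mul_const _)).hasDerivWithinAt)
    (fun r hr => by simpa using h1 r hr) (convex_uIcc _ _) left_mem_uIcc right_mem_uIcc
  calc _ = (1 + ‖x‖) ^ m * ‖heat A τ h x - (τ : ℂ) * heat A t (lapCLM A h) x -
        (heat A t h x - (t : ℂ) * heat A t (lapCLM A h) x)‖ := by
        congr 2
        ring
    _ ≤ (1 + ‖x‖) ^ m * (C / (1 + ‖x‖) ^ m * |τ - t| * ‖τ - t‖) := by gcongr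
    _ = _ := by
      rw [Real.norm_eq_abs]
      field_simp

end Heat

/-! ### Existence and uniqueness of classical solutions for constant coefficients. -/

section Uniqueness

open SchwartzMap

variable {N : ℕ}

/-- The operator with constant coefficients `∑ A_{ij} ∂_i ∂_j`. -/
def constOp (A : Fin N → Fin N → ℝ) : SecondOrderOp N where
  a := fun i j _ => A i j
  b := fun _ _ => 0
  c := fun _ => 0

theorem constOp_act (A : Fin N → Fin N → ℝ) (u : Eucl N → ℂ) (x : Eucl N) :
    (constOp A).act u x = ∑ i, ∑ j, (A i j : ℂ) * partialD i (partialD j u) x := by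
  simp [SecondOrderOp.act, constOp]

theorem constOp_act_schwartz (A : Fin N → Fin N → ℝ) (h : 𝓢(Eucl N, ℂ)) :
    (constOp A).act h = lapCLM A h := by
  ext x
  rw [constOp_act, lapCLM_eq]
  simp [coe_dCLM, sum_apply]

theorem memLp_one_add_norm {p : ℝ≥0∞} (hp : 1 ≤ p) (hp' : p < ⊤) :
    MemLp (fun x : Eucl N => ((1 + ‖x‖) ^ (N + 1))⁻¹) p volume := by
  have hm : AEStronglyMeasurable (fun x : Eucl N => ((1 + ‖x‖) ^ (N + 1))⁻¹) volume :=
    Measurable.aestronglyMeasurable (by fun_prop)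
  have h1 : Integrable (fun x : Eucl N => ((1 + ‖x‖) ^ (N + 1))⁻¹) volume := by
    refine integrable_of_one_add_norm_bound (C := 1) hm fun ξ => ?_
    have : 0 < 1 + ‖ξ‖ := by positivity
    rw [finrank_euclideanSpace_fin, norm_inv, Real.norm_of_nonneg (by positivity)]
    exact (mul_inv_cancel₀ (by positivity)).le
  rw [← integrable_norm_rpow_iff hm (zero_lt_one.trans_le hp).ne' hp'.ne]
  refine h1.mono' (Measurable.aestronglyMeasurable (by fun_prop)) (.of_forall fun x => ?_)
  have h2 : 1 ≤ (1 + ‖x‖) ^ (N + 1) := one_le_pow₀ (one_le_one_add_norm x)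
  have h3 : 1 ≤ p.toReal := by
    rw [← ENNReal.toReal_one]
    exact ENNReal.toReal_mono hp'.ne hp
  have h4 : 0 < ((1 + ‖x‖) ^ (N + 1))⁻¹ := by positivity
  rw [Real.norm_of_nonneg (by positivity), Real.norm_of_nonneg h4.le]
  calc _ ≤ (((1 + ‖x‖) ^ (N + 1))⁻¹) ^ (1 : ℝ) :=
        Real.rpow_le_rpow_of_exponent_ge h4 (inv_le_one_of_one_le₀ h2) h3
    _ = _ := Real.rpow_one _

/-- The function `(1 + ‖x‖) ^ (-(N + 1))` lies in `L^p` for all `1 ≤ p < ∞`, so weighted uniform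
bounds control `L^p` norms. -/
theorem tendsto_eLpNorm_of_weighted {p : ℝ≥0∞} (hp : 1 ≤ p) (hp' : p < ⊤) {ι : Type*}
    {l : Filter ι} {f : ι → Eucl N → ℂ} {c : ι → ℝ} (hc : Tendsto c l (𝓝 0))
    (h : ∀ᶠ i in l, ∀ x, (1 + ‖x‖) ^ (N + 1) * ‖f i x‖ ≤ c i) :
    Tendsto (fun i => eLpNorm (f i) p volume) l (𝓝 0) := by
  have h1 : Tendsto (fun i => ENNReal.ofReal (c i) *
      eLpNorm (fun x : Eucl N => ((1 + ‖x‖) ^ (N + 1))⁻¹) p volume) l (𝓝 0) := by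
    have := ENNReal.Tendsto.mul_const (ENNReal.tendsto_ofReal hc)
      (b := eLpNorm (fun x : Eucl N => ((1 + ‖x‖) ^ (N + 1))⁻¹) p volume)
      (Or.inr (memLp_one_add_norm hp hp').2.ne)
    simpa using this
  refine tendsto_of_tendsto_of_tendsto_of_le_of_le' tendsto_const_nhds h1
    (.of_forall fun _ => zero_le) ?_
  filter_upwards [h] with i hi
  refine eLpNorm_le_mul_eLpNorm_of_ae_le_mul (.of_forall fun x => ?_) p
  have h2 : 0 < (1 + ‖x‖) ^ (N + 1) := by positivity
  rw [norm_inv, Real.norm_of_nonneg h2.le, ← div_eq_mul_inv, le_div_iff₀ h2, mul_comm]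
  exact hi x

theorem tendsto_abs_sqrt_sub (t : ℝ) (s : Set ℝ) (C : ℝ) :
    Tendsto (fun τ => C * |√τ - √t|) (𝓝[s] t) (𝓝 0) := by
  have : Continuous fun τ => C * |√τ - √t| := by fun_prop
  have := (this.tendsto t).mono_left (nhdsWithin_le_nhds (s := s))
  simpa using this

theorem continuousInLp_heat {A : Fin N → Fin N → ℝ} (hA : ∀ ξ, 0 ≤ quadForm A ξ) {p : ℝ≥0∞}
    (hp : 1 ≤ p) (hp' : p < ⊤) (h : 𝓢(Eucl N, ℂ)) :
    ContinuousInLp p (Ici 0) (fun t => heat A t h) := by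
  refine ⟨fun t _ => (heat A t h).memLp p volume, fun t ht => ?_⟩
  obtain ⟨C, -, hC⟩ := exists_bound_heat_sub hA (t + 1) h (N + 1)
  refine tendsto_eLpNorm_of_weighted hp hp' (tendsto_abs_sqrt_sub t _ C) ?_
  filter_upwards [self_mem_nhdsWithin, mem_nhdsWithin_of_mem_nhds
    (Iic_mem_nhds (lt_add_one t))] with τ h1 h2 x
  exact hC t ⟨ht, by linarith⟩ τ ⟨h1, h2⟩ x

theorem ContinuousInLp.mono {p : ℝ≥0∞} {J J' : Set ℝ} {v : ℝ → Eucl N → ℂ}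
    (hv : ContinuousInLp p J v) (h : J' ⊆ J) : ContinuousInLp p J' v :=
  ⟨fun t ht => hv.1 t (h ht), fun t ht => (hv.2 t (h ht)).mono_left (nhdsWithin_mono t h)⟩

theorem ContinuousInLp.congr {p : ℝ≥0∞} {J : Set ℝ} {v v' : ℝ → Eucl N → ℂ}
    (hv : ContinuousInLp p J v) (h : ∀ t ∈ J, v' t = v t) : ContinuousInLp p J v' := by
  refine ⟨fun t ht => h t ht ▸ hv.1 t ht, fun t ht => (hv.2 t ht).congr' ?_⟩
  filter_upwards [self_mem_nhdsWithin] with τ hτ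
  rw [h t ht, h τ hτ]

theorem heat_lapCLM {A : Fin N → Fin N → ℝ} (hA : ∀ ξ, 0 ≤ quadForm A ξ) {t : ℝ} (ht : 0 ≤ t)
    (h : 𝓢(Eucl N, ℂ)) : heat A t (lapCLM A h) = lapCLM A (heat A t h) := by
  simp [lapCLM_eq, heat_dCLM hA ht]

/-- Spatial derivatives commute with the semigroup, so each continuity requirement reduces to
continuity of the flow with another Schwartz datum. -/
theorem isClassicalSolution_heat {A : Fin N → Fin N → ℝ} (hA : ∀ ξ, 0 ≤ quadForm A ξ) {p : ℝ≥0∞}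
    (hp : 1 ≤ p) (hp' : p < ⊤) (h : 𝓢(Eucl N, ℂ)) :
    IsClassicalSolution p (constOp A) h (fun t => heat A t h) where
  initial := by simp only [heat_zero hA]
  contDiff t _ := (heat A t h).smooth 2
  continuous_Lp := continuousInLp_heat hA hp hp' h
  continuous_first i := by
    refine ((continuousInLp_heat hA hp hp' (dCLM i h)).mono Ioi_subset_Ici_self).congr
      fun t ht => ?_
    rw [heat_dCLM hA (le_of_lt ht), coe_dCLM]
  continuous_second i j := by
    refine ((continuousInLp_heat hA hp hp' (dCLM i (dCLM j h))).mono Ioi_subset_Ici_self).congr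
      fun t ht => ?_
    rw [heat_dCLM hA (le_of_lt ht), heat_dCLM hA (le_of_lt ht), coe_dCLM, coe_dCLM]
  equation t ht := by
    obtain ⟨C, hC0, hC⟩ := exists_bound_heat_sub_sub hA (t + 1) h (N + 1)
    have hc : Tendsto (fun τ => C * |τ - t|) (𝓝[≠] t) (𝓝 0) := by
      have : Continuous fun τ => C * |τ - t| := by fun_prop
      simpa using (this.tendsto t).mono_left nhdsWithin_le_nhds
    refine tendsto_eLpNorm_of_weighted hp hp' hc ?_
    filter_upwards [self_mem_nhdsWithin, mem_nhdsWithin_of_mem_nhds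
      (Iic_mem_nhds (lt_add_one t)), mem_nhdsWithin_of_mem_nhds (Ioi_mem_nhds ht)]
      with τ h0 h1 h2 x
    have h3 := hC t ⟨ht, by linarith⟩ τ ⟨h2, h1⟩ x
    have h4 : (τ - t : ℂ) ≠ 0 := by
      rw [sub_ne_zero]
      exact_mod_cast h0
    have h5 : 0 < |τ - t| := abs_pos.2 (sub_ne_zero.2 h0)
    rw [constOp_act_schwartz, ← heat_lapCLM hA ht.le]
    have e : ((τ - t)⁻¹ • (⇑(heat A τ h) - ⇑(heat A t h)) - ⇑(heat A t (lapCLM A h))) x =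
        (τ - t : ℂ)⁻¹ * (heat A τ h x - heat A t h x - (τ - t) * heat A t (lapCLM A h) x) := by
      simp only [Pi.sub_apply, Pi.smul_apply, Complex.real_smul]
      push_cast
      field_simp
    have h6 : ‖(τ - t : ℂ)‖ = |τ - t| := by
      rw [← Complex.ofReal_sub, Complex.norm_real, Real.norm_eq_abs]
    rw [e, norm_mul, norm_inv, h6]
    calc _ = |τ - t|⁻¹ * ((1 + ‖x‖) ^ (N + 1) *
          ‖heat A τ h x - heat A t h x - (τ - t) * heat A t (lapCLM A h) x‖) := by ring
      _ ≤ |τ - t|⁻¹ * (C * |τ - t| ^ 2) := by gcongr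
      _ = C * |τ - t| := by field_simp

open Classical in
/-- The family `v` as a family of elements of `L^p`, with the value `0` off `L^p`. -/
def lpFamily (p : ℝ≥0∞) (v : ℝ → Eucl N → ℂ) (t : ℝ) : Lp ℂ p (volume : Measure (Eucl N)) :=
  if h : MemLp (v t) p volume then h.toLp else 0

theorem lpFamily_eq {p : ℝ≥0∞} {v : ℝ → Eucl N → ℂ} {t : ℝ} (h : MemLp (v t) p volume) :
    lpFamily p v t = h.toLp := dif_pos h

theorem continuousOn_lpFamily {p : ℝ≥0∞} [Fact (1 ≤ p)] {J : Set ℝ} {v : ℝ → Eucl N → ℂ}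
    (hv : ContinuousInLp p J v) : ContinuousOn (lpFamily p v) J := fun t ht => by
  rw [ContinuousWithinAt, Lp.tendsto_Lp_iff_tendsto_eLpNorm']
  refine (hv.2 t ht).congr' ?_
  filter_upwards [self_mem_nhdsWithin] with τ hτ
  rw [lpFamily_eq (hv.1 t ht), lpFamily_eq (hv.1 τ hτ)]
  exact eLpNorm_congr_ae ((hv.1 τ hτ).coeFn_toLp.symm.sub (hv.1 t ht).coeFn_toLp.symm)

theorem hasDerivAt_lpFamily {p : ℝ≥0∞} [Fact (1 ≤ p)] {v : ℝ → Eucl N → ℂ} {w : Eucl N → ℂ}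
    {t : ℝ} (hv : ∀ᶠ τ in 𝓝 t, MemLp (v τ) p volume) (hw : MemLp w p volume)
    (h : Tendsto (fun τ => eLpNorm ((τ - t)⁻¹ • (v τ - v t) - w) p volume) (𝓝[≠] t) (𝓝 0)) :
    HasDerivAt (lpFamily p v) hw.toLp t := by
  rw [hasDerivAt_iff_tendsto_slope, Lp.tendsto_Lp_iff_tendsto_eLpNorm']
  refine h.congr' ?_
  filter_upwards [nhdsWithin_le_nhds hv] with τ hτ
  have ht := hv.self_of_nhds
  rw [slope_def_module, lpFamily_eq hτ, lpFamily_eq ht, ← MemLp.toLp_sub, ← MemLp.toLp_const_smul]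
  exact eLpNorm_congr_ae ((((hτ.sub ht).const_smul _).coeFn_toLp.symm).sub hw.coeFn_toLp.symm)

variable {A : Fin N → Fin N → ℝ} {p : ℝ≥0∞} {f : Eucl N → ℂ} {u : ℝ → Eucl N → ℂ}

theorem IsClassicalSolution.memLp_act (hu : IsClassicalSolution p (constOp A) f u) {t : ℝ}
    (ht : 0 < t) : MemLp ((constOp A).act (u t)) p volume := by
  have : (constOp A).act (u t) = fun x => ∑ i, ∑ j, (A i j : ℂ) * partialD i (partialD j (u t)) x :=
    funext fun x => constOp_act A (u t) x
  rw [this]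
  exact memLp_finsetSum _ fun i _ => memLp_finsetSum _ fun j _ =>
    ((hu.continuous_second i j).1 t ht).const_mul _

theorem IsClassicalSolution.hasDerivAt [Fact (1 ≤ p)] (hu : IsClassicalSolution p (constOp A) f u)
    {t : ℝ} (ht : 0 < t) : HasDerivAt (lpFamily p u) (hu.memLp_act ht).toLp t :=
  hasDerivAt_lpFamily ((eventually_gt_nhds ht).mono fun τ hτ => hu.continuous_Lp.1 τ (le_of_lt hτ))
    _ (hu.equation t ht)

theorem integral_partialD_mul {v : Eucl N → ℂ} (hv : ContDiff ℝ 1 v) {q : ℝ≥0∞}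
    [p.HolderConjugate q] (h0 : MemLp v p volume) (i : Fin N) (h1 : MemLp (partialD i v) p volume)
    (ψ : 𝓢(Eucl N, ℂ)) : ∫ x, partialD i v x * ψ x = -∫ x, v x * dCLM i ψ x := by
  rw [coe_dCLM]
  have hd : MemLp (partialD i ψ) q volume := by
    rw [← coe_dCLM]
    exact (dCLM i ψ).memLp q volume
  have := integral_mul_fderiv_eq_neg_fderiv_mul_of_integrable (μ := volume) (f := v) (g := ψ)
    (v := EuclideanSpace.single i (1 : ℝ)) (h1.integrable_mul (ψ.memLp q volume))
    (h0.integrable_mul hd) (h0.integrable_mul (ψ.memLp q volume))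
    (fun x _ => hv.differentiable one_ne_zero x) (fun x _ => ψ.differentiableAt)
  simp only [partialD] at this ⊢
  rw [this, neg_neg]

/-- Two integrations by parts, legitimate because `u t` is of class `C²` with the relevant
derivatives in `L^p`. They exchange the two indices, which the symmetry of `A` undoes. -/
theorem IsClassicalSolution.integral_act_mul (hsymm : ∀ i j, A i j = A j i) {q : ℝ≥0∞}
    [p.HolderConjugate q] (hu : IsClassicalSolution p (constOp A) f u) {t : ℝ} (ht : 0 < t)
    (ψ : 𝓢(Eucl N, ℂ)) :
    ∫ x, (constOp A).act (u t) x * ψ x = ∫ x, u t x * lapCLM A ψ x := by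
  have h2 := hu.contDiff t ht
  have hI : ∀ i j, ∫ x, partialD i (partialD j (u t)) x * ψ x =
      ∫ x, u t x * dCLM j (dCLM i ψ) x := fun i j => by
    rw [integral_partialD_mul (q := q) ?_ ((hu.continuous_first j).1 t ht) i
      ((hu.continuous_second i j).1 t ht), integral_partialD_mul (q := q) (h2.of_le one_le_two)
      (hu.continuous_Lp.1 t ht.le) j ((hu.continuous_first j).1 t ht), neg_neg]
    exact (h2.fderiv_right (m := 1) (by norm_num)).clm_apply contDiff_const
  have hi1 : ∀ i j, Integrable (fun x => (A i j : ℂ) * (partialD i (partialD j (u t)) x * ψ x)) :=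
    fun i j => (((hu.continuous_second i j).1 t ht).integrable_mul (ψ.memLp q volume)).const_mul _
  have hi2 : ∀ i j, Integrable (fun x => (A i j : ℂ) * (u t x * dCLM i (dCLM j ψ) x)) :=
    fun i j => ((hu.continuous_Lp.1 t ht.le).integrable_mul
      ((dCLM i (dCLM j ψ)).memLp q volume)).const_mul _
  have e1 : ∀ x, (constOp A).act (u t) x * ψ x =
      ∑ i, ∑ j, (A i j : ℂ) * (partialD i (partialD j (u t)) x * ψ x) := fun x => by
    simp only [constOp_act, Finset.sum_mul, mul_assoc]
  have e2 : ∀ x, u t x * lapCLM A ψ x =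
      ∑ i, ∑ j, (A i j : ℂ) * (u t x * dCLM i (dCLM j ψ) x) := fun x => by
    rw [lapCLM_eq]
    simp only [sum_apply, smul_apply, smul_eq_mul, Finset.mul_sum, mul_left_comm]
  simp_rw [e1, e2]
  rw [integral_finsetSum _ fun i _ => integrable_finsetSum _ fun j _ => hi1 i j,
    integral_finsetSum _ fun i _ => integrable_finsetSum _ fun j _ => hi2 i j]
  simp_rw [integral_finsetSum _ fun j _ => hi1 _ j, integral_finsetSum _ fun j _ => hi2 _ j,
    integral_const_mul, hI]
  rw [Finset.sum_comm]
  exact Finset.sum_congr rfl fun i _ => Finset.sum_congr rfl fun j _ => by rw [hsymm]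

/-- The function `t ↦ B (U t) (V (T - t))` has derivative zero on `(0, T)` and is continuous on `[0,
T]`, so its values at the ends agree. -/
theorem bilinear_eq_of_hasDerivAt {E F : Type*} [NormedAddCommGroup E] [NormedSpace ℝ E]
    [NormedAddCommGroup F] [NormedSpace ℝ F] (B : E →L[ℝ] F →L[ℝ] ℂ) {U U' : ℝ → E} {V V' : ℝ → F}
    {T : ℝ} (hT : 0 < T) (hU : ContinuousOn U (Ici 0)) (hV : ContinuousOn V (Ici 0))
    (dU : ∀ t, 0 < t → HasDerivAt U (U' t) t) (dV : ∀ t, 0 < t → HasDerivAt V (V' t) t)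
    (h : ∀ t ∈ Ioo 0 T, B (U' t) (V (T - t)) = B (U t) (V' (T - t))) :
    B (U T) (V 0) = B (U 0) (V T) := by
  have hcont : ContinuousOn (fun t => B (U t) (V (T - t))) (Icc 0 T) :=
    B.isBoundedBilinearMap.continuous.comp_continuousOn ((hU.mono Icc_subset_Ici_self).prodMk
      (hV.comp (by fun_prop) fun t ht => sub_nonneg.2 ht.2))
  have hderiv : ∀ t ∈ Ioo 0 T, HasDerivAt (fun t => B (U t) (V (T - t))) 0 t := fun t ht => by
    have d2 := (dV (T - t) (sub_pos.2 ht.2)).comp_const_sub T t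
    refine (B.hasDerivAt_of_bilinear (fun _ => dU t ht.1) (fun _ => d2)).congr_deriv ?_
    rw [map_neg, h t ht]
    exact neg_add_cancel _
  -- Differentiability is not available at time 0, so constancy is obtained on `[a, T]` and the
  -- limit `a → 0` is taken by continuity.
  have hconst : ∀ a ∈ Ioo 0 T, B (U T) (V (T - T)) = B (U a) (V (T - a)) := fun a ha =>
    constant_of_has_deriv_right_zero (hcont.mono (Icc_subset_Icc_left ha.1.le))
      (fun x hx => (hderiv x ⟨ha.1.trans_le hx.1, hx.2⟩).hasDerivWithinAt) T ⟨ha.2.le, le_rfl⟩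
  have h1 : Tendsto (fun t => B (U t) (V (T - t))) (𝓝[Ioo 0 T] 0) (𝓝 (B (U 0) (V (T - 0)))) :=
    (hcont 0 ⟨le_rfl, hT.le⟩).mono_left (nhdsWithin_mono 0 Ioo_subset_Icc_self)
  have h2 : Tendsto (fun t => B (U t) (V (T - t))) (𝓝[Ioo 0 T] 0) (𝓝 (B (U T) (V (T - T)))) := by
    refine tendsto_const_nhds.congr' ?_
    filter_upwards [self_mem_nhdsWithin] with a ha using hconst a ha
  have : (𝓝[Ioo 0 T] (0 : ℝ)).NeBot := by
    rw [nhdsWithin_Ioo_eq_nhdsGT hT]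
    infer_instance
  have h3 := tendsto_nhds_unique h2 h1
  rwa [sub_self, sub_zero] at h3

/-- The duality argument for uniqueness. -/
theorem IsClassicalSolution.integral_mul (hA : ∀ ξ, 0 ≤ quadForm A ξ)
    (hsymm : ∀ i j, A i j = A j i) (hp : 1 < p) (hu : IsClassicalSolution p (constOp A) f u)
    {T : ℝ} (hT : 0 < T) (φ : 𝓢(Eucl N, ℂ)) :
    ∫ x, u T x * φ x = ∫ x, f x * heat A T φ x := by
  have : Fact (1 ≤ p) := ⟨hp.le⟩
  let q : ℝ≥0∞ := ENNReal.conjExponent p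
  have hpq : p.HolderConjugate q := .conjExponent hp.le
  have hq : 1 ≤ q := le_self_add
  -- The strict inequality `1 < p` makes the dual exponent finite, so that the heat flow of `φ` is a
  -- classical solution in `L^q`.
  have hq' : q < ⊤ :=
    ENNReal.add_lt_top.2 ⟨ENNReal.one_lt_top, ENNReal.inv_lt_top.2 (tsub_pos_of_lt hp)⟩
  have : Fact (1 ≤ q) := ⟨hq⟩
  have hv := isClassicalSolution_heat hA hq hq' φ
  have hB : ∀ {g h : Eucl N → ℂ} (hg : MemLp g p volume) (hh : MemLp h q volume),
      (ContinuousLinearMap.mul ℝ ℂ).lpPairing (volume : Measure (Eucl N)) p q hg.toLp hh.toLp =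
        ∫ x, g x * h x := fun hg hh => by
    rw [ContinuousLinearMap.lpPairing_eq_integral]
    refine integral_congr_ae ?_
    filter_upwards [hg.coeFn_toLp, hh.coeFn_toLp] with x h1 h2
    simp [h1, h2]
  have hu0 : ∀ t, 0 ≤ t → MemLp (u t) p volume := hu.continuous_Lp.1
  have hv0 : ∀ t, 0 ≤ t → MemLp (heat A t φ) q volume := hv.continuous_Lp.1
  have eV : ∀ t (ht : 0 ≤ t), lpFamily q (fun t => heat A t φ) t = (hv0 t ht).toLp :=
    fun t ht => lpFamily_eq (hv0 t ht)
  have key := bilinear_eq_of_hasDerivAt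
    ((ContinuousLinearMap.mul ℝ ℂ).lpPairing (volume : Measure (Eucl N)) p q)
    (U := lpFamily p u) (U' := lpFamily p fun t => (constOp A).act (u t))
    (V := lpFamily q fun t => heat A t φ)
    (V' := lpFamily q fun t => (constOp A).act (heat A t φ)) hT
    (continuousOn_lpFamily hu.continuous_Lp) (continuousOn_lpFamily hv.continuous_Lp)
    (fun t ht => by rw [lpFamily_eq (hu.memLp_act ht)]; exact hu.hasDerivAt ht)
    (fun t ht => by rw [lpFamily_eq (hv.memLp_act ht)]; exact hv.hasDerivAt ht)
    (fun t ht => by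
      have h2 : 0 < T - t := sub_pos.2 ht.2
      rw [lpFamily_eq (hu.memLp_act ht.1), lpFamily_eq (hu0 t ht.1.le), eV _ h2.le,
        lpFamily_eq (v := fun t => (constOp A).act (heat A t φ)) (hv.memLp_act h2), hB, hB, hu.integral_act_mul (q := q) hsymm ht.1,
        constOp_act_schwartz])
  rw [lpFamily_eq (hu0 T hT.le), lpFamily_eq (hu0 0 le_rfl), eV T hT.le,
    eV 0 le_rfl, hB, hB, hu.initial, heat_zero hA] at key
  exact key

/-- Uniqueness of classical solutions with Schwartz initial data. -/
theorem IsClassicalSolution.eq_heat (hA : ∀ ξ, 0 ≤ quadForm A ξ)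
    (hsymm : ∀ i j, A i j = A j i) (hp : 1 < p) (hp' : p < ⊤) {h : 𝓢(Eucl N, ℂ)}
    (hu : IsClassicalSolution p (constOp A) h u) {t : ℝ} (ht : 0 ≤ t) : u t = heat A t h := by
  rcases ht.eq_or_lt with rfl | ht
  · rw [hu.initial, heat_zero hA]
  have hc : Continuous (u t) := (hu.contDiff t ht).continuous
  refine (hc.ae_eq_iff_eq volume (heat A t h).continuous).1 ?_
  refine ae_eq_of_integral_contDiff_smul_eq hc.locallyIntegrable
    (heat A t h).continuous.locallyIntegrable fun g hg hgc => ?_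
  have hg' : ContDiff ℝ ∞ fun x => (g x : ℂ) := Complex.ofRealCLM.contDiff.comp hg
  have hgc' : HasCompactSupport fun x => (g x : ℂ) := hgc.comp_left (g := Complex.ofReal) rfl
  have e1 := hu.integral_mul hA hsymm hp ht (hgc'.toSchwartzMap hg')
  -- The duality identity applies to the explicit solution as well. Both solutions thus have the
  -- same pairing with every test function, and continuity in `x` upgrades this to pointwise
  -- equality.
  have e2 := (isClassicalSolution_heat hA hp.le hp' h).integral_mul hA hsymm hp ht
    (hgc'.toSchwartzMap hg')
  rw [← e2] at e1
  simpa [mul_comm] using e1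

/-- On Schwartz functions `e^{tL}`, for `L` with constant coefficients, is a Fourier multiplier. -/
theorem expL_constOp (hA : ∀ ξ, 0 ≤ quadForm A ξ) (hsymm : ∀ i j, A i j = A j i) (hp : 1 < p)
    (hp' : p < ⊤) (h : 𝓢(Eucl N, ℂ)) {t : ℝ} (ht : 0 ≤ t) :
    expL p (constOp A) t h = heat A t h := by
  have hex : ∃ u, IsClassicalSolution p (constOp A) h u :=
    ⟨_, isClassicalSolution_heat hA hp.le hp' h⟩
  rw [expL, dif_pos hex]
  exact hex.choose_spec.eq_heat hA hsymm hp hp' ht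

theorem taylorCoeff_zero (L : SecondOrderOp N) (w : Eucl N) :
    L.taylorCoeff w 0 = constOp fun i j => L.a i j w := by
  simp [SecondOrderOp.taylorCoeff, constOp, SecondOrderOp.dilate]

end Uniqueness

/-! ### Operators with rapidly decaying kernels. -/

section Kernel

open SchwartzMap

variable {N : ℕ} {P : Type*}

/-- The decay weight for kernels `G (σ, w, a, v)`. -/
def kerDecay (q : P × Eucl N × Eucl N × Eucl N) : ℝ := 1 + ‖q.2.2.2‖

theorem one_le_kerDecay (q : P × Eucl N × Eucl N × Eucl N) : 1 ≤ kerDecay q :=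
  one_le_one_add_norm _

variable [NormedAddCommGroup P]

/-- The growth weight for kernels `G (σ, w, a, v)`. -/
def kerGrowth (q : P × Eucl N × Eucl N × Eucl N) : ℝ := 1 + ‖q.1‖ + ‖q.2.2.1‖

theorem one_le_kerGrowth (q : P × Eucl N × Eucl N × Eucl N) : 1 ≤ kerGrowth q := by
  have := norm_nonneg q.1
  have := norm_nonneg q.2.2.1
  unfold kerGrowth
  linarith

variable [NormedSpace ℝ P]

/-- Kernels with rapid decay in the last variable and moderate growth in the parameters. -/
def IsRapidKernel (G : P × Eucl N × Eucl N × Eucl N → ℂ) : Prop :=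
  UnifRapid kerGrowth kerDecay (fun _ : Unit => G)

/-- Families of operators on Schwartz space with a kernel `G (σ, w, x - w, x - y)`. -/
def HasRapidKernel (T : P → Eucl N → 𝓢(Eucl N, ℂ) → 𝓢(Eucl N, ℂ)) : Prop :=
  ∃ G : P × Eucl N × Eucl N × Eucl N → ℂ, IsRapidKernel G ∧
    ∀ σ w f x, T σ w f x = ∫ y, G (σ, w, x - w, x - y) * f y

theorem UnifTemperate.exists_norm_bound {ι Q F : Type*} [NormedAddCommGroup Q] [NormedSpace ℝ Q]
    [NormedAddCommGroup F] [NormedSpace ℝ F] {ρ : Q → ℝ} {f : ι → Q → F} (hf : UnifTemperate ρ f)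
    (hρ : ∀ q, 1 ≤ ρ q) : ∃ (k : ℕ) (C : ℝ), 0 ≤ C ∧ ∀ i q, ‖f i q‖ ≤ C * ρ q ^ k := by
  obtain ⟨k, C, hC, h⟩ := hf.exists_bound hρ 0
  exact ⟨k, C, hC, fun i q => by simpa using h 0 le_rfl i q⟩

theorem IsRapidKernel.integrable {G : P × Eucl N × Eucl N × Eucl N → ℂ} (hG : IsRapidKernel G)
    (σ : P) (w x : Eucl N) (f : 𝓢(Eucl N, ℂ)) :
    Integrable fun y => G (σ, w, x - w, x - y) * f y := by
  obtain ⟨k, C, -, h⟩ := UnifTemperate.exists_norm_bound hG.unifTemperate one_le_kerGrowth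
  have hc : Continuous G := (hG.1 ()).continuous
  refine f.integrable.bdd_mul (c := C * (1 + ‖σ‖ + ‖x - w‖) ^ k)
    (Continuous.aestronglyMeasurable (by fun_prop)) (.of_forall fun y => h () (σ, w, x - w, x - y))

theorem HasRapidKernel.add {T T' : P → Eucl N → 𝓢(Eucl N, ℂ) → 𝓢(Eucl N, ℂ)}
    (hT : HasRapidKernel T) (hT' : HasRapidKernel T') :
    HasRapidKernel fun σ w f => T σ w f + T' σ w f := by
  obtain ⟨G, hG, h⟩ := hT
  obtain ⟨G', hG', h'⟩ := hT'
  refine ⟨fun q => G q + G' q, UnifRapid.add hG hG' one_le_kerGrowth one_le_kerDecay,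
    fun σ w f x => ?_⟩
  rw [add_apply, h, h', ← integral_add (hG.integrable σ w x f) (hG'.integrable σ w x f)]
  simp only [add_mul]

theorem hasRapidKernel_zero :
    HasRapidKernel fun (_ : P) (_ : Eucl N) (_ : 𝓢(Eucl N, ℂ)) => (0 : 𝓢(Eucl N, ℂ)) := by
  refine ⟨0, ⟨fun _ => contDiff_zero_fun, fun n => ⟨0, fun m => ⟨0, fun _ q => ?_⟩⟩⟩, by simp⟩
  have : (fun _ => 0 : P × Eucl N × Eucl N × Eucl N → ℂ) = 0 := rfl
  simp [← this]

theorem HasRapidKernel.sum {J : Type*} (s : Finset J)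
    {T : J → P → Eucl N → 𝓢(Eucl N, ℂ) → 𝓢(Eucl N, ℂ)} (hT : ∀ j ∈ s, HasRapidKernel (T j)) :
    HasRapidKernel fun σ w f => ∑ j ∈ s, T j σ w f := by
  classical
  induction s using Finset.induction_on with
  | empty => simpa using hasRapidKernel_zero
  | insert a s ha ih =>
    simp only [Finset.sum_insert ha]
    exact (hT a (Finset.mem_insert_self a s)).add
      (ih fun j hj => hT j (Finset.mem_insert_of_mem hj))

theorem HasRapidKernel.mul {T T' : P → Eucl N → 𝓢(Eucl N, ℂ) → 𝓢(Eucl N, ℂ)}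
    (hT : HasRapidKernel T) {c : P → Eucl N → Eucl N → ℂ}
    (hc : UnifTemperate (kerGrowth (P := P) (N := N)) (fun (_ : Unit) q => c q.1 q.2.1 q.2.2.1))
    (h : ∀ σ w f x, T' σ w f x = c σ w (x - w) * T σ w f x) : HasRapidKernel T' := by
  obtain ⟨G, hG, hT⟩ := hT
  refine ⟨fun q => c q.1 q.2.1 q.2.2.1 * G q, UnifRapid.bilinear (ContinuousLinearMap.mul ℝ ℂ)
    (hc.mono one_le_kerGrowth ⟨1, 1, fun q => ?_⟩) hG one_le_kerGrowth one_le_kerDecay,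
    fun σ w f x => ?_⟩
  · rw [one_mul, pow_one]
    exact le_mul_of_one_le_right (zero_le_one.trans (one_le_kerGrowth q)) (one_le_kerDecay q)
  · rw [h, hT, ← integral_const_mul]
    simp only [mul_assoc]

theorem HasRapidKernel.dCLM {T : P → Eucl N → 𝓢(Eucl N, ℂ) → 𝓢(Eucl N, ℂ)}
    (hT : HasRapidKernel T) (i : Fin N) : HasRapidKernel fun σ w f => dCLM i (T σ w f) := by
  obtain ⟨G, hG, hT⟩ := hT
  let e : Eucl N := EuclideanSpace.single i 1
  -- The point `x` occurs in both arguments `x - w` and `x - y`, so the kernel is differentiated in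
  -- the direction `(0, 0, e, e)`.
  have hG' : IsRapidKernel (fun q => fderiv ℝ G q (0, 0, e, e)) :=
    UnifRapid.fderiv_apply hG one_le_kerDecay _
  refine ⟨_, hG', fun σ w f x => ?_⟩
  obtain ⟨k, C, hC, hb⟩ := UnifTemperate.exists_norm_bound hG'.unifTemperate one_le_kerGrowth
  have hc : Continuous G := (hG.1 ()).continuous
  have hc' : Continuous (fun q => fderiv ℝ G q (0, 0, e, e)) := (hG'.1 ()).continuous
  have he : ‖e‖ = 1 := by simp [e]
  let F : ℝ → Eucl N → ℂ := fun s y => G (σ, w, x + s • e - w, x + s • e - y) * f y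
  let F' : ℝ → Eucl N → ℂ := fun s y =>
    fderiv ℝ G (σ, w, x + s • e - w, x + s • e - y) (0, 0, e, e) * f y
  have hF : ∀ s, Integrable (F s) := fun s => hG.integrable σ w _ f
  have hF' : ∀ s, Integrable (F' s) := fun s => hG'.integrable σ w _ f
  have hbound : ∀ y, ∀ s ∈ Metric.ball (0 : ℝ) 1,
      ‖F' s y‖ ≤ C * (1 + ‖σ‖ + (‖x - w‖ + 1)) ^ k * ‖f y‖ := fun y s hs => by
    rw [norm_mul]
    refine mul_le_mul_of_nonneg_right ((hb () _).trans ?_) (norm_nonneg _)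
    have h3 : ‖x + s • e - w‖ ≤ ‖x - w‖ + 1 := by
      have h4 : x + s • e - w = (x - w) + s • e := by abel
      rw [h4]
      refine (norm_add_le _ _).trans ?_
      rw [norm_smul, he, mul_one]
      have : ‖s‖ < 1 := by simpa using hs
      linarith
    have : kerGrowth (σ, w, x + s • e - w, x + s • e - y) ≤ 1 + ‖σ‖ + (‖x - w‖ + 1) := by
      unfold kerGrowth
      simp only
      linarith
    have := one_le_kerGrowth (σ, w, x + s • e - w, x + s • e - y)
    gcongr
  have hdiff : ∀ y, ∀ s ∈ Metric.ball (0 : ℝ) 1, HasDerivAt (F · y) (F' s y) s := fun y s _ => by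
    have h2 : HasDerivAt (fun s : ℝ => x + s • e) e s := by
      simpa using ((hasDerivAt_id s).smul_const e).const_add x
    have h3 : HasDerivAt (fun s : ℝ => (σ, w, x + s • e - w, x + s • e - y)) (0, 0, e, e) s :=
      (hasDerivAt_const s σ).prodMk ((hasDerivAt_const s w).prodMk
        ((h2.sub_const w).prodMk (h2.sub_const y)))
    have h4 : HasFDerivAt G _ (σ, w, x + s • e - w, x + s • e - y) :=
      ((hG.1 ()).differentiable (by simp) _).hasFDerivAt
    exact (h4.comp_hasDerivAt s h3).mul_const (f y)
  have h1 : HasDerivAt (fun s => ∫ y, F s y) (∫ y, F' 0 y) 0 :=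
    (hasDerivAt_integral_of_dominated_loc_of_deriv_le
      (Metric.ball_mem_nhds 0 one_pos) (.of_forall fun s => (hF s).1) (hF 0) (hF' 0).1
      (.of_forall hbound) (f.integrable.norm.const_mul _) (.of_forall hdiff)).2
  have h2 : HasDerivAt (fun s : ℝ => T σ w f (x + s • e)) (fderiv ℝ (T σ w f) x e) 0 :=
    ((T σ w f).differentiableAt (x := x)).hasFDerivAt.hasLineDerivAt e
  have h3 : (fun s : ℝ => T σ w f (x + s • e)) = fun s => ∫ y, F s y :=
    funext fun s => hT σ w f _
  rw [h3] at h2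
  have := h2.unique h1
  rw [coe_dCLM, partialD, this]
  simp [F']

end Kernel

/-! ### Commuting the Taylor coefficients with the heat semigroup. -/

section Transport

open SchwartzMap

variable {N : ℕ}

theorem IsCbInfty.const_mul {g : Eucl N → ℝ} (hg : IsCbInfty g) (r : ℝ) :
    IsCbInfty fun x => r * g x := by
  refine ⟨contDiff_const.mul hg.1, fun m => ?_⟩
  obtain ⟨C, hC⟩ := hg.2 m
  refine ⟨|r| * C, fun x => ?_⟩
  have e : (fun x => r * g x) = r • g := rfl
  rw [e, iteratedFDeriv_const_smul_apply ((hg.1.of_le (by exact_mod_cast le_top)).contDiffAt),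
    norm_smul, Real.norm_eq_abs]
  exact mul_le_mul_of_nonneg_left (hC x) (abs_nonneg r)

theorem IsCbInfty.unifTemperate {g : Eucl N → ℝ} (hg : IsCbInfty g) :
    UnifTemperate (fun _ : Eucl N => 1) (fun _ : Unit => g) :=
  ⟨fun _ => hg.1, fun n => ⟨0, (hg.2 n).imp fun C h _ x => by simpa using h x⟩⟩

theorem IsCbInfty.partialD {g : Eucl N → ℝ} (hg : IsCbInfty g) (i : Fin N) :
    IsCbInfty (partialD i g) := by
  have h := hg.unifTemperate.fderiv.clm_comp
    (ContinuousLinearMap.apply ℝ ℝ (EuclideanSpace.single i (1 : ℝ) : Eucl N))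
  refine ⟨h.1 (), fun m => ?_⟩
  obtain ⟨k, C, h⟩ := h.2 m
  simp only [one_pow, mul_one] at h
  exact ⟨C, fun x => h () x⟩

/-- A smooth family of uniformly elliptic symmetric matrices, bounded with all derivatives. -/
structure IsEllipticFamily (A : Eucl N → Fin N → Fin N → ℝ) (γ : ℝ) : Prop where
  smooth : ∀ i j, IsCbInfty fun w => A w i j
  symm : ∀ w i j, A w i j = A w j i
  elliptic : ∀ w ξ, γ * ‖ξ‖ ^ 2 ≤ quadForm (A w) ξ

theorem IsEllipticFamily.nonneg {A : Eucl N → Fin N → Fin N → ℝ} {γ : ℝ}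
    (hA : IsEllipticFamily A γ) (hγ : 0 < γ) (w ξ : Eucl N) : 0 ≤ quadForm (A w) ξ :=
  (mul_nonneg hγ.le (sq_nonneg _)).trans (hA.elliptic w ξ)

variable {P : Type*} [NormedAddCommGroup P] [NormedSpace ℝ P]

theorem IsCbInfty.unifTemperate_kernel {g : Eucl N → ℝ} (hg : IsCbInfty g) :
    UnifTemperate (kerGrowth (P := P) (N := N)) (fun (_ : Unit) q => g q.2.1) :=
  hg.unifTemperate.comp_clm one_le_kerGrowth (fun _ => le_rfl)
    ((ContinuousLinearMap.fst ℝ (Eucl N) (Eucl N × Eucl N)).comp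
      (ContinuousLinearMap.snd ℝ P (Eucl N × Eucl N × Eucl N)))
    ⟨0, 1, fun q => by simp⟩

theorem unifTemperate_kernel_coord (i : Fin N) :
    UnifTemperate (kerGrowth (P := P) (N := N)) (fun (_ : Unit) q => q.2.2.1 i) := by
  refine (unifTemperate_coord (ι := Unit) i).comp_clm one_le_kerGrowth one_le_one_add_norm
    ((ContinuousLinearMap.fst ℝ (Eucl N) (Eucl N)).comp
      ((ContinuousLinearMap.snd ℝ (Eucl N) (Eucl N × Eucl N)).comp
      (ContinuousLinearMap.snd ℝ P (Eucl N × Eucl N × Eucl N)))) ⟨1, 1, fun q => ?_⟩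
  have := norm_nonneg q.1
  simp only [kerGrowth, ContinuousLinearMap.comp_apply, ContinuousLinearMap.coe_fst',
    ContinuousLinearMap.coe_snd', pow_one, one_mul]
  linarith

theorem HasRapidKernel.mul_real {T T' : P → Eucl N → 𝓢(Eucl N, ℂ) → 𝓢(Eucl N, ℂ)}
    (hT : HasRapidKernel T) {c : P → Eucl N → Eucl N → ℝ}
    (hc : UnifTemperate (kerGrowth (P := P) (N := N)) (fun (_ : Unit) q => c q.1 q.2.1 q.2.2.1))
    (h : ∀ σ w f x, T' σ w f x = (c σ w (x - w) : ℝ) * T σ w f x) : HasRapidKernel T' :=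
  hT.mul (c := fun σ w a => (c σ w a : ℂ)) (hc.clm_comp Complex.ofRealCLM) h

theorem HasRapidKernel.xCLM {T : P → Eucl N → 𝓢(Eucl N, ℂ) → 𝓢(Eucl N, ℂ)}
    (hT : HasRapidKernel T) (i : Fin N) : HasRapidKernel fun σ w f => xCLM w i (T σ w f) :=
  hT.mul_real (c := fun _ _ a => a i) (unifTemperate_kernel_coord i) fun σ w f x => by
    simp [xCLM_apply]

/-- The operators `V w` that can be moved across the heat semigroups `heat (A w) t` at the cost of
a dependence on `t` that preserves rapidly decaying kernels. -/
def Transportable (P : Type*) [NormedAddCommGroup P] [NormedSpace ℝ P]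
    (A : Eucl N → Fin N → Fin N → ℝ) (V : Eucl N → 𝓢(Eucl N, ℂ) → 𝓢(Eucl N, ℂ)) : Prop :=
  ∃ V' : ℝ → Eucl N → 𝓢(Eucl N, ℂ) → 𝓢(Eucl N, ℂ),
    (∀ t w h, 0 ≤ t → heat (A w) t (V w h) = V' t w (heat (A w) t h)) ∧
    ∀ (T : P → Eucl N → 𝓢(Eucl N, ℂ) → 𝓢(Eucl N, ℂ)) (τ : P → ℝ),
      UnifTemperate (kerGrowth (P := P) (N := N)) (fun (_ : Unit) q => τ q.1) →
      HasRapidKernel T → HasRapidKernel fun σ w f => V' (τ σ) w (T σ w f)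

variable {A : Eucl N → Fin N → Fin N → ℝ} {γ : ℝ}
  {V V' : Eucl N → 𝓢(Eucl N, ℂ) → 𝓢(Eucl N, ℂ)}

theorem transportable_id : Transportable P A fun _ h => h :=
  ⟨fun _ _ h => h, fun _ _ _ _ => rfl, fun _ _ _ hT => hT⟩

theorem transportable_zero : Transportable P A fun _ _ => 0 :=
  ⟨fun _ _ _ => 0, fun _ _ _ _ => map_zero _, fun _ _ _ _ => hasRapidKernel_zero⟩

theorem Transportable.add (hV : Transportable P A V) (hV' : Transportable P A V') :
    Transportable P A fun w h => V w h + V' w h := by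
  obtain ⟨W, h1, h2⟩ := hV
  obtain ⟨W', h1', h2'⟩ := hV'
  exact ⟨fun t w h => W t w h + W' t w h, fun t w h ht => by rw [map_add, h1 t w h ht, h1' t w h ht],
    fun T τ hτ hT => (h2 T τ hτ hT).add (h2' T τ hτ hT)⟩

theorem Transportable.sum {J : Type*} (s : Finset J)
    {V : J → Eucl N → 𝓢(Eucl N, ℂ) → 𝓢(Eucl N, ℂ)} (hV : ∀ j ∈ s, Transportable P A (V j)) :
    Transportable P A fun w h => ∑ j ∈ s, V j w h := by
  classical
  induction s using Finset.induction_on with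
  | empty => simpa using transportable_zero
  | insert a s ha ih =>
    simp only [Finset.sum_insert ha]
    exact (hV a (Finset.mem_insert_self a s)).add
      (ih fun j hj => hV j (Finset.mem_insert_of_mem hj))

theorem Transportable.smul (hV : Transportable P A V) {c : Eucl N → ℝ} (hc : IsCbInfty c) :
    Transportable P A fun w h => (c w : ℂ) • V w h := by
  obtain ⟨W, h1, h2⟩ := hV
  exact ⟨fun t w h => (c w : ℂ) • W t w h, fun t w h ht => by rw [map_smul, h1 t w h ht],
    fun T τ hτ hT => (h2 T τ hτ hT).mul_real (c := fun _ w _ => c w) hc.unifTemperate_kernel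
      fun σ w f x => by simp⟩

theorem Transportable.dCLM (hA : IsEllipticFamily A γ) (hγ : 0 < γ) (hV : Transportable P A V)
    (i : Fin N) : Transportable P A fun w h => dCLM i (V w h) := by
  obtain ⟨W, h1, h2⟩ := hV
  exact ⟨fun t w h => DysonTaylor.dCLM i (W t w h),
    fun t w h ht => by rw [heat_dCLM (hA.nonneg hγ w) ht, h1 t w h ht],
    fun T τ hτ hT => (h2 T τ hτ hT).dCLM i⟩

/-- By `heat_xCLM` the price is the sum `2 t ∑_j A_ij ∂_j`. Its coefficients are linear in the time
and in `C_b^∞` in `w`, so rapid kernels remain rapid. -/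
theorem Transportable.xCLM (hA : IsEllipticFamily A γ) (hγ : 0 < γ) (hV : Transportable P A V)
    (i : Fin N) : Transportable P A fun w h => xCLM w i (V w h) := by
  obtain ⟨W, h1, h2⟩ := hV
  refine ⟨fun t w h => DysonTaylor.xCLM w i (W t w h) +
      ∑ j, (2 * t * A w i j : ℂ) • DysonTaylor.dCLM j (W t w h),
    fun t w h ht => by rw [heat_xCLM (hA.nonneg hγ w) (hA.symm w) ht, h1 t w h ht],
    fun T τ hτ hT => ((h2 T τ hτ hT).xCLM i).add (HasRapidKernel.sum _ fun j _ => ?_)⟩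
  refine ((h2 T τ hτ hT).dCLM j).mul_real (c := fun σ w _ => 2 * (τ σ * A w i j)) ?_
    fun σ w f x => ?_
  · exact (unifTemperate_const (fun _ => (2 : ℝ)) ⟨_, fun _ => le_rfl⟩).bilinear
      (ContinuousLinearMap.mul ℝ ℝ) (hτ.bilinear (ContinuousLinearMap.mul ℝ ℝ)
        (hA.smooth i j).unifTemperate_kernel one_le_kerGrowth) one_le_kerGrowth
  · simp [mul_assoc]

theorem contDiff_taylor {g : Eucl N → ℝ} (hg : IsCbInfty g) (r : ℕ) (w y : Eucl N) :
    ContDiff ℝ ∞ fun s : ℝ => s ^ r * g (w + s • y) :=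
  (contDiff_id.pow r).mul (hg.1.comp (by fun_prop))

/-- One derivative of `s ^ r * g (w + s • y)` is a combination of functions of the same shape, with
coefficients `r` and `y i`. For `r = 0` the truncated exponent `r - 1` is harmless because of the
factor `r`. -/
theorem iteratedDeriv_succ_taylor {g : Eucl N → ℝ} (hg : IsCbInfty g) (m r : ℕ) (w y : Eucl N) :
    iteratedDeriv (m + 1) (fun s : ℝ => s ^ r * g (w + s • y)) 0 =
      r * iteratedDeriv m (fun s : ℝ => s ^ (r - 1) * g (w + s • y)) 0 +
      ∑ i, y i * iteratedDeriv m (fun s : ℝ => s ^ r * partialD i g (w + s • y)) 0 := by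
  have hd : deriv (fun s : ℝ => s ^ r * g (w + s • y)) = fun s =>
      r * (s ^ (r - 1) * g (w + s • y)) + ∑ i, y i * (s ^ r * partialD i g (w + s • y)) := by
    funext s
    have h1 : HasDerivAt (fun s : ℝ => w + s • y) y s := by
      simpa using ((hasDerivAt_id s).smul_const y).const_add w
    have h2 := ((hg.1.differentiable (by simp) (w + s • y)).hasFDerivAt).comp_hasDerivAt s h1
    have h3 : fderiv ℝ g (w + s • y) y = ∑ i, y i * partialD i g (w + s • y) := by
      have h4 : y = ∑ i, y i • EuclideanSpace.single i (1 : ℝ) := by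
        simpa using ((EuclideanSpace.basisFun (Fin N) ℝ).sum_repr y).symm
      conv_lhs => rw [congrArg (fderiv ℝ g (w + s • y)) h4]
      simp [partialD]
    rw [show deriv (fun s : ℝ => s ^ r * g (w + s • y)) s = _ from
      ((hasDerivAt_pow r s).mul h2).deriv, h3, Finset.mul_sum, mul_assoc]
    congr 1
    exact Finset.sum_congr rfl fun i _ => by ring
  have hc : ∀ {f : ℝ → ℝ}, ContDiff ℝ ∞ f → ContDiffAt ℝ m f 0 := fun h =>
    (h.of_le (by exact_mod_cast le_top)).contDiffAt
  rw [iteratedDeriv_succ', hd, iteratedDeriv_fun_add (hc (contDiff_const.mul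
    (contDiff_taylor hg (r - 1) w y))) (hc (ContDiff.sum fun i _ => contDiff_const.mul
      (contDiff_taylor (hg.partialD i) r w y))), iteratedDeriv_fun_sum fun i _ =>
      hc (contDiff_const.mul (contDiff_taylor (hg.partialD i) r w y))]
  simp only [iteratedDeriv_const_mul_field]

/-- Shows by induction that Taylor coefficients in `s` are polynomials in `x - w` with `C_b^∞`
coefficients, in the form needed for transport. The operator `V` must vary in the induction, since
each step composes it with multiplication by some `x_i - w_i`. -/
theorem Transportable.taylor (hA : IsEllipticFamily A γ) (hγ : 0 < γ) (m : ℕ) :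
    ∀ {g : Eucl N → ℝ} (_ : IsCbInfty g) (r : ℕ) {V : Eucl N → 𝓢(Eucl N, ℂ) → 𝓢(Eucl N, ℂ)},
      Transportable P A V → ∃ V', Transportable P A V' ∧ ∀ w h x, V' w h x =
        (iteratedDeriv m (fun s : ℝ => s ^ r * g (w + s • (x - w))) 0 : ℝ) * V w h x := by
  induction m with
  | zero =>
    intro g hg r V hV
    -- The value at `s = 0` is `0 ^ r * g w`, with `0 ^ 0 = 1` covering the second order
    -- coefficients.
    exact ⟨_, hV.smul (hg.const_mul (0 ^ r)), fun w h x => by simp⟩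
  | succ m ih =>
    intro g hg r V hV
    obtain ⟨V₀, h0, e0⟩ := ih hg (r - 1) hV
    choose V₁ h1 e1 using fun i => ih (hg.partialD i) r (hV.xCLM hA hγ i)
    have hc : IsCbInfty fun _ : Eucl N => (r : ℝ) := by
      refine ⟨contDiff_const, fun m => ⟨|(r : ℝ)|, fun x => ?_⟩⟩
      rcases m with _ | m
      · simp
      · simp [iteratedFDeriv_const_of_ne (𝕜 := ℝ) (Nat.succ_ne_zero m)]
    refine ⟨_, (h0.smul hc).add (Transportable.sum Finset.univ fun i _ => h1 i),
      fun w h x => ?_⟩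
    rw [iteratedDeriv_succ_taylor hg, add_apply, smul_apply, e0]
    simp only [sum_apply, e1, xCLM_apply]
    push_cast
    rw [add_mul, Finset.sum_mul]
    simp only [smul_eq_mul, PiLp.sub_apply]
    push_cast
    congr 1
    · ring
    · exact Finset.sum_congr rfl fun i _ => by ring

/-- The Taylor coefficients of an elliptic operator can be moved across the heat semigroups. -/
theorem exists_transportable_taylorCoeff {L : SecondOrderOp N} (hL : L.IsElliptic γ)
    (hA : IsEllipticFamily A γ) (hγ : 0 < γ) (m : ℕ) :
    ∃ V, Transportable P A V ∧ ∀ w (h : 𝓢(Eucl N, ℂ)), (L.taylorCoeff w m).act h = V w h := by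
  have hid : Transportable P A fun _ h => h := transportable_id
  -- The exponents 0, 1, 2 in this and the next lines are the powers of `s` in front of `a`, `b`,
  -- `c` in the dilated operator.
  choose Va ha ea using fun i j => Transportable.taylor hA hγ m (hL.smooth_a i j) 0
    ((hid.dCLM hA hγ j).dCLM hA hγ i)
  choose Vb hb eb using fun i => Transportable.taylor hA hγ m (hL.smooth_b i) 1 (hid.dCLM hA hγ i)
  obtain ⟨Vc, hc, ec⟩ := Transportable.taylor hA hγ m hL.smooth_c 2 hid
  have hm : IsCbInfty fun _ : Eucl N => (m.factorial : ℝ)⁻¹ := by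
    refine ⟨contDiff_const, fun n => ⟨|(m.factorial : ℝ)⁻¹|, fun x => ?_⟩⟩
    rcases n with _ | n
    · simp
    · simp [iteratedFDeriv_const_of_ne (𝕜 := ℝ) (Nat.succ_ne_zero n)]
  refine ⟨_, (((Transportable.sum Finset.univ fun i _ => Transportable.sum Finset.univ fun j _ =>
    ha i j).add (Transportable.sum Finset.univ fun i _ => hb i)).add hc).smul hm, fun w h => ?_⟩
  ext x
  simp only [SecondOrderOp.act, SecondOrderOp.taylorCoeff, SecondOrderOp.dilate, smul_apply,
    add_apply, sum_apply, ea, eb, ec, coe_dCLM, smul_eq_mul, pow_zero, pow_one, one_mul]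
  push_cast
  simp only [div_eq_mul_inv, mul_add, Finset.mul_sum]
  congr 1
  · congr 1
    · exact Finset.sum_congr rfl fun i _ => Finset.sum_congr rfl fun j _ => by ring
    · exact Finset.sum_congr rfl fun i _ => by ring
  · ring

end Transport

/-! ### Normal form and kernel of the Dyson product. -/

section Dyson

open SchwartzMap FourierTransform

variable {N : ℕ}

/-- Uses `1 + r ≤ 2 (1 + r²)` and the exponential series bound `y ^ K / K! ≤ exp y` at `y = c (1 +
r²)`. -/
theorem exists_bound_pow_mul_exp {c : ℝ} (hc : 0 < c) (K : ℕ) :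
    ∃ D, ∀ r : ℝ, 0 ≤ r → (1 + r) ^ K * Real.exp (-(c * r ^ 2)) ≤ D := by
  refine ⟨2 ^ K * (K.factorial * (c ^ K)⁻¹ * Real.exp c), fun r hr => ?_⟩
  have h1 : (1 + r) ^ K ≤ 2 ^ K * (1 + r ^ 2) ^ K := by
    rw [← mul_pow]
    gcongr
    nlinarith [sq_nonneg (r - 1)]
  have h2 := Real.pow_div_factorial_le_exp (c * (1 + r ^ 2)) (by positivity) K
  have h3 : (1 + r ^ 2) ^ K ≤ K.factorial * (c ^ K)⁻¹ * Real.exp c * Real.exp (c * r ^ 2) := by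
    rw [mul_pow, div_le_iff₀ (by positivity), mul_add, mul_one, Real.exp_add] at h2
    have : 0 < c ^ K := by positivity
    rw [← mul_le_mul_iff_right₀ this]
    refine h2.trans_eq ?_
    field_simp
  calc _ ≤ 2 ^ K * (K.factorial * (c ^ K)⁻¹ * Real.exp c * Real.exp (c * r ^ 2)) *
        Real.exp (-(c * r ^ 2)) := by
        gcongr
        exact h1.trans (by gcongr)
    _ = _ := by
      rw [Real.exp_neg]
      have := Real.exp_pos (c * r ^ 2)
      field_simp

theorem integral_fourier_mul {φ : Eucl N → ℂ} (hφ : Integrable φ) (f : 𝓢(Eucl N, ℂ)) :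
    ∫ y, 𝓕 φ y * f y = ∫ ξ, φ ξ * 𝓕 f ξ := by
  simpa using! VectorFourier.integral_fourierIntegral_smul_eq_flip (L := innerₗ (Eucl N))
    Real.continuous_fourierChar continuous_inner hφ f.integrable

variable {A : Eucl N → Fin N → Fin N → ℝ} {γ : ℝ}

/-- Derivatives in `(w, ξ)` cost only powers of `1 + ‖ξ‖`, and ellipticity bounds the remaining
exponential by a Gaussian that does not depend on `w`. -/
theorem unifSchwartz_heatSymbol (hA : IsEllipticFamily A γ) (hγ : 0 < γ) :
    UnifSchwartz (fun (_ : Unit) (q : Eucl N × Eucl N) => heatSymbol (A q.1) 1 q.2) := by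
  have hρ : ∀ q : Eucl N × Eucl N, 1 ≤ 1 + ‖q.2‖ := fun q => one_le_one_add_norm q.2
  have hc : ∀ i, UnifTemperate (fun q : Eucl N × Eucl N => 1 + ‖q.2‖) (fun (_ : Unit) q => q.2 i) :=
    fun i => (unifTemperate_coord i).comp_clm hρ one_le_one_add_norm
      (ContinuousLinearMap.snd ℝ (Eucl N) (Eucl N)) ⟨1, 1, fun q => by simp⟩
  have ha : ∀ i j, UnifTemperate (fun q : Eucl N × Eucl N => 1 + ‖q.2‖)
      (fun (_ : Unit) q => A q.1 i j) := fun i j =>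
    (hA.smooth i j).unifTemperate.comp_clm hρ (fun _ => le_rfl)
      (ContinuousLinearMap.fst ℝ (Eucl N) (Eucl N)) ⟨0, 1, fun q => by simp⟩
  have hq : UnifTemperate (fun q : Eucl N × Eucl N => 1 + ‖q.2‖)
      (fun (_ : Unit) q => quadForm (A q.1) q.2) :=
    UnifTemperate.sum hρ fun i _ => UnifTemperate.sum hρ fun j _ =>
      ((ha i j).bilinear (ContinuousLinearMap.mul ℝ ℝ) (hc i) hρ).bilinear
        (ContinuousLinearMap.mul ℝ ℝ) (hc j) hρ
  have hΦ := (unifTemperate_const (fun _ : Unit => -(4 * Real.pi ^ 2)) ⟨_, fun _ => le_rfl⟩).bilinear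
    (ContinuousLinearMap.mul ℝ ℝ) hq hρ
  have he : UnifSchwartz (fun (_ : Unit) (q : Eucl N × Eucl N) =>
      Real.exp (-(4 * Real.pi ^ 2) * quadForm (A q.1) q.2)) := by
    refine unifSchwartz_iff.2 ⟨fun i => Real.contDiff_exp.comp (hΦ.1 i), fun n m => ?_⟩
    obtain ⟨k, C, hC, h⟩ := exists_bound_exp_comp hρ hΦ n
    obtain ⟨D, hD⟩ := exists_bound_pow_mul_exp (c := 4 * Real.pi ^ 2 * γ) (by positivity) (m + k)
    refine ⟨C * D, fun i q => ?_⟩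
    have h1 : Real.exp (-(4 * Real.pi ^ 2) * quadForm (A q.1) q.2) ≤
        Real.exp (-(4 * Real.pi ^ 2 * γ * ‖q.2‖ ^ 2)) := by
      rw [Real.exp_le_exp, neg_mul, neg_le_neg_iff, mul_assoc]
      exact mul_le_mul_of_nonneg_left (hA.elliptic q.1 q.2) (by positivity)
    calc _ ≤ (1 + ‖q.2‖) ^ m * (C * (1 + ‖q.2‖) ^ k *
          Real.exp (-(4 * Real.pi ^ 2 * γ * ‖q.2‖ ^ 2))) := by
          refine mul_le_mul_of_nonneg_left ((h i q).trans ?_) (by positivity)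
          exact mul_le_mul_of_nonneg_left h1 (by positivity)
      _ = C * ((1 + ‖q.2‖) ^ (m + k) * Real.exp (-(4 * Real.pi ^ 2 * γ * ‖q.2‖ ^ 2))) := by ring
      _ ≤ C * D := mul_le_mul_of_nonneg_left (hD _ (norm_nonneg _)) hC
  have := UnifRapid.clm_comp Complex.ofRealCLM he hρ
  refine (congrArg UnifSchwartz ?_).mpr this
  funext _ q
  simp only [heatSymbol, Complex.ofRealCLM_apply]
  congr 2
  ring

variable {P : Type*} [NormedAddCommGroup P] [NormedSpace ℝ P]

theorem hasRapidKernel_heat (hA : IsEllipticFamily A γ) (hγ : 0 < γ) :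
    HasRapidKernel fun (_ : P) w f => heat (A w) 1 f := by
  have hP := unifSchwartz_heatSymbol hA hγ
  set m : Eucl N × Eucl N → ℂ := fun q => heatSymbol (A q.1) 1 q.2
  -- The kernel at `x - y` is an inverse Fourier transform of the multiplier, that is, its Fourier
  -- transform at `-(x - y)`; hence the sign.
  let ℓ : P × Eucl N × Eucl N × Eucl N →L[ℝ] Eucl N × Eucl N :=
    ((ContinuousLinearMap.fst ℝ (Eucl N) (Eucl N × Eucl N)).comp
      (ContinuousLinearMap.snd ℝ P (Eucl N × Eucl N × Eucl N))).prod
    (-((ContinuousLinearMap.snd ℝ (Eucl N) (Eucl N)).comp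
      ((ContinuousLinearMap.snd ℝ (Eucl N) (Eucl N × Eucl N)).comp
      (ContinuousLinearMap.snd ℝ P (Eucl N × Eucl N × Eucl N)))))
  have hℓ : ∀ q, ℓ q = (q.2.1, -q.2.2.2) := fun q => rfl
  refine ⟨fun q => partialFourier m (ℓ q), ?_, fun σ w f x => ?_⟩
  · refine UnifRapid.comp one_le_kerGrowth one_le_kerDecay (fun _ => le_rfl)
      (fun q => one_le_one_add_norm q.2) hP.partialFourier (fun _ => ℓ.contDiff)
      (fun n hn => ⟨0, ‖ℓ‖, fun _ q => ?_⟩) ⟨0, 1, fun _ q => by simp⟩ ⟨1, fun _ q => ?_⟩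
    · simpa using norm_iteratedFDeriv_clm_le ℓ hn q
    · rw [hℓ]
      simp [kerDecay]
  · have hm : Continuous fun ξ => m (w, ξ) := (hP.1 ()).continuous.comp (by fun_prop)
    have hmi : Integrable fun ξ => m (w, ξ) := (hP.slice ((), w)).integrable
    have hφ : Integrable fun ξ =>
        Complex.exp (2 * Real.pi * inner ℝ ξ x * Complex.I) * m (w, ξ) := by
      refine hmi.bdd_mul (c := 1) (Continuous.aestronglyMeasurable (by fun_prop))
        (.of_forall fun ξ => ?_)
      have := Complex.norm_exp_ofReal_mul_I (2 * Real.pi * inner ℝ ξ x)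
      push_cast at this
      exact this.le
    rw [heat_apply (hA.nonneg hγ w) zero_le_one]
    simp only [← mul_assoc]
    rw [← integral_fourier_mul hφ f]
    congr 1
    funext y
    congr 1
    rw [hℓ, partialFourier, Real.fourier_eq', Real.fourier_eq']
    refine integral_congr_ae (.of_forall fun v => ?_)
    simp only [smul_eq_mul]
    rw [← mul_assoc, ← Complex.exp_add]
    congr 2
    simp only [neg_sub, inner_sub_right]
    push_cast
    ring

/-- The normal form of the Dyson product, with all heat semigroups moved to the right. -/
def dysonNormal (A : Eucl N → Fin N → Fin N → ℝ) : (k : ℕ) →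
    (Fin k → ℝ → Eucl N → 𝓢(Eucl N, ℂ) → 𝓢(Eucl N, ℂ)) → (Fin k → ℝ) → Eucl N →
      𝓢(Eucl N, ℂ) → 𝓢(Eucl N, ℂ)
  | 0, _, _, w, f => heat (A w) 1 f
  | k + 1, V, t, w, f => V 0 (t 0) w (dysonNormal A k (Fin.tail V) (Fin.tail t) w f)

theorem hasRapidKernel_dysonNormal (hA : IsEllipticFamily A γ) (hγ : 0 < γ) (k : ℕ) :
    ∀ (V : Fin k → ℝ → Eucl N → 𝓢(Eucl N, ℂ) → 𝓢(Eucl N, ℂ)) (τ : Fin k → P → ℝ),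
    (∀ j (T : P → Eucl N → 𝓢(Eucl N, ℂ) → 𝓢(Eucl N, ℂ)) (τ : P → ℝ),
      UnifTemperate (kerGrowth (P := P) (N := N)) (fun (_ : Unit) q => τ q.1) →
      HasRapidKernel T → HasRapidKernel fun σ w f => V j (τ σ) w (T σ w f)) →
    (∀ j, UnifTemperate (kerGrowth (P := P) (N := N)) (fun (_ : Unit) q => τ j q.1)) →
    HasRapidKernel fun σ w f => dysonNormal A k V (fun j => τ j σ) w f := by
  induction k with
  | zero => exact fun _ _ _ _ => hasRapidKernel_heat hA hγ
  | succ k ih =>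
    intro V τ hV hτ
    exact hV 0 _ (τ 0) (hτ 0) (ih (Fin.tail V) (Fin.tail τ) (fun j => hV j.succ) fun j => hτ j.succ)

/-- The numbers `e j` are the knots of the time interval, with `τ_j = e_j - e_{j+1}`. Dropping the
first factor leaves a product of total time `e 1` instead of 1, so the induction carries the missing
time as a semigroup of time `1 - e 0` on the left. The operator with index `j` is crossed by
semigroups of total time `1 - e (j + 1)`, and all times sum to 1 on the right. -/
theorem dysonProduct_eq (hA : IsEllipticFamily A γ) (hγ : 0 < γ) (w : Eucl N)
    {S : ℝ → (Eucl N → ℂ) → Eucl N → ℂ}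
    (hS : ∀ t, 0 ≤ t → ∀ h : 𝓢(Eucl N, ℂ), S t h = heat (A w) t h) (f : 𝓢(Eucl N, ℂ)) (k : ℕ) :
    ∀ (V₀ : Fin k → (Eucl N → ℂ) → Eucl N → ℂ) (V : Fin k → 𝓢(Eucl N, ℂ) → 𝓢(Eucl N, ℂ))
      (V' : Fin k → ℝ → Eucl N → 𝓢(Eucl N, ℂ) → 𝓢(Eucl N, ℂ)) (e : Fin (k + 2) → ℝ),
      (∀ j (h : 𝓢(Eucl N, ℂ)), V₀ j h = V j h) →
      (∀ j t h, 0 ≤ t → heat (A w) t (V j h) = V' j t w (heat (A w) t h)) →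
      (∀ j : Fin (k + 1), e j.succ ≤ e j.castSucc) → e 0 ≤ 1 → e (Fin.last (k + 1)) = 0 →
      ∃ g : 𝓢(Eucl N, ℂ), dysonProduct S k V₀ (fun j => e j.castSucc - e j.succ) f = g ∧
        heat (A w) (1 - e 0) g = dysonNormal A k V' (fun j => 1 - e j.castSucc.succ) w f := by
  have hn := hA.nonneg hγ w
  induction k with
  | zero =>
    intro V₀ V V' e _ _ he h0 h1
    have h2 : e 1 ≤ e 0 := he 0
    refine ⟨heat (A w) (e 0 - e 1) f, hS _ (sub_nonneg.2 h2) f, ?_⟩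
    rw [heat_heat hn (sub_nonneg.2 h0) (sub_nonneg.2 h2)]
    have : e 1 = 0 := h1
    simp [dysonNormal, this]
  | succ k ih =>
    intro V₀ V V' e hV hV' he h0 h1
    have h2 : e 1 ≤ e 0 := he 0
    obtain ⟨g, hg, hg'⟩ := ih (Fin.tail V₀) (Fin.tail V) (Fin.tail V') (Fin.tail e)
      (fun j => hV j.succ) (fun j => hV' j.succ) (fun j => he j.succ) (h2.trans h0) h1
    refine ⟨heat (A w) (e 0 - e 1) (V 0 g), ?_, ?_⟩
    · have e1 : dysonProduct S (k + 1) V₀ (fun j => e j.castSucc - e j.succ) f =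
          S (e 0 - e 1) (V₀ 0 (dysonProduct S k (Fin.tail V₀)
            (fun j => Fin.tail e j.castSucc - Fin.tail e j.succ) f)) := rfl
      rw [e1, hg, hV, hS _ (sub_nonneg.2 h2)]
    · have e2 : dysonNormal A (k + 1) V' (fun j => 1 - e j.castSucc.succ) w f =
          V' 0 (1 - e 1) w (dysonNormal A k (Fin.tail V')
            (fun j => 1 - Fin.tail e j.castSucc.succ) w f) := rfl
      rw [e2, ← hg', heat_heat hn (sub_nonneg.2 h0) (sub_nonneg.2 h2), sub_add_sub_cancel,
        hV' 0 _ _ (sub_nonneg.2 (h2.trans h0))]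
      rfl

/-- The integrands of `Λ_{α,w}` have rapidly decaying kernels. -/
theorem exists_kernel_dysonIntegrand {p : ℝ≥0∞} (hp : 1 < p) (hp' : p < ⊤) (hγ : 0 < γ)
    {L : SecondOrderOp N} (hL : L.IsElliptic γ) {k : ℕ} (α : Fin k → ℕ) :
    ∃ G : (Fin k → ℝ) × Eucl N × Eucl N × Eucl N → ℂ, IsRapidKernel G ∧
      ∀ σ ∈ simplex k, ∀ w (f : 𝓢(Eucl N, ℂ)) x,
        dysonIntegrand p L α w σ f x = ∫ y, G (σ, w, x - w, x - y) * f y := by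
  have hA : IsEllipticFamily (fun w i j => L.a i j w) γ :=
    ⟨hL.smooth_a, fun w i j => hL.symm i j w, hL.elliptic⟩
  choose V hV hVe using fun j =>
    exists_transportable_taylorCoeff (P := Fin k → ℝ) hL hA hγ (α j)
  choose V' h1 h2 using hV
  have hτ : ∀ j : Fin k, UnifTemperate (kerGrowth (P := Fin k → ℝ) (N := N))
      (fun (_ : Unit) q => 1 - q.1 j) := fun j => by
    have e1 := unifTemperate_clm (ι := Unit) (ρ := kerGrowth (P := Fin k → ℝ) (N := N)) (C := 1)
      (fun _ => -(ContinuousLinearMap.proj (R := ℝ) (φ := fun _ : Fin k => ℝ) j).comp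
        (ContinuousLinearMap.fst ℝ (Fin k → ℝ) (Eucl N × Eucl N × Eucl N)))
      (B := _) (fun _ => le_rfl) fun _ q => by
        have e2 := norm_le_pi_norm q.1 j
        have e3 := norm_nonneg q.2.2.1
        simp only [kerGrowth]
        simp
        simp at e2
        linarith
    refine (congrArg (UnifTemperate _) ?_).mpr ((unifTemperate_const (fun _ : Unit => (1 : ℝ))
      ⟨_, fun _ => le_rfl⟩).add e1 one_le_kerGrowth)
    funext _ q
    simp [sub_eq_add_neg]
  -- The semigroups to the left of the operator paired with `σ j` have total time `1 - σ j`. This is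
  -- affine in `σ`, hence of moderate growth.
  obtain ⟨G, hG, hGe⟩ := hasRapidKernel_dysonNormal hA hγ k V' (fun j σ => 1 - σ j) h2 hτ
  refine ⟨G, hG, fun σ hσ w f x => ?_⟩
  rw [← hGe]
  have hn := hA.nonneg hγ w
  let e : Fin (k + 2) → ℝ := Fin.cons (α := fun _ => ℝ) 1 (Fin.snoc (α := fun _ => ℝ) σ 0)
  have hs : ∀ i : Fin (k + 1), e i.succ ∈ Icc (0 : ℝ) 1 := fun i => by
    simp only [e, Fin.cons_succ]
    rcases Fin.eq_castSucc_or_eq_last i with ⟨i', rfl⟩ | rfl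
    · rw [Fin.snoc_castSucc]
      exact hσ.2 i'
    · simp
  have he : ∀ j : Fin (k + 1), e j.succ ≤ e j.castSucc := fun j => by
    refine Fin.cases ?_ (fun i => ?_) j
    · exact (hs 0).2
    · have e1 : e i.succ.castSucc = σ i := by
        rw [← Fin.succ_castSucc]
        simp [e]
      rw [e1]
      simp only [e, Fin.cons_succ]
      rcases Fin.eq_castSucc_or_eq_last i.succ with ⟨i', h⟩ | h
      · rw [h, Fin.snoc_castSucc]
        refine hσ.1 ?_
        have := congrArg Fin.val h
        simp at this
        exact Fin.le_def.2 (by omega)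
      · rw [h, Fin.snoc_last]
        exact (hσ.2 i).1
  obtain ⟨g, hg, hg'⟩ := dysonProduct_eq hA hγ w (S := expL p (L.taylorCoeff w 0))
    (fun t ht h => by rw [taylorCoeff_zero]; exact expL_constOp hn (hA.symm w) hp hp' h ht) f k
    (fun j => (L.taylorCoeff w (α j)).act) (fun j => V j w) V' e (fun j h => hVe j w h)
    (fun j t h ht => h1 j t w h ht) he le_rfl (by simp [e, ← Fin.succ_last])
  have e2 : dysonIntegrand p L α w σ f = g := hg
  have e3 : e 0 = 1 := rfl
  have e4 : (fun j : Fin k => 1 - e j.castSucc.succ) = fun j => 1 - σ j := by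
    funext j
    simp [e]
  -- The first knot is 1, so no time is missing and the auxiliary semigroup on the left is the
  -- identity.
  rw [e3, sub_self, heat_zero hn, e4] at hg'
  rw [e2, hg']

end Dyson

/-! ### The kernel of the simplex integral. -/

section LamKernel

open SchwartzMap

variable {N : ℕ}

theorem UnifRapid.comp_clm {ι Q Q' F : Type*} [NormedAddCommGroup Q] [NormedSpace ℝ Q]
    [NormedAddCommGroup Q'] [NormedSpace ℝ Q'] [NormedAddCommGroup F] [NormedSpace ℝ F]
    {ρ η : Q → ℝ} {ρ' η' : Q' → ℝ} {g : ι → Q' → F} (hg : UnifRapid ρ' η' g)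
    (hρ : ∀ q, 1 ≤ ρ q) (hη : ∀ q, 1 ≤ η q) (hρ' : ∀ q, 1 ≤ ρ' q) (hη' : ∀ q, 1 ≤ η' q)
    (ℓ : Q →L[ℝ] Q') (h1 : ∃ (k : ℕ) (C : ℝ), ∀ q, ρ' (ℓ q) ≤ C * (ρ q * η q) ^ k)
    (h2 : ∃ C : ℝ, ∀ q, η q ≤ C * η' (ℓ q)) : UnifRapid ρ η (fun i q => g i (ℓ q)) :=
  UnifRapid.comp hρ hη hρ' hη' hg (fun _ => ℓ.contDiff)
    (fun n hn => ⟨0, ‖ℓ‖, fun _ q => by simpa using norm_iteratedFDeriv_clm_le ℓ hn q⟩)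
    (h1.imp fun _ => Exists.imp fun _ h _ => h) (h2.imp fun _ h _ => h)

theorem simplex_subset_Icc (k : ℕ) : simplex k ⊆ Icc 0 1 :=
  fun _ hσ => ⟨fun j => (hσ.2 j).1, fun j => (hσ.2 j).2⟩

theorem isCompact_simplex (k : ℕ) : IsCompact (simplex k) := by
  refine isCompact_Icc.of_isClosed_subset ?_ (simplex_subset_Icc k)
  have : simplex k = {σ | Antitone σ} ∩ Icc 0 1 := by
    ext σ
    exact ⟨fun h => ⟨h.1, simplex_subset_Icc k h⟩, fun h => ⟨h.1, fun j => ⟨h.2.1 j, h.2.2 j⟩⟩⟩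
  rw [this]
  exact isClosed_antitone.inter isClosed_Icc

theorem norm_le_one_of_mem_simplex {k : ℕ} {σ : Fin k → ℝ} (hσ : σ ∈ simplex k) : ‖σ‖ ≤ 1 := by
  refine (pi_norm_le_iff_of_nonneg zero_le_one).2 fun j => ?_
  rw [Real.norm_of_nonneg (hσ.2 j).1]
  exact (hσ.2 j).2

/-- The kernel obtained by integration over the simplex. -/
def simplexKernel {k : ℕ} (G : (Fin k → ℝ) × Eucl N × Eucl N × Eucl N → ℂ)
    (q : Eucl N × Eucl N × Eucl N) : ℂ := ∫ σ in simplex k, G (σ, q)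

theorem unifRapid_simplexKernel {k : ℕ} {G : (Fin k → ℝ) × Eucl N × Eucl N × Eucl N → ℂ}
    (hG : IsRapidKernel G) :
    UnifRapid (fun q : Eucl N × Eucl N × Eucl N => 1 + ‖q.2.1‖) (fun q => 1 + ‖q.2.2‖)
      (fun _ : Unit => simplexKernel G) := by
  let K : (Eucl N × Eucl N × Eucl N) × (Fin k → ℝ) → ℂ := fun p => G (p.2, p.1)
  have hK : UnifRapid (fun p : (Eucl N × Eucl N × Eucl N) × (Fin k → ℝ) =>
      1 + ‖p.2‖ + ‖p.1.2.1‖) (fun p => 1 + ‖p.1.2.2‖) (fun _ : Unit => K) := by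
    let ℓ : (Eucl N × Eucl N × Eucl N) × (Fin k → ℝ) →L[ℝ]
        (Fin k → ℝ) × Eucl N × Eucl N × Eucl N :=
      (ContinuousLinearMap.snd ℝ (Eucl N × Eucl N × Eucl N) (Fin k → ℝ)).prod
        (ContinuousLinearMap.fst ℝ (Eucl N × Eucl N × Eucl N) (Fin k → ℝ))
    have hG' : UnifRapid (kerGrowth (P := Fin k → ℝ) (N := N)) kerDecay (fun _ : Unit => G) := hG
    have h1 : ∀ p : (Eucl N × Eucl N × Eucl N) × (Fin k → ℝ), 1 ≤ 1 + ‖p.2‖ + ‖p.1.2.1‖ :=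
      fun p => one_le_kerGrowth (ℓ p)
    have h2 : ∀ p : (Eucl N × Eucl N × Eucl N) × (Fin k → ℝ), 1 ≤ 1 + ‖p.1.2.2‖ :=
      fun p => one_le_kerDecay (ℓ p)
    refine hG'.comp_clm h1 h2 one_le_kerGrowth one_le_kerDecay ℓ ⟨1, 1, fun p => ?_⟩
      ⟨1, fun p => ?_⟩
    · rw [one_mul, pow_one]
      exact le_mul_of_one_le_right (zero_le_one.trans (h1 p)) (h2 p)
    · rw [one_mul]
      exact le_rfl
  refine ⟨fun _ => contDiff_setIntegral (isCompact_simplex k) (hK.1 ()), fun n => ?_⟩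
  obtain ⟨l, h⟩ := hK.2 n
  refine ⟨l, fun m => ?_⟩
  obtain ⟨C, hC⟩ := h m
  refine ⟨|C| * 2 ^ l * volume.real (simplex k), fun _ q => ?_⟩
  have h0 : 0 < (1 + ‖q.2.2‖) ^ m := by positivity
  -- On the simplex `‖σ‖ ≤ 1`, so the growth weight is at most `2 (1 + ‖q.2.1‖)` and the dependence
  -- on `σ` disappears.
  have hb := (contDiff_setIntegral_nat (μ := volume) (isCompact_simplex k) n ℂ (hK.1 ())).2 q
    (|C| * (2 * (1 + ‖q.2.1‖)) ^ l / (1 + ‖q.2.2‖) ^ m) fun σ hσ => by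
      rw [le_div_iff₀ h0, mul_comm]
      refine (hC () (q, σ)).trans ?_
      have h1 := norm_le_one_of_mem_simplex hσ
      have h2 := norm_nonneg q.2.1
      refine mul_le_mul (le_abs_self C) (pow_le_pow_left₀ (by positivity) ?_ l) (by positivity)
        (abs_nonneg C)
      simp only
      linarith
  calc _ ≤ (1 + ‖q.2.2‖) ^ m * (|C| * (2 * (1 + ‖q.2.1‖)) ^ l / (1 + ‖q.2.2‖) ^ m *
        volume.real (simplex k)) := mul_le_mul_of_nonneg_left hb h0.le
    _ = _ := by
      rw [mul_pow]
      field_simp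

/-- Joint integrability, needed to exchange the integral over the simplex with the action of the
kernel by Fubini's theorem. -/
theorem integrable_simplex_prod {k : ℕ} {G : (Fin k → ℝ) × Eucl N × Eucl N × Eucl N → ℂ}
    (hG : IsRapidKernel G) (w x : Eucl N) (f : 𝓢(Eucl N, ℂ)) :
    Integrable (fun p : (Fin k → ℝ) × Eucl N => G (p.1, w, x - w, x - p.2) * f p.2)
      ((volume.restrict (simplex k)).prod volume) := by
  obtain ⟨l, C, hC, h⟩ := UnifTemperate.exists_norm_bound hG.unifTemperate one_le_kerGrowth
  have hc : Continuous G := (hG.1 ()).continuous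
  have : IsFiniteMeasure ((volume : Measure (Fin k → ℝ)).restrict (simplex k)) :=
    ⟨by simpa using (isCompact_simplex k).measure_lt_top⟩
  refine (f.integrable.comp_snd _).bdd_mul (c := C * (2 + ‖x - w‖) ^ l)
    (Continuous.aestronglyMeasurable (by fun_prop)) ?_
  have hae : ∀ᵐ σ ∂((volume : Measure (Fin k → ℝ)).restrict (simplex k)), σ ∈ simplex k :=
    ae_restrict_mem (isCompact_simplex k).measurableSet
  filter_upwards [Measure.quasiMeasurePreserving_fst.ae hae] with p hp
  refine (h () _).trans ?_
  have h1 := norm_le_one_of_mem_simplex hp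
  refine mul_le_mul_of_nonneg_left (pow_le_pow_left₀
    (zero_le_one.trans (one_le_kerGrowth _)) ?_ l) hC
  simp only [kerGrowth]
  linarith

/-- Kernels are continuous in `y` and compactly supported smooth functions are Schwartz functions,
so testing against these determines the kernel. This makes the choice in `kernelOf` irrelevant. -/
theorem IsSmoothKernel.unique {T : (Eucl N → ℂ) → Eucl N → ℂ} {K K' : Eucl N → Eucl N → ℂ}
    (hK : IsSmoothKernel T K) (hK' : IsSmoothKernel T K') : K = K' := by
  funext x
  have hc : Continuous (K x) := hK.1.continuous.comp (by fun_prop : Continuous fun y => (x, y))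
  have hc' : Continuous (K' x) := hK'.1.continuous.comp (by fun_prop : Continuous fun y => (x, y))
  refine (hc.ae_eq_iff_eq volume hc').1 ?_
  refine ae_eq_of_integral_contDiff_smul_eq hc.locallyIntegrable hc'.locallyIntegrable
    fun g hg hgc => ?_
  have hg' : ContDiff ℝ ∞ fun x => (g x : ℂ) := Complex.ofRealCLM.contDiff.comp hg
  have hgc' : HasCompactSupport fun x => (g x : ℂ) := hgc.comp_left (g := Complex.ofReal) rfl
  have e := (hK.2 (hgc'.toSchwartzMap hg') x).2.symm.trans (hK'.2 (hgc'.toSchwartzMap hg') x).2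
  simpa [mul_comm] using e

theorem IsSmoothKernel.kernelOf_eq {T : (Eucl N → ℂ) → Eucl N → ℂ} {K : Eucl N → Eucl N → ℂ}
    (hK : IsSmoothKernel T K) : kernelOf T = K := by
  have hex : ∃ K, IsSmoothKernel T K := ⟨K, hK⟩
  rw [kernelOf, dif_pos hex]
  exact hex.choose_spec.unique hK

/-- The operators `Λ_{α,w}` are well defined and have rapidly decaying smooth kernels. -/
theorem exists_kernel_Lam {p : ℝ≥0∞} (hp : 1 < p) (hp' : p < ⊤) {γ : ℝ} (hγ : 0 < γ)
    {L : SecondOrderOp N} (hL : L.IsElliptic γ) {k : ℕ} (α : Fin k → ℕ) :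
    ∃ K : Eucl N × Eucl N × Eucl N → ℂ,
      UnifRapid (fun q : Eucl N × Eucl N × Eucl N => 1 + ‖q.2.1‖) (fun q => 1 + ‖q.2.2‖)
        (fun _ : Unit => K) ∧
      ∀ w, (∀ (f : 𝓢(Eucl N, ℂ)) x,
        IntegrableOn (fun σ => dysonIntegrand p L α w σ f x) (simplex k) volume) ∧
        IsSmoothKernel (Lam p L α w) (fun x y => K (w, x - w, x - y)) := by
  obtain ⟨G, hG, h⟩ := exists_kernel_dysonIntegrand hp hp' hγ hL α
  have hS := (isCompact_simplex k).measurableSet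
  have hK := unifRapid_simplexKernel hG
  have hc : ∀ q, IntegrableOn (fun σ => G (σ, q)) (simplex k) volume := fun q =>
    ((hG.1 ()).continuous.comp (by fun_prop : Continuous fun σ => (σ, q))).continuousOn
      |>.integrableOn_compact (isCompact_simplex k)
  refine ⟨simplexKernel G, hK, fun w => ⟨fun f x => ?_, ?_, fun f x => ⟨?_, ?_⟩⟩⟩
  · refine IntegrableOn.congr_fun (integrable_simplex_prod hG w x f).integral_prod_left
      (fun σ hσ => (h σ hσ w f x).symm) hS
  · exact (hK.1 ()).comp (by fun_prop)
  · refine (integrable_simplex_prod hG w x f).integral_prod_right.congr (.of_forall fun y => ?_)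
    simp only [simplexKernel, ← integral_mul_const]
  · have e1 : Lam p L α w f x = ∫ σ in simplex k, ∫ y, G (σ, w, x - w, x - y) * f y :=
      setIntegral_congr_fun hS fun σ hσ => h σ hσ w f x
    rw [e1, integral_integral_swap (integrable_simplex_prod hG w x f)]
    simp only [simplexKernel, ← integral_mul_const]

end LamKernel

/-! ### Uniform estimates for the change of variables `v = (x - y)/s`. -/

section Rescaling

/-- Smooth functions all of whose derivatives of positive order are bounded. -/
def PosBounded {W F : Type} [NormedAddCommGroup W] [NormedSpace ℝ W] [NormedAddCommGroup F]
    [NormedSpace ℝ F] (g : W → F) : Prop :=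
  ContDiff ℝ ∞ g ∧ ∀ m : ℕ, 1 ≤ m → ∃ C : ℝ, ∀ w, ‖iteratedFDeriv ℝ m g w‖ ≤ C

variable {Q W F : Type} [NormedAddCommGroup Q] [NormedSpace ℝ Q] [NormedAddCommGroup W]
  [NormedSpace ℝ W] [NormedAddCommGroup F] [NormedSpace ℝ F]

theorem PosBounded.fderiv {g : W → F} (hg : PosBounded g) : PosBounded (fderiv ℝ g) :=
  ⟨hg.1.fderiv_right (by simp), fun m _ => by
    simpa only [norm_iteratedFDeriv_fderiv] using hg.2 (m + 1) (by omega)⟩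

theorem exists_bound_comp_sub_smul (ℓ κ : Q →L[ℝ] W) {g : W → F} (hg : ContDiff ℝ ∞ g) (n : ℕ)
    (hn : ∃ C : ℝ, ∀ w, ‖iteratedFDeriv ℝ n g w‖ ≤ C) :
    ∃ C : ℝ, ∀ s ∈ Ioc (0 : ℝ) 1, ∀ q,
      ‖iteratedFDeriv ℝ n (fun q => g (ℓ q - s • κ q)) q‖ ≤ C := by
  obtain ⟨C, hC⟩ := hn
  refine ⟨C * (‖ℓ‖ + ‖κ‖) ^ n, fun s hs q => ?_⟩
  have e : (fun q => g (ℓ q - s • κ q)) = g ∘ (ℓ - s • κ) := rfl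
  have hC0 : 0 ≤ C := (norm_nonneg _).trans (hC 0)
  have h1 : ‖ℓ - s • κ‖ ≤ ‖ℓ‖ + ‖κ‖ := by
    refine (norm_sub_le _ _).trans ?_
    rw [norm_smul, Real.norm_of_nonneg hs.1.le]
    have := mul_le_of_le_one_left (norm_nonneg κ) hs.2
    linarith
  rw [e, ContinuousLinearMap.iteratedFDeriv_comp_right _ hg _ (by exact_mod_cast le_top)]
  refine (ContinuousMultilinearMap.norm_compContinuousLinearMap_le _ _).trans ?_
  rw [Finset.prod_const, Finset.card_univ, Fintype.card_fin]
  exact mul_le_mul (hC _) (pow_le_pow_left₀ (norm_nonneg _) h1 n) (by positivity) hC0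

/-- The difference quotients of `g`, as functions of the base point and the direction. -/
def diffQuot (ℓ κ : Q →L[ℝ] W) (g : W → F) (s : ℝ) (q : Q) : F :=
  s⁻¹ • (g (ℓ q) - g (ℓ q - s • κ q))

theorem contDiff_diffQuot (ℓ κ : Q →L[ℝ] W) {g : W → F} (hg : ContDiff ℝ ∞ g) (s : ℝ) :
    ContDiff ℝ ∞ (diffQuot ℓ κ g s) :=
  contDiff_const.smul ((hg.comp ℓ.contDiff).sub (hg.comp (by fun_prop)))

theorem PosBounded.exists_bound_diffQuot_zero (ℓ κ : Q →L[ℝ] W) {g : W → F} (hg : PosBounded g) :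
    ∃ C : ℝ, 0 ≤ C ∧ ∀ s ∈ Ioc (0 : ℝ) 1, ∀ q, ‖diffQuot ℓ κ g s q‖ ≤ C * ‖κ q‖ := by
  obtain ⟨C, hC⟩ := hg.2 1 le_rfl
  refine ⟨C, (norm_nonneg _).trans (hC 0), fun s hs q => ?_⟩
  have h1 : ‖g (ℓ q) - g (ℓ q - s • κ q)‖ ≤ C * ‖ℓ q - (ℓ q - s • κ q)‖ :=
    Convex.norm_image_sub_le_of_norm_fderiv_le (𝕜 := ℝ)
      (fun w _ => hg.1.differentiable (by simp) w) (fun w _ => by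
        have := hC w
        rwa [← zero_add 1, ← norm_iteratedFDeriv_fderiv, norm_iteratedFDeriv_zero] at this) convex_univ (mem_univ _) (mem_univ _)
  rw [sub_sub_cancel, norm_smul, Real.norm_of_nonneg hs.1.le] at h1
  rw [diffQuot, norm_smul, norm_inv, Real.norm_of_nonneg hs.1.le, inv_mul_le_iff₀ hs.1]
  linarith

/-- The factor `s⁻¹` cancels against the `s` in front of `κ`. What is left is a difference quotient
of `Dg` and a term without negative powers of `s`, which permits estimates uniform as `s → 0`. -/
theorem fderiv_diffQuot (ℓ κ : Q →L[ℝ] W) {g : W → F} (hg : ContDiff ℝ ∞ g) {s : ℝ} (hs : s ≠ 0)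
    (q : Q) : fderiv ℝ (diffQuot ℓ κ g s) q =
      (diffQuot ℓ κ (fderiv ℝ g) s q).comp ℓ + (fderiv ℝ g (ℓ q - s • κ q)).comp κ := by
  have hd : ∀ w, HasFDerivAt g (fderiv ℝ g w) w := fun w =>
    (hg.differentiable (by simp) w).hasFDerivAt
  have h1 : HasFDerivAt (diffQuot ℓ κ g s) (s⁻¹ • ((fderiv ℝ g (ℓ q)).comp ℓ -
      (fderiv ℝ g (ℓ q - s • κ q)).comp (ℓ - s • κ))) q :=
    (((hd (ℓ q)).comp q ℓ.hasFDerivAt).sub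
      ((hd (ℓ q - s • κ q)).comp q (ℓ - s • κ).hasFDerivAt)).const_smul s⁻¹
  rw [h1.fderiv]
  ext v
  simp [diffQuot, smul_sub, hs]
  abel

/-- Induction through `fderiv_diffQuot`, with base case the mean value inequality. The target space
is quantified inside because `g` is replaced by its derivative. -/
theorem PosBounded.exists_bound_diffQuot (ℓ κ : Q →L[ℝ] W) (n : ℕ) :
    ∀ (F : Type) [NormedAddCommGroup F] [NormedSpace ℝ F] {g : W → F}, PosBounded g →
      ∃ C : ℝ, 0 ≤ C ∧ ∀ s ∈ Ioc (0 : ℝ) 1, ∀ q,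
        ‖iteratedFDeriv ℝ n (diffQuot ℓ κ g s) q‖ ≤ C * (1 + ‖κ q‖) := by
  induction n with
  | zero =>
    intro F _ _ g hg
    obtain ⟨C, hC, h⟩ := hg.exists_bound_diffQuot_zero ℓ κ
    refine ⟨C, hC, fun s hs q => ?_⟩
    rw [norm_iteratedFDeriv_zero]
    exact (h s hs q).trans (mul_le_mul_of_nonneg_left (by linarith) hC)
  | succ n ih =>
    intro F _ _ g hg
    obtain ⟨C, hC, h⟩ := ih (W →L[ℝ] F) hg.fderiv
    obtain ⟨D, hD⟩ := exists_bound_comp_sub_smul ℓ κ (hg.1.fderiv_right (m := ∞) (by simp)) n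
      (by simpa only [norm_iteratedFDeriv_fderiv] using hg.2 (n + 1) (by omega))
    have hD0 : 0 ≤ D := (norm_nonneg _).trans (hD 1 ⟨one_pos, le_rfl⟩ 0)
    let T : (Q →L[ℝ] W) → (W →L[ℝ] F) →L[ℝ] (Q →L[ℝ] F) :=
      fun ℓ => (ContinuousLinearMap.compL ℝ Q W F).flip ℓ
    refine ⟨‖T ℓ‖ * C + ‖T κ‖ * D, by positivity, fun s hs q => ?_⟩
    have e : _root_.fderiv ℝ (diffQuot ℓ κ g s) = (fun q => T ℓ (diffQuot ℓ κ (_root_.fderiv ℝ g) s q)) +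
        fun q => T κ (_root_.fderiv ℝ g (ℓ q - s • κ q)) :=
      funext fun q => fderiv_diffQuot ℓ κ hg.1 hs.1.ne' q
    have c1 : ContDiff ℝ ∞ (diffQuot ℓ κ (_root_.fderiv ℝ g) s) := contDiff_diffQuot ℓ κ hg.fderiv.1 s
    have c2 : ContDiff ℝ ∞ fun q => _root_.fderiv ℝ g (ℓ q - s • κ q) := hg.fderiv.1.comp (by fun_prop)
    have d1 : ContDiff ℝ n fun q => T ℓ (diffQuot ℓ κ (_root_.fderiv ℝ g) s q) :=
      ((T ℓ).contDiff.comp c1).of_le (by exact_mod_cast le_top)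
    have d2 : ContDiff ℝ n fun q => T κ (_root_.fderiv ℝ g (ℓ q - s • κ q)) :=
      ((T κ).contDiff.comp c2).of_le (by exact_mod_cast le_top)
    rw [← norm_iteratedFDeriv_fderiv, e, iteratedFDeriv_add_apply d1.contDiffAt d2.contDiffAt]
    refine (norm_add_le _ _).trans ?_
    have b1 := (norm_iteratedFDeriv_clm_comp_le (T ℓ) c1 n q).trans
      (mul_le_mul_of_nonneg_left (h s hs q) (norm_nonneg _))
    have b2 := (norm_iteratedFDeriv_clm_comp_le (T κ) c2 n q).trans
      (mul_le_mul_of_nonneg_left (hD s hs q) (norm_nonneg _))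
    have b3 : ‖T κ‖ * D ≤ ‖T κ‖ * D * (1 + ‖κ q‖) :=
      le_mul_of_one_le_right (by positivity) (by simp)
    calc _ ≤ _ := add_le_add b1 b2
      _ ≤ _ := by linarith

theorem norm_iteratedFDeriv_prodMk_le {E F : Type*} [NormedAddCommGroup E] [NormedSpace ℝ E]
    [NormedAddCommGroup F] [NormedSpace ℝ F] {f : Q → E} {g : Q → F} (hf : ContDiff ℝ ∞ f)
    (hg : ContDiff ℝ ∞ g) (n : ℕ) (q : Q) :
    ‖iteratedFDeriv ℝ n (fun q => (f q, g q)) q‖ ≤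
      ‖iteratedFDeriv ℝ n f q‖ + ‖iteratedFDeriv ℝ n g q‖ := by
  rw [iteratedFDeriv_prodMk hf.contDiffAt hg.contDiffAt (by exact_mod_cast le_top),
    ContinuousMultilinearMap.opNorm_prod]
  exact max_le_add_of_nonneg (norm_nonneg _) (norm_nonneg _)

variable {N : ℕ}

/-- The map `(x, v) ↦ (x, x)`. -/
def diagCLM (N : ℕ) : Eucl N × Eucl N →L[ℝ] Eucl N × Eucl N :=
  (ContinuousLinearMap.fst ℝ (Eucl N) (Eucl N)).prod (ContinuousLinearMap.fst ℝ (Eucl N) (Eucl N))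

/-- The map `(x, v) ↦ (0, v)`. -/
def dirCLM (N : ℕ) : Eucl N × Eucl N →L[ℝ] Eucl N × Eucl N :=
  (ContinuousLinearMap.inr ℝ (Eucl N) (Eucl N)).comp (ContinuousLinearMap.snd ℝ (Eucl N) (Eucl N))

theorem norm_dirCLM (q : Eucl N × Eucl N) : ‖dirCLM N q‖ = ‖q.2‖ := by
  simp [dirCLM, Prod.norm_def]

/-- The change of variables `(x, v) ↦ (z, (x - z) / s, v)`, where `z = z (x, x - s v)`. -/
def rescaleMap (z : Eucl N × Eucl N → Eucl N) (s : ℝ) (q : Eucl N × Eucl N) :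
    Eucl N × Eucl N × Eucl N :=
  (z (diagCLM N q - s • dirCLM N q), diffQuot (diagCLM N) (dirCLM N) z s q, q.2)

/-- The base point `z` may be unbounded, but the bounds on `K` are uniform in it. The second
argument of `K` is at most a constant times `‖v‖`, and the derivatives of positive order of the
substitution are `O(1 + ‖v‖)`; both are absorbed by the rapid decay of `K` in its last argument. -/
theorem unifSchwartz_comp_rescaleMap {z : Eucl N × Eucl N → Eucl N} (hz : PosBounded z)
    {K : Eucl N × Eucl N × Eucl N → ℂ}
    (hK : UnifRapid (fun q : Eucl N × Eucl N × Eucl N => 1 + ‖q.2.1‖) (fun q => 1 + ‖q.2.2‖)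
      (fun _ : Unit => K)) :
    UnifSchwartz (fun (s : Ioc (0 : ℝ) 1) q => K (rescaleMap z s q)) := by
  have c1 : ∀ s : ℝ, ContDiff ℝ ∞ fun q => z (diagCLM N q - s • dirCLM N q) := fun s =>
    hz.1.comp (by fun_prop)
  have c2 := contDiff_diffQuot (diagCLM N) (dirCLM N) hz.1
  refine UnifRapid.comp (ρ := fun _ : Eucl N × Eucl N => 1) (η := fun q => 1 + ‖q.2‖)
    (Φ := fun (s : Ioc (0 : ℝ) 1) q => rescaleMap z s q)
    (fun _ => le_rfl) (fun q => one_le_one_add_norm q.2) (fun q => one_le_one_add_norm q.2.1)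
    (fun q => one_le_one_add_norm q.2.2) (hK.reindex fun _ => ())
    (fun s => (c1 s).prodMk ((c2 s).prodMk contDiff_snd)) (fun n hn => ?_) ?_
    ⟨1, fun s q => (one_mul _).ge⟩
  · obtain ⟨C, hC⟩ := exists_bound_comp_sub_smul (diagCLM N) (dirCLM N) hz.1 n (hz.2 n hn)
    obtain ⟨D, -, hD⟩ := PosBounded.exists_bound_diffQuot (diagCLM N) (dirCLM N) n _ hz
    have hC0 : 0 ≤ C := (norm_nonneg _).trans (hC 1 ⟨one_pos, le_rfl⟩ 0)
    refine ⟨1, C + (D + ‖ContinuousLinearMap.snd ℝ (Eucl N) (Eucl N)‖), fun s q => ?_⟩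
    have b1 := hC s s.2 q
    have b2 := hD s s.2 q
    have b3 := norm_iteratedFDeriv_clm_le (ContinuousLinearMap.snd ℝ (Eucl N) (Eucl N)) hn q
    rw [norm_dirCLM] at b2
    have h1 : 1 ≤ 1 + ‖q.2‖ := one_le_one_add_norm q.2
    refine (norm_iteratedFDeriv_prodMk_le (c1 s) ((c2 s).prodMk contDiff_snd) n q).trans ?_
    refine (add_le_add b1 ((norm_iteratedFDeriv_prodMk_le (c2 s) contDiff_snd n q).trans
      (add_le_add b2 b3))).trans ?_
    rw [one_mul, pow_one, add_mul, add_mul]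
    have h2 := le_mul_of_one_le_right hC0 h1
    have h3 := le_mul_of_one_le_right
      (norm_nonneg (ContinuousLinearMap.snd ℝ (Eucl N) (Eucl N))) h1
    linarith
  · obtain ⟨C, hC0, hC⟩ := hz.exists_bound_diffQuot_zero (diagCLM N) (dirCLM N)
    refine ⟨1, 1 + C, fun s q => ?_⟩
    have h1 := hC s s.2 q
    rw [norm_dirCLM] at h1
    simp only [rescaleMap, one_mul, pow_one]
    nlinarith [norm_nonneg q.2]

end Rescaling

/-! ### From uniformly Schwartz kernels to symbols in `S^{-∞}`. -/

section Symbol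

open SchwartzMap FourierTransform

/-- The iterated directional derivative `∂_{v₁} ⋯ ∂_{vᵣ} g`. -/
def dirDeriv {Q F : Type*} [NormedAddCommGroup Q] [NormedSpace ℝ Q] [NormedAddCommGroup F]
    [NormedSpace ℝ F] (vs : List Q) (g : Q → F) : Q → F :=
  vs.foldr (fun v g q => fderiv ℝ g q v) g

theorem UnifRapid.dirDeriv {ι Q F : Type*} [NormedAddCommGroup Q] [NormedSpace ℝ Q]
    [NormedAddCommGroup F] [NormedSpace ℝ F] {ρ η : Q → ℝ} {f : ι → Q → F}
    (hf : UnifRapid ρ η f) (hη : ∀ q, 1 ≤ η q) (vs : List Q) :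
    UnifRapid ρ η (fun i => dirDeriv vs (f i)) := by
  induction vs with
  | nil => exact hf
  | cons v vs ih => exact ih.fderiv_apply hη v

variable {N : ℕ}

theorem contDiff_dirDeriv {Q F : Type*} [NormedAddCommGroup Q] [NormedSpace ℝ Q]
    [NormedAddCommGroup F] [NormedSpace ℝ F] {g : Q → F} (hg : ContDiff ℝ ∞ g) (vs : List Q) :
    ContDiff ℝ ∞ (dirDeriv vs g) := by
  induction vs with
  | nil => exact hg
  | cons v vs ih => exact (ih.fderiv_right (m := ∞) (by simp)).clm_apply contDiff_const

theorem iterPartialD_snd {G : Eucl N × Eucl N → ℂ} (hG : ContDiff ℝ ∞ G) (J : List (Fin N))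
    (x ξ : Eucl N) : iterPartialD J (fun ξ => G (x, ξ)) ξ =
      dirDeriv (J.map fun j => (0, EuclideanSpace.single j (1 : ℝ))) G (x, ξ) := by
  induction J generalizing ξ with
  | nil => rfl
  | cons j J ih =>
    have h1 : iterPartialD J (fun ξ => G (x, ξ)) = fun ξ =>
        dirDeriv (J.map fun j => (0, EuclideanSpace.single j (1 : ℝ))) G (x, ξ) := funext ih
    have h2 := ((contDiff_dirDeriv hG (J.map fun j => (0, EuclideanSpace.single j (1 : ℝ))))
      |>.differentiable (by simp) (x, ξ)).hasFDerivAt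
    have h3 := h2.comp ξ (hasFDerivAt_prodMk_right (𝕜 := ℝ) x ξ)
    change partialD j (iterPartialD J fun ξ => G (x, ξ)) ξ = fderiv ℝ (dirDeriv
      (J.map fun j => (0, EuclideanSpace.single j (1 : ℝ))) G) (x, ξ) (0, EuclideanSpace.single j 1)
    rw [h1, partialD]
    refine (congrArg (fun T => T (EuclideanSpace.single j (1 : ℝ))) h3.fderiv).trans ?_
    simp

theorem iterPartialD_fst {G : Eucl N × Eucl N → ℂ} (hG : ContDiff ℝ ∞ G) (J : List (Fin N))
    (x ξ : Eucl N) : iterPartialD J (fun x => G (x, ξ)) x =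
      dirDeriv (J.map fun j => (EuclideanSpace.single j (1 : ℝ), 0)) G (x, ξ) := by
  induction J generalizing x with
  | nil => rfl
  | cons j J ih =>
    have h1 : iterPartialD J (fun x => G (x, ξ)) = fun x =>
        dirDeriv (J.map fun j => (EuclideanSpace.single j (1 : ℝ), 0)) G (x, ξ) := funext ih
    have h2 := ((contDiff_dirDeriv hG (J.map fun j => (EuclideanSpace.single j (1 : ℝ), 0)))
      |>.differentiable (by simp) (x, ξ)).hasFDerivAt
    have h3 := h2.comp x (hasFDerivAt_prodMk_left (𝕜 := ℝ) x ξ)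
    change partialD j (iterPartialD J fun x => G (x, ξ)) x = fderiv ℝ (dirDeriv
      (J.map fun j => (EuclideanSpace.single j (1 : ℝ), 0)) G) (x, ξ) (EuclideanSpace.single j 1, 0)
    rw [h1, partialD]
    refine (congrArg (fun T => T (EuclideanSpace.single j (1 : ℝ))) h3.fderiv).trans ?_
    simp

theorem mixedD_eq {G : Eucl N × Eucl N → ℂ} (hG : ContDiff ℝ ∞ G) (I J : List (Fin N))
    (x ξ : Eucl N) : mixedD I J (fun x ξ => G (x, ξ)) x ξ =
      dirDeriv (I.map fun j => (EuclideanSpace.single j (1 : ℝ), 0))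
        (dirDeriv (J.map fun j => (0, EuclideanSpace.single j (1 : ℝ))) G) (x, ξ) := by
  rw [mixedD]
  simp only [iterPartialD_snd hG]
  exact iterPartialD_fst (contDiff_dirDeriv hG _) I x ξ

theorem one_le_japanese (ξ : Eucl N) : 1 ≤ japanese ξ :=
  Real.one_le_sqrt.2 (by linarith [sq_nonneg ‖ξ‖])

theorem japanese_le (ξ : Eucl N) : japanese ξ ≤ 1 + ‖ξ‖ :=
  Real.sqrt_le_iff.2 ⟨by positivity, by nlinarith [norm_nonneg ξ]⟩

theorem uniformlyBounded_of_unifSchwartz {J : Set ℝ} {a : ℝ → Eucl N × Eucl N → ℂ}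
    (ha : UnifSchwartz (fun s : J => a s)) :
    UniformlyBoundedInSNegInfty J (fun s x ξ => a s (x, ξ)) := by
  refine ⟨fun s hs => ha.1 ⟨s, hs⟩, fun m I I' => ?_⟩
  have hη : ∀ q : Eucl N × Eucl N, 1 ≤ 1 + ‖q.2‖ := fun q => one_le_one_add_norm q.2
  have h1 : UnifSchwartz (fun s : J => dirDeriv (I.map fun j => (EuclideanSpace.single j (1 : ℝ), 0))
      (dirDeriv (I'.map fun j => (0, EuclideanSpace.single j (1 : ℝ))) (a s))) :=
    (UnifRapid.dirDeriv ha hη _).dirDeriv hη _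
  -- A negative exponent is replaced by 0, which only enlarges the weight because `japanese ξ ≥ 1`.
  obtain ⟨C, -, hC⟩ := h1.exists_bound 0 ((I'.length : ℤ) - m).toNat
  refine ⟨C, fun s hs x ξ => ?_⟩
  have h2 := hC ⟨s, hs⟩ (x, ξ)
  rw [norm_iteratedFDeriv_zero] at h2
  rw [mixedD_eq (ha.1 ⟨s, hs⟩)]
  refine le_trans (mul_le_mul_of_nonneg_right ?_ (norm_nonneg _)) h2
  calc japanese ξ ^ ((I'.length : ℤ) - m)
      ≤ japanese ξ ^ ((((I'.length : ℤ) - m).toNat : ℕ) : ℤ) :=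
        zpow_le_zpow_right₀ (one_le_japanese ξ) (Int.self_le_toNat _)
    _ = japanese ξ ^ ((I'.length : ℤ) - m).toNat := zpow_natCast _ _
    _ ≤ (1 + ‖ξ‖) ^ ((I'.length : ℤ) - m).toNat :=
        pow_le_pow_left₀ (zero_le_one.trans (one_le_japanese ξ)) (japanese_le ξ) _

theorem fourierHat_eq (u : 𝓢(Eucl N, ℂ)) (ξ : Eucl N) :
    fourierHat u ξ = 𝓕 u ((2 * Real.pi)⁻¹ • ξ) := by
  rw [fourierHat, SchwartzMap.fourier_coe, Real.fourier_eq']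
  refine integral_congr_ae (.of_forall fun x => ?_)
  simp only [smul_eq_mul, inner_smul_right, real_inner_comm x ξ]
  congr 2
  push_cast
  field_simp

/-- The dilated convolution with kernel `h` as a pseudodifferential operator. -/
theorem psdo_fourier_slice {h : 𝓢(Eucl N, ℂ)} {a : Eucl N → ℂ} {s : ℝ} (hs : 0 < s) (x : Eucl N)
    (ha : ∀ ξ, a ξ = 𝓕 h ((2 * Real.pi)⁻¹ • ξ)) (u : 𝓢(Eucl N, ℂ)) :
    (((2 * Real.pi) ^ N)⁻¹ : ℝ) *
      ∫ ξ, Complex.exp (Complex.I * (inner ℝ x ξ : ℝ)) * a (s • ξ) * fourierHat u ξ =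
      ((s ^ N)⁻¹ : ℝ) * ∫ y, h (s⁻¹ • (x - y)) * u y := by
  have hpi : 0 < 2 * Real.pi := by positivity
  have hfr : Module.finrank ℝ (Eucl N) = N := finrank_euclideanSpace_fin
  -- This function is chosen so that its Fourier transform at `v` is `s ^ N * u (x - s • v)`. The
  -- identity `∫ 𝓕 h * g = ∫ h * 𝓕 g` then turns the symbol integral into the convolution.
  let g : Eucl N → ℂ := fun η =>
    Complex.exp (2 * Real.pi * inner ℝ η (s⁻¹ • x) * Complex.I) * 𝓕 u (s⁻¹ • η)
  have hgi : Integrable g := by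
    refine ((𝓕 u).integrable.comp_smul (inv_ne_zero hs.ne')).bdd_mul (c := 1)
      (Continuous.aestronglyMeasurable (by fun_prop)) (.of_forall fun η => ?_)
    have := Complex.norm_exp_ofReal_mul_I (2 * Real.pi * inner ℝ η (s⁻¹ • x))
    push_cast at this
    exact this.le
  have hg : ∀ v, 𝓕 g v = (s ^ N : ℝ) * u (x - s • v) := fun v => by
    have h1 : u (x - s • v) = ∫ ξ, Complex.exp (2 * Real.pi * inner ℝ ξ (x - s • v) * Complex.I) *
        𝓕 u ξ := by
      have h2 : u = 𝓕⁻ (𝓕 u) := (FourierTransform.fourierInv_fourier_eq (F := 𝓢(Eucl N, ℂ)) u).symm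
      conv_lhs => rw [h2]
      rw [SchwartzMap.fourierInv_coe, Real.fourierInv_eq']
      simp
    have h3 := Measure.integral_comp_inv_smul_of_nonneg (volume : Measure (Eucl N))
      (fun ξ => Complex.exp (2 * Real.pi * inner ℝ ξ (x - s • v) * Complex.I) * 𝓕 u ξ) hs.le
    rw [hfr, ← h1, Complex.real_smul] at h3
    rw [← h3, Real.fourier_eq']
    refine integral_congr_ae (.of_forall fun η => ?_)
    simp only [smul_eq_mul, g]
    rw [← mul_assoc, ← Complex.exp_add]
    congr 2
    simp only [inner_smul_left, inner_smul_right, inner_sub_right]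
    push_cast
    have : (s : ℂ) ≠ 0 := by exact_mod_cast hs.ne'
    simp
    field_simp
    ring
  have key : ∫ η, 𝓕 h η * g η = ∫ v, h v * 𝓕 g v := by
    simpa using! VectorFourier.integral_fourierIntegral_smul_eq_flip (L := innerₗ (Eucl N))
      Real.continuous_fourierChar continuous_inner h.integrable hgi
  have e1 : ∫ ξ, Complex.exp (Complex.I * (inner ℝ x ξ : ℝ)) * a (s • ξ) * fourierHat u ξ =
      (((2 * Real.pi) * s⁻¹) ^ N : ℝ) * ∫ η, 𝓕 h η * g η := by
    -- The substitution `η = s ξ / (2π)` combines the dilation with the passage between the two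
    -- normalisations of the Fourier transform.
    have h3 := Measure.integral_comp_inv_smul_of_nonneg (volume : Measure (Eucl N))
      (fun η => 𝓕 h η * g η) (R := (2 * Real.pi) * s⁻¹) (by positivity)
    rw [hfr, Complex.real_smul] at h3
    rw [← h3]
    refine integral_congr_ae (.of_forall fun ξ => ?_)
    have h4 : ((2 * Real.pi) * s⁻¹)⁻¹ = (2 * Real.pi)⁻¹ * s := by rw [mul_inv, inv_inv]
    simp only [g, ha, fourierHat_eq, h4, smul_smul]
    have h5 : s⁻¹ * ((2 * Real.pi)⁻¹ * s) = (2 * Real.pi)⁻¹ := by field_simp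
    rw [h5]
    have h6 : (2 * Real.pi * inner ℝ (((2 * Real.pi)⁻¹ * s) • ξ) (s⁻¹ • x) * Complex.I : ℂ) =
        Complex.I * (inner ℝ x ξ : ℝ) := by
      rw [inner_smul_left, inner_smul_right, real_inner_comm]
      have : (s : ℂ) ≠ 0 := by exact_mod_cast hs.ne'
      have : (Real.pi : ℂ) ≠ 0 := by exact_mod_cast Real.pi_ne_zero
      simp
      field_simp
    rw [h6]
    ring
  have e2 : ∫ y, h (s⁻¹ • (x - y)) * u y = (s ^ N : ℝ) * ∫ v, h v * u (x - s • v) := by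
    have h3 := Measure.integral_comp_inv_smul_of_nonneg (volume : Measure (Eucl N))
      (fun v => h v * u (x - s • v)) hs.le
    rw [hfr, Complex.real_smul] at h3
    rw [← h3, ← integral_sub_left_eq_self _ _ x]
    refine integral_congr_ae (.of_forall fun y => ?_)
    simp [smul_smul, hs.ne']
  rw [e1, e2, key]
  simp only [hg]
  have e3 : ∫ v, h v * ((s ^ N : ℝ) * u (x - s • v)) = (s ^ N : ℝ) * ∫ v, h v * u (x - s • v) := by
    rw [← integral_const_mul]
    exact integral_congr_ae (.of_forall fun v => by ring)
  rw [e3]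
  have : (s : ℂ) ≠ 0 := by exact_mod_cast hs.ne'
  have : (Real.pi : ℂ) ≠ 0 := by exact_mod_cast Real.pi_ne_zero
  push_cast
  simp only [mul_pow, inv_pow]
  field_simp

end Symbol

/-! ### The rescaled kernel and its symbol. -/

section Main

open SchwartzMap FourierTransform

variable {N : ℕ}

theorem Admissible.posBounded {z : Eucl N → Eucl N → Eucl N} (hz : Admissible z) :
    PosBounded fun q : Eucl N × Eucl N => z q.1 q.2 :=
  ⟨hz.1, hz.2.2⟩

/-- With `v = (x - y)/s` the point `(x, x - s v)` is `(x, y)`, and `z(x, x) = x` identifies `(x -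
z)/s` with the difference quotient of `z`. The difference of the two dilated points is `v` itself.
-/
theorem rescaledKernel_eq {p : ℝ≥0∞} {L : SecondOrderOp N} {k : ℕ} {α : Fin k → ℕ}
    {K : Eucl N × Eucl N × Eucl N → ℂ}
    (hK : ∀ w, IsSmoothKernel (Lam p L α w) (fun x y => K (w, x - w, x - y)))
    {z : Eucl N → Eucl N → Eucl N} (hz : Admissible z) {s : ℝ} (hs : s ≠ 0) (x y : Eucl N) :
    rescaledKernel p L α z s x y =
      ((s ^ N)⁻¹ : ℝ) * K (rescaleMap (fun q => z q.1 q.2) s (x, s⁻¹ • (x - y))) := by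
  have h1 : diagCLM N (x, s⁻¹ • (x - y)) - s • dirCLM N (x, s⁻¹ • (x - y)) = (x, y) := by
    simp [diagCLM, dirCLM, smul_smul, hs]
  have h2 : diagCLM N (x, s⁻¹ • (x - y)) = (x, x) := rfl
  rw [rescaledKernel, (hK _).kernelOf_eq]
  simp only [rescaleMap, diffQuot, h1]
  simp only [h2, hz.2.1]
  congr 3
  rw [add_sub_cancel_left]
  congr 1
  rw [add_sub_add_left_eq_sub, ← smul_sub, sub_sub_sub_cancel_right]

theorem unifSchwartz_symbol {ι : Type} {H : ι → Eucl N × Eucl N → ℂ} (hH : UnifSchwartz H) :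
    UnifSchwartz fun i q => partialFourier (H i) (q.1, (2 * Real.pi)⁻¹ • q.2) := by
  have hpi : 0 < 2 * Real.pi := by positivity
  refine UnifRapid.comp_clm hH.partialFourier (fun _ => le_rfl)
    (fun q => one_le_one_add_norm q.2) (fun _ => le_rfl) (fun q => one_le_one_add_norm q.2)
    ((ContinuousLinearMap.fst ℝ (Eucl N) (Eucl N)).prod
      ((2 * Real.pi)⁻¹ • ContinuousLinearMap.snd ℝ (Eucl N) (Eucl N)))
    -- The constant compares the weights before and after the frequency is divided by `2π`: `1 + r ≤
    -- (1 + 2π)(1 + r/(2π))`.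
    ⟨0, 1, fun q => by simp⟩ ⟨1 + 2 * Real.pi, fun q => ?_⟩
  simp only [ContinuousLinearMap.prod_apply, _root_.smul_apply,
    ContinuousLinearMap.coe_snd', norm_smul, norm_inv, Real.norm_of_nonneg hpi.le]
  have h1 : 0 ≤ (2 * Real.pi)⁻¹ * ‖q.2‖ := by positivity
  have h2 : ‖q.2‖ = 2 * Real.pi * ((2 * Real.pi)⁻¹ * ‖q.2‖) := by field_simp
  nlinarith

end Main
end DysonTaylor

end

theorem mainTheorem4 {N : ℕ} (p : ENNReal) (hp : 1 < p) (hp' : p < ⊤)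
    (γ : ℝ) (hγ : 0 < γ) (L : DysonTaylor.SecondOrderOp N) (hL : L.IsElliptic γ)
    (n k l : ℕ) (hk : 1 ≤ k) (hkn : k ≤ n)
    (α : Fin k → ℕ) (hα : α ∈ DysonTaylor.indexSet k l) (hαn : ∀ j, α j ≤ n)
    (z : Eucl N → Eucl N → Eucl N) (hz : DysonTaylor.Admissible z) :
    -- the operators `Λ_{α,w}` are well defined and have smooth kernels
    (∀ w : Eucl N,
      (∀ (f : SchwartzMap (Eucl N) ℂ) (x : Eucl N),
        MeasureTheory.IntegrableOn (fun σ => DysonTaylor.dysonIntegrand p L α w σ f x)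
          (DysonTaylor.simplex k) MeasureTheory.volume) ∧
      DysonTaylor.IsSmoothKernel (DysonTaylor.Lam p L α w)
        (DysonTaylor.kernelOf (DysonTaylor.Lam p L α w))) ∧
    -- `𝓛_{s,α} = b_s(x, D)` with `b_s(x, ξ) = a_s(x, s ξ)`
    ∃ a : ℝ → Eucl N → Eucl N → ℂ,
      DysonTaylor.UniformlyBoundedInSNegInfty (Set.Ioc 0 1) a ∧
      ∀ s ∈ Set.Ioc (0 : ℝ) 1, ∀ (u : SchwartzMap (Eucl N) ℂ) (x : Eucl N),
        MeasureTheory.Integrable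
          (fun y => DysonTaylor.rescaledKernel p L α z s x y * u y) MeasureTheory.volume ∧
        DysonTaylor.rescaledOp p L α z s u x
          = DysonTaylor.psdo (fun x ξ => a s x (s • ξ)) u x := by
  open DysonTaylor in
  obtain ⟨K, hK, hΛ⟩ := exists_kernel_Lam hp hp' hγ hL α
  have hH := unifSchwartz_comp_rescaleMap hz.posBounded hK
  -- The symbol is the Fourier transform in `v` of `K (rescaleMap z s (x, v))`. Evaluation at `ξ /
  -- (2π)` converts the character `e^{-2πi v·ξ}` to `e^{-i v·ξ}`.
  refine ⟨fun w => ⟨(hΛ w).1, by rw [(hΛ w).2.kernelOf_eq]; exact (hΛ w).2⟩,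
    fun s x ξ => partialFourier (fun q => K (rescaleMap (fun q => z q.1 q.2) s q))
      (x, (2 * Real.pi)⁻¹ • ξ),
    uniformlyBounded_of_unifSchwartz (a := fun s q => partialFourier
      (fun q => K (rescaleMap (fun q => z q.1 q.2) s q)) (q.1, (2 * Real.pi)⁻¹ • q.2))
      (unifSchwartz_symbol hH), fun s hs u x => ?_⟩
  have hker : ∀ y, rescaledKernel p L α z s x y =
      ((s ^ N)⁻¹ : ℝ) * hH.slice (⟨s, hs⟩, x) (s⁻¹ • (x - y)) :=
    rescaledKernel_eq (fun w => (hΛ w).2) hz hs.1.ne' x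
  obtain ⟨C, hC⟩ : ∃ C, ∀ v, ‖hH.slice (⟨s, hs⟩, x) v‖ ≤ C := by
    obtain ⟨C, -, hC⟩ := (hH.slice (⟨s, hs⟩, x)).decay 0 0
    exact ⟨C, fun v => by simpa using hC v⟩
  constructor
  · simp only [hker, mul_assoc]
    refine (u.integrable.bdd_mul (c := C) (Continuous.aestronglyMeasurable ?_)
      (.of_forall fun y => hC _)).const_mul _
    exact (hH.slice (⟨s, hs⟩, x)).continuous.comp (by fun_prop)
  · rw [rescaledOp, psdo, psdo_fourier_slice (h := hH.slice (⟨s, hs⟩, x)) (a := fun ξ =>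
      partialFourier (fun q => K (rescaleMap (fun q => z q.1 q.2) s q))
        (x, (2 * Real.pi)⁻¹ • ξ)) hs.1 x (fun ξ => rfl) u, ← integral_const_mul]
    simp only [hker, mul_assoc]
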